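/- **Setting.** Consider the system $$\dot x=Ax,\qquad \dot\theta=-k_pf(\theta,\omega,x)+\omega,\qquad \dot\omega=-k_if(\theta,\omega,x),\qquad f(\theta,\omega,x)=\frac{g(\theta,\omega)-h(\omega)^Tx}{\mu-\nu^Tx},$$ with $x\in\mathbb R^4$, $\theta,\omega\in\mathbb R$, $k_p,k_i>0$, $A$ Hurwitz, $\mu\ne0$, $\nu\in\mathbb R^4$, and $g:\mathbb R^2\to\mathbb R$, $h:\mathbb R\to\mathbb R^4$ continuously differentiable with $g(0,0)=0$. Assume that the Jacobian at the origin of the $(\theta,\omega)$-subsystem with $x=0$ has non-real eigenvalues with negative real parts. Let $\gamma>0$, let $P$ be symmetric positive definite with $A^TP+PA+\gamma P$ negative definite, and put $V^{CC}(x)=x^TPx$. For $V\ge0$ the *$V$-comparison system* is $\dot\theta=-k_pf_*+\omega$, $\dot\omega=-k_if_*$, where $f_*(\theta,\omega)$ is the minimum (if $\omega\ge0$) or the maximum (if $\omega<0$) of $f(\theta,\omega,x)$ over $\{x:V^{CC}(x)\le V\}$; its solutions are understood in the absolutely continuous sense. Let $0<\bar V<\bar{\bar V}$ be such that $\nu^Tx\ne\mu$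 whenever $V^{CC}(x)\le\bar{\bar V}$. Suppose that for every $V\in(0,\bar V]$ the $V$-comparison system has a limit cycle $C_V$, and that with $C_0=\{0\}$ the curves $C_V$ change smoothly with $V$: they have parametrizations $\sigma\mapsto\Gamma(V,\sigma)$ of period $1$, with $\Gamma$ continuous on $[0,\bar V]\times\mathbb R$ and $C^1$ on $(0,\bar V]\times\mathbb R$, which for $V>0$ are regular and injective on $[0,1)$. Let $\Lambda(V)$ be the closed region bounded by $C_V$, and define $V^{PLL}$ on $\Lambda(\bar V)$ by $V^{PLL}=V$ on $C_V$, $0\le V\le\bar V$. The *lock-in domain* of the origin is the set of initial states whose solution exists for all $t\ge0$, converges to the origin and does not cross the lines $\theta=\pm\pi$, i.e. satisfies $|\theta(t)|\le\pi$ for all $t\ge0$. **Theorem.** Suppose that $\Lambda(\bar V)$ is contained between the lines $\theta=\pm\pi$, i.e. $|\theta|\le\pi$ on $\Lambda(\bar V)$. Let $F:\mathbb R^2\to\mathbb R$ be a function such that $$\frac{dV^{PLL}}{dt}\le F(V^{PLL},V^{CC})$$ (upper derivative, one-sided at end points of time intervals) along all solutions of the system, on time intervals on which $(\theta,\omega)\in\Lambda(\bar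 V)$ and $V^{CC}(x)\le\bar{\bar V}$. Let $\Phi$ be a function on $[0,\bar{\bar V}]$ such that $\Phi(V)=\bar V$ on $[0,\bar V]$, such that $$\Phi'(V)=-\frac{F(\Phi(V),V)}{\gamma V}\quad\text{on }[\bar V,\bar{\bar V}],\qquad \Phi(\bar V)=\bar V$$ (with one-sided derivatives at the end points), such that $0<\Phi(V)\le\bar V$ for $\bar V\le V<\bar{\bar V}$, and such that $\Phi(\bar{\bar V})=0$. Then the set $$\{(\theta,\omega,x):\ (\theta,\omega)\in\Lambda(\bar V),\ V^{CC}(x)\le\bar{\bar V},\ V^{PLL}(\theta,\omega)\le\Phi(V^{CC}(x))\}$$ is forward invariant and contained in the lock-in domain of the origin. -/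

import Mathlib

open Set Filter Topology MeasureTheory Matrix

noncomputable section

/-- Data of the closed-loop error dynamics: a linear current controller `x' = A x` with `A`
Hurwitz, driving a planar phase-locked loop. -/
structure InverterSystem where
  kp : ℝ
  ki : ℝ
  μ : ℝ
  ν : Fin 4 → ℝ
  g : ℝ → ℝ → ℝ
  h : ℝ → Fin 4 → ℝ
  A : Matrix (Fin 4) (Fin 4) ℝ
  kp_pos : 0 < kp
  ki_pos : 0 < ki
  μ_ne_zero : μ ≠ 0
  g_zero : g 0 0 = 0
  g_smooth : ContDiff ℝ 1 (fun p : ℝ × ℝ => g p.1 p.2)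
  h_smooth : ContDiff ℝ 1 h
  hurwitz : ∀ z ∈ spectrum ℂ (A.map (algebraMap ℝ ℂ)), z.re < 0

namespace InverterSystem

/-- States `(θ, ω, x)`: phase-angle error, frequency error, current-controller state. -/
abbrev State : Type := ℝ × ℝ × (Fin 4 → ℝ)

variable (S : InverterSystem)

/-- `f(θ, ω, x) = (g(θ, ω) - h(ω)ᵀ x) / (μ - νᵀ x)`; meaningful only at nonsingular `x`. -/
def f (θ ω : ℝ) (x : Fin 4 → ℝ) : ℝ :=
  (S.g θ ω - S.h ω ⬝ᵥ x) / (S.μ - S.ν ⬝ᵥ x)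

/-- `x` is not a singularity of `f`. -/
def Nonsingular (x : Fin 4 → ℝ) : Prop := S.ν ⬝ᵥ x ≠ S.μ

/-- The right-hand side of the whole system. -/
def field (z : State) : State :=
  (-S.kp * S.f z.1 z.2.1 z.2.2 + z.2.1, -S.ki * S.f z.1 z.2.1 z.2.2, S.A *ᵥ z.2.2)

/-- `z` solves the whole system on the time interval `I`, in the region where it is defined
(derivatives at an end point of `I` are one-sided). -/
def IsSolutionOn (z : ℝ → State) (I : Set ℝ) : Prop :=
  ∀ t ∈ I, S.Nonsingular (z t).2.2 ∧ HasDerivWithinAt z (S.field (z t)) I t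

/-- The Jacobian at the origin of the phase-locked loop with `x = 0`. -/
def pllJacobian : Matrix (Fin 2) (Fin 2) ℝ :=
  !![-S.kp * deriv (fun θ => S.f θ 0 0) 0, 1 - S.kp * deriv (fun ω => S.f 0 ω 0) 0;
     -S.ki * deriv (fun θ => S.f θ 0 0) 0, -S.ki * deriv (fun ω => S.f 0 ω 0) 0]

/-- The eigenvalues of the Jacobian are non-real with negative real parts. -/
def OscillatoryStable : Prop :=
  ∀ z ∈ spectrum ℂ (S.pllJacobian.map (algebraMap ℝ ℂ)), z.re < 0 ∧ z.im ≠ 0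

/-- Forward invariance: every solution on `[0, T]` that starts in `W` stays in `W`. -/
def ForwardInvariant (W : Set State) : Prop :=
  ∀ (T : ℝ) (z : ℝ → State), S.IsSolutionOn z (Icc 0 T) → z 0 ∈ W → ∀ t ∈ Icc 0 T, z t ∈ W

/-- The lock-in domain of the origin: the initial states whose (unique) solution exists for all
`t ≥ 0`, converges to the origin and does not cross the lines `θ = π` and `θ = -π`. -/
def lockInDomain : Set State :=
  {z₀ | ∃ z : ℝ → State, S.IsSolutionOn z (Ici 0) ∧ z 0 = z₀ ∧ Tendsto z atTop (𝓝 0) ∧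
    ∀ t, 0 ≤ t → |(z t).1| ≤ Real.pi}

/-- An estimation of the lock-in domain: a forward-invariant subset of it. -/
def IsLockInEstimation (W : Set State) : Prop :=
  S.ForwardInvariant W ∧ W ⊆ S.lockInDomain

/-- `xᵀ P x` is a quadratic Lyapunov function of the current controller with decay rate `γ`. -/
def IsCCLyapunov (P : Matrix (Fin 4) (Fin 4) ℝ) (γ : ℝ) : Prop :=
  P.PosDef ∧ 0 < γ ∧ (-(S.Aᵀ * P + P * S.A + γ • P)).PosDef

end InverterSystem

/-- `V^CC(x) = xᵀ P x`. -/
def VCC (P : Matrix (Fin 4) (Fin 4) ℝ) (x : Fin 4 → ℝ) : ℝ := x ⬝ᵥ (P *ᵥ x)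

namespace InverterSystem

variable (S : InverterSystem) (P : Matrix (Fin 4) (Fin 4) ℝ)

/-- `f_*` of the `V`-comparison system: the minimum (for `ω ≥ 0`) or maximum (for `ω < 0`) of
`f(θ, ω, x)` over `V^CC(x) ≤ V`. -/
def fStar (V : ℝ) (p : ℝ × ℝ) : ℝ :=
  if 0 ≤ p.2 then sInf ((fun x => S.f p.1 p.2 x) '' {x | VCC P x ≤ V})
  else sSup ((fun x => S.f p.1 p.2 x) '' {x | VCC P x ≤ V})

/-- The right-hand side of the `V`-comparison system. -/
def compField (V : ℝ) (p : ℝ × ℝ) : ℝ × ℝ :=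
  (-S.kp * S.fStar P V p + p.2, -S.ki * S.fStar P V p)

/-- `C` is the trajectory of a non-constant periodic solution of the `V`-comparison system.
As the right-hand side is discontinuous on `ω = 0`, solutions are absolutely continuous
(Caratheodory) solutions, i.e. solutions of the integral equation; `T` is the least period. -/
def IsClosedOrbit (V : ℝ) (C : Set (ℝ × ℝ)) : Prop :=
  ∃ (T : ℝ) (u : ℝ → ℝ × ℝ), 0 < T ∧ Function.Periodic u T ∧ InjOn u (Ico 0 T) ∧
    (∀ t, IntervalIntegrable (fun s => S.compField P V (u s)) volume 0 t ∧
      u t = u 0 + ∫ s in (0 : ℝ)..t, S.compField P V (u s)) ∧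
    range u = C

/-- A limit cycle: an isolated closed orbit. -/
def IsLimitCycle (V : ℝ) (C : Set (ℝ × ℝ)) : Prop :=
  S.IsClosedOrbit P V C ∧
    ∃ U : Set (ℝ × ℝ), IsOpen U ∧ C ⊆ U ∧ ∀ C', S.IsClosedOrbit P V C' → C' ⊆ U → C' = C

/-- `C V`, `0 < V ≤ Vbar`, are limit cycles of the `V`-comparison systems; they reduce to the
zero equilibrium for `V = 0`, and they change smoothly with `V`: there is a parametrization
`Γ (V, σ)` of period `1` in `σ`, continuous up to `V = 0` and continuously differentiable for
`V > 0`, by regular simple closed curves. -/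
def IsLimitCycleFamily (Vbar : ℝ) (C : ℝ → Set (ℝ × ℝ)) : Prop :=
  C 0 = {0} ∧ (∀ V ∈ Ioc 0 Vbar, S.IsLimitCycle P V (C V)) ∧
    ∃ Γ : ℝ × ℝ → ℝ × ℝ,
      ContinuousOn Γ (Icc 0 Vbar ×ˢ univ) ∧
      ContDiffOn ℝ 1 Γ (Ioc 0 Vbar ×ˢ univ) ∧
      (∀ V ∈ Icc 0 Vbar, Function.Periodic (fun σ => Γ (V, σ)) 1 ∧
        range (fun σ => Γ (V, σ)) = C V) ∧
      (∀ V ∈ Ioc 0 Vbar, InjOn (fun σ => Γ (V, σ)) (Ico 0 1) ∧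
        ∀ σ, deriv (fun σ => Γ (V, σ)) σ ≠ 0)

end InverterSystem

/-- The closed region bounded by a closed curve `C`: the curve together with the bounded
connected components of its complement. `Λ(V)` is `closedRegion (C V)`. -/
def closedRegion (C : Set (ℝ × ℝ)) : Set (ℝ × ℝ) :=
  C ∪ {p | p ∉ C ∧ Bornology.IsBounded (connectedComponentIn Cᶜ p)}

/-- `V^PLL`: the value `V ∈ [0, Vbar]` such that `p` lies on the curve `C V`. It is only used
for `p ∈ Λ(Vbar)`. -/
def VPLL (Vbar : ℝ) (C : ℝ → Set (ℝ × ℝ)) (p : ℝ × ℝ) : ℝ :=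
  sInf {V | V ∈ Icc 0 Vbar ∧ p ∈ C V}

namespace InverterSystem

variable (S : InverterSystem) (P : Matrix (Fin 4) (Fin 4) ℝ)

/-- `dV^PLL/dt ≤ F(V^PLL, V^CC)` along the solutions of the system, as long as
`(θ, ω) ∈ Λ(Vbar)`, where `V^PLL` is defined, and `V^CC ≤ Vmax`. The derivative is the upper
one (limit superior of difference quotients, one-sided at the ends of the time interval), which
is the derivative whenever that exists. -/
def IsGrowthBound (Vbar Vmax : ℝ) (C : ℝ → Set (ℝ × ℝ)) (F : ℝ → ℝ → ℝ) : Prop :=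
  ∀ (t₀ t₁ : ℝ) (z : ℝ → State), S.IsSolutionOn z (Icc t₀ t₁) →
    (∀ t ∈ Icc t₀ t₁, ((z t).1, (z t).2.1) ∈ closedRegion (C Vbar) ∧ VCC P (z t).2.2 ≤ Vmax) →
    ∀ t ∈ Icc t₀ t₁, ∀ r, F (VPLL Vbar C ((z t).1, (z t).2.1)) (VCC P (z t).2.2) < r →
      ∀ᶠ τ in 𝓝[Icc t₀ t₁ \ {t}] t,
        slope (fun τ => VPLL Vbar C ((z τ).1, (z τ).2.1)) t τ < r

end InverterSystem

/-- The set `V^PLL(θ, ω) ≤ Φ(V^CC(x))`, within the domains `Λ(Vbar)` of `V^PLL` and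
`[0, Vmax]` of `Φ`. -/
def improvedSet (P : Matrix (Fin 4) (Fin 4) ℝ) (Vbar Vmax : ℝ) (C : ℝ → Set (ℝ × ℝ))
    (Φ : ℝ → ℝ) : Set InverterSystem.State :=
  {z | (z.1, z.2.1) ∈ closedRegion (C Vbar) ∧ VCC P z.2.2 ≤ Vmax ∧
    VPLL Vbar C (z.1, z.2.1) ≤ Φ (VCC P z.2.2)}

end

/-! In the sheared coordinate ψ = θ - κω with κ = k_p/k_i, the planar equations read ψ' = ω, ω' = α,
and x enters only through the acceleration α = -k_i f. While V^CC ≤ V, α lies between `accLo` and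
`accHi`, and the V-comparison system is the extremal choice: largest α above the line ω = 0,
smallest below it. As ψ is monotone on either side of that line, a closed orbit of the comparison
system is a pair of graphs U and -L over one interval (`ExtremalOrbit.exists_loop`), and its inside
is explicit. Above ω = 0 every admissible trajectory satisfies (ω² - U(ψ)²)' ≤ 2K|ω² - U(ψ)²|, so it
cannot cross U outwards; a half turn of the plane gives the same below. Hence the closed and the
open region bounded by C_V are invariant while V^CC ≤ V (`Traj.inRegion_of_inRegion`,
`Traj.inInner_of_inInner`).

For V' < V the cycle C_{V'} is itself admissible for the level V, so it lies inside C_V as soon as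
it meets Λ(V), unless it is contained in C_V. The latter is impossible because every cycle has a
point off ω = 0 where f really depends on x (`exists_nondegenerate`): there the extremal
accelerations of the two levels differ. Otherwise ν = 0 and h = 0 near ω = 0, all small cycles would
solve the same equation, and isolation of limit cycles would freeze the family, which must shrink to
the origin. Together with continuity in V this gives nesting and filling (`nested`,
`exists_mem_of_mem_region`), and V^PLL is well defined and continuous, with sublevel sets Λ(V).

At such a nondegenerate point of C_W, and for V > W, some x of level V accelerates the solution more
strongly than the W-comparison system allows. The solution then crosses C_W outwards with nonzero
speed, which forces F(W, V) > 0 for W < V < Vmax (`growth_pos`). So Φ decreases, and when V^PLL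
touches Φ(V^CC) while V^CC > Vbar, the bound (V^CC)' < -γ V^CC makes Φ(V^CC) increase strictly
faster than F allows V^PLL to. This is a strict barrier. For V^CC ≤ Vbar the barrier is Λ(Vbar)
itself, and the level V^CC = Vmax, where the planar state must be 0, follows by approximation from
lower levels.

On the invariant set V^CC tends to 0 exponentially. The invariance of all Λ(V) then makes V^PLL
converge to some m. If m > 0, a limit solution has x = 0 and stays on C_m. It runs along the whole
cycle, so its acceleration is extremal everywhere off the corners; but x = 0 is not extremal at a
nondegenerate point (`not_solution_on_cycle`). Hence m = 0, and the shrinking of the curves gives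
convergence to the origin. -/

noncomputable section

/-! ### Scalar comparison and local Lipschitz conditions. -/

/-- A scalar differential inequality `D' ≤ K |D|` preserves the signs `D ≤ 0` and `D < 0`. -/
lemma nonpos_and_neg_of_deriv_le_mul_abs {D D' : ℝ → ℝ} {s t K : ℝ} (hst : s ≤ t)
    (hc : ContinuousOn D (Icc s t)) (hd : ∀ r ∈ Ioo s t, HasDerivAt D (D' r) r)
    (hb : ∀ r ∈ Ioo s t, D' r ≤ K * |D r|) : (D s ≤ 0 → D t ≤ 0) ∧ (D s < 0 → D t < 0) := by
  have aux : ∀ t', t' ∈ Icc s t → D s ≤ 0 → D t' ≤ 0 := by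
    intro t' ht' hs
    by_contra! hpos
    -- The last time with D ≤ 0; after it |D| = D, so D times exp(-Kr) cannot increase.
    set Z := Icc s t' ∩ D ⁻¹' Iic 0
    have hc' : ContinuousOn D (Icc s t') := hc.mono (Icc_subset_Icc_right ht'.2)
    have hZ : IsClosed Z := hc'.preimage_isClosed_of_isClosed isClosed_Icc isClosed_Iic
    have hZc : IsCompact Z := isCompact_Icc.of_isClosed_subset hZ inter_subset_left
    have hne : Z.Nonempty := ⟨s, ⟨le_rfl, ht'.1⟩, hs⟩
    have hr := hZc.sSup_mem hne
    set r₀ := sSup Z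
    have hr0 : D r₀ ≤ 0 := hr.2
    have hlt : r₀ < t' := lt_of_le_of_ne hr.1.2 (fun h => by rw [h] at hr0; linarith)
    have hgt : ∀ r ∈ Ioc r₀ t', 0 < D r := by
      intro r hr'
      by_contra! h
      have : r ≤ r₀ := le_csSup hZc.bddAbove ⟨⟨hr.1.1.trans hr'.1.le, hr'.2⟩, h⟩
      exact absurd hr'.1 (not_lt.2 this)
    have hanti : AntitoneOn (fun r => D r * Real.exp (-K * r)) (Icc r₀ t') := by
      have hder : ∀ r ∈ Ioo r₀ t', HasDerivAt (fun r => D r * Real.exp (-K * r))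
          (D' r * Real.exp (-K * r) + D r * (Real.exp (-K * r) * (-K * 1))) r := fun r h =>
        (hd r ⟨hr.1.1.trans_lt h.1, h.2.trans_le ht'.2⟩).mul
          (((hasDerivAt_id r).const_mul (-K)).exp)
      refine antitoneOn_of_deriv_nonpos (convex_Icc _ _) ?_ ?_ ?_
      · exact (hc'.mono (Icc_subset_Icc_left hr.1.1)).mul (by fun_prop)
      · intro r h
        rw [interior_Icc] at h
        exact (hder r h).differentiableAt.differentiableWithinAt
      · intro r h
        rw [interior_Icc] at h
        rw [(hder r h).deriv]
        have h1 := hb r ⟨hr.1.1.trans_lt h.1, h.2.trans_le ht'.2⟩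
        rw [abs_of_pos (hgt r ⟨h.1, h.2.le⟩)] at h1
        nlinarith [Real.exp_pos (-K * r)]
    have := hanti ⟨le_rfl, hlt.le⟩ ⟨hlt.le, le_rfl⟩ hlt.le
    have h2 := Real.exp_pos (-K * t')
    have h3 := Real.exp_pos (-K * r₀)
    simp only at this
    nlinarith [mul_pos hpos h2]
  refine ⟨aux t ⟨hst, le_rfl⟩, fun hs => ?_⟩
  -- Now D ≤ 0 throughout, so |D| = -D and the integrating factor has the opposite sign.
  have hanti : AntitoneOn (fun r => D r * Real.exp (K * r)) (Icc s t) := by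
    have hder : ∀ r ∈ Ioo s t, HasDerivAt (fun r => D r * Real.exp (K * r))
        (D' r * Real.exp (K * r) + D r * (Real.exp (K * r) * (K * 1))) r := fun r h =>
      (hd r h).mul (((hasDerivAt_id r).const_mul K).exp)
    refine antitoneOn_of_deriv_nonpos (convex_Icc _ _) ?_ ?_ ?_
    · exact hc.mul (by fun_prop)
    · intro r h
      rw [interior_Icc] at h
      exact (hder r h).differentiableAt.differentiableWithinAt
    · intro r h
      rw [interior_Icc] at h
      rw [(hder r h).deriv]
      have h1 := hb r h
      rw [abs_of_nonpos (aux r (Ioo_subset_Icc_self h) hs.le)] at h1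
      nlinarith [Real.exp_pos (K * r)]
  have := hanti ⟨le_rfl, hst⟩ ⟨hst, le_rfl⟩ hst
  have h2 := Real.exp_pos (K * t)
  have h3 := Real.exp_pos (K * s)
  simp only at this
  by_contra! h
  nlinarith [mul_nonneg h h2.le, mul_pos (neg_pos.2 hs) h3]

/-- Local Lipschitz continuity of a function of two real variables. -/
def LocLip (φ : ℝ → ℝ → ℝ) : Prop :=
  ∀ R, ∃ K, 0 ≤ K ∧ ∀ s w s' w', |s| ≤ R → |w| ≤ R → |s'| ≤ R → |w'| ≤ R →
    |φ s w - φ s' w'| ≤ K * (|s - s'| + |w - w'|)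

lemma LocLip.reflect {φ : ℝ → ℝ → ℝ} (h : LocLip φ) : LocLip (fun s w => -φ (-s) (-w)) := by
  intro R
  obtain ⟨K, hK, h⟩ := h R
  refine ⟨K, hK, fun s w s' w' h1 h2 h3 h4 => ?_⟩
  have := h (-s) (-w) (-s') (-w') (by simpa) (by simpa) (by simpa) (by simpa)
  have e1 : |-s - -s'| = |s - s'| := by rw [← abs_neg]; ring_nf
  have e2 : |-w - -w'| = |w - w'| := by rw [← abs_neg]; ring_nf
  rw [e1, e2] at this
  rw [← abs_neg]
  convert this using 2
  ring

lemma LocLip.continuous {φ : ℝ → ℝ → ℝ} (h : LocLip φ) :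
    Continuous (fun p : ℝ × ℝ => φ p.1 p.2) := by
  rw [continuous_iff_continuousAt]
  intro p
  obtain ⟨K, hK, h⟩ := h (|p.1| + |p.2| + 1)
  rw [ContinuousAt, tendsto_iff_dist_tendsto_zero]
  have hlim : Tendsto (fun q : ℝ × ℝ => K * (|q.1 - p.1| + |q.2 - p.2|)) (𝓝 p) (𝓝 0) := by
    have : Continuous (fun q : ℝ × ℝ => K * (|q.1 - p.1| + |q.2 - p.2|)) := by fun_prop
    simpa using this.tendsto p
  refine squeeze_zero' (Eventually.of_forall fun _ => dist_nonneg) ?_ hlim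
  have h1 : ∀ᶠ q : ℝ × ℝ in 𝓝 p, |q.1| < |p.1| + |p.2| + 1 := by
    refine (continuous_fst.abs.tendsto p).eventually_lt_const ?_
    have := abs_nonneg p.2; linarith
  have h2 : ∀ᶠ q : ℝ × ℝ in 𝓝 p, |q.2| < |p.1| + |p.2| + 1 := by
    refine (continuous_snd.abs.tendsto p).eventually_lt_const ?_
    have := abs_nonneg p.1; linarith
  filter_upwards [h1, h2] with q h1 h2
  rw [Real.dist_eq]
  exact h _ _ _ _ h1.le h2.le (by have := abs_nonneg p.2; linarith)
    (by have := abs_nonneg p.1; linarith)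

/-! ### Loops in the plane (ψ, ω) and the trajectories compared with them. -/

/-- A closed orbit of `s' = w`, `w' = hi` for `w ≥ 0`, `w' = lo` for `w < 0`, written as the union
of the graphs of `U` and `-L` over `[a, b]`. -/
structure Loop (lo hi : ℝ → ℝ → ℝ) (a b : ℝ) (U L : ℝ → ℝ) : Prop where
  lt : a < b
  contU : ContinuousOn U (Icc a b)
  contL : ContinuousOn L (Icc a b)
  U_left : U a = 0
  U_right : U b = 0
  L_left : L a = 0
  L_right : L b = 0
  U_pos : ∀ s ∈ Ioo a b, 0 < U s
  L_pos : ∀ s ∈ Ioo a b, 0 < L s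
  derivU : ∀ s ∈ Ioo a b, HasDerivAt U (hi s (U s) / U s) s
  derivL : ∀ s ∈ Ioo a b, HasDerivAt L (lo s (-L s) / L s) s
  lo_left : 0 < lo a 0
  hi_right : hi b 0 < 0

/-- The closed region bounded by a loop. -/
def InRegion (a b : ℝ) (U L : ℝ → ℝ) (s w : ℝ) : Prop := a ≤ s ∧ s ≤ b ∧ -L s ≤ w ∧ w ≤ U s

/-- The open region bounded by a loop. -/
def InInner (a b : ℝ) (U L : ℝ → ℝ) (s w : ℝ) : Prop := a < s ∧ s < b ∧ -L s < w ∧ w < U s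

/-- The points of a loop. -/
def OnLoop (a b : ℝ) (U L : ℝ → ℝ) (s w : ℝ) : Prop := a ≤ s ∧ s ≤ b ∧ (w = U s ∨ w = -L s)

/-- A trajectory of the differential inclusion `s' = w`, `w' ∈ [lo, hi]`, differentiable off
`w = 0`, which crosses `w = 0` immediately wherever `lo` and `hi` have the same sign. -/
structure Traj (lo hi : ℝ → ℝ → ℝ) (ψ ω : ℝ → ℝ) (t₀ t₁ : ℝ) : Prop where
  contψ : ContinuousOn ψ (Icc t₀ t₁)
  contω : ContinuousOn ω (Icc t₀ t₁)
  derivψ : ∀ t ∈ Ioo t₀ t₁, HasDerivAt ψ (ω t) t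
  derivω : ∀ t ∈ Ioo t₀ t₁, ω t ≠ 0 →
    ∃ α, lo (ψ t) (ω t) ≤ α ∧ α ≤ hi (ψ t) (ω t) ∧ HasDerivAt ω α t
  up_right : ∀ t ∈ Ico t₀ t₁, ω t = 0 → 0 < lo (ψ t) 0 → ∀ᶠ s in 𝓝[>] t, 0 < ω s
  up_left : ∀ t ∈ Ioc t₀ t₁, ω t = 0 → 0 < lo (ψ t) 0 → ∀ᶠ s in 𝓝[<] t, ω s < 0
  down_right : ∀ t ∈ Ico t₀ t₁, ω t = 0 → hi (ψ t) 0 < 0 → ∀ᶠ s in 𝓝[>] t, ω s < 0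
  down_left : ∀ t ∈ Ioc t₀ t₁, ω t = 0 → hi (ψ t) 0 < 0 → ∀ᶠ s in 𝓝[<] t, 0 < ω s

lemma Icc_mem_right {t₀ t₁ t : ℝ} (ht : t ∈ Ico t₀ t₁) : 𝓝[>] t ≤ 𝓝[Icc t₀ t₁] t := by
  refine nhdsWithin_le_of_mem ?_
  exact mem_of_superset (Ioc_mem_nhdsGT ht.2) (fun s hs => ⟨ht.1.trans hs.1.le, hs.2⟩)

lemma Icc_mem_left {t₀ t₁ t : ℝ} (ht : t ∈ Ioc t₀ t₁) : 𝓝[<] t ≤ 𝓝[Icc t₀ t₁] t := by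
  refine nhdsWithin_le_of_mem ?_
  exact mem_of_superset (Ico_mem_nhdsLT ht.1) (fun s hs => ⟨hs.1, hs.2.le.trans ht.2⟩)

section reflect
variable {lo hi : ℝ → ℝ → ℝ} {a b : ℝ} {U L : ℝ → ℝ}

/-- The half turn (s, w) ↦ (-s, -w) exchanges the two arcs and replaces (lo, hi) by (-hi, -lo).
Every argument below is carried out for the upper arc only and transferred by this symmetry. -/
lemma Loop.reflect (h : Loop lo hi a b U L) :
    Loop (fun s w => -hi (-s) (-w)) (fun s w => -lo (-s) (-w)) (-b) (-a)
      (fun s => L (-s)) (fun s => U (-s)) where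
  lt := neg_lt_neg h.lt
  contU := h.contL.comp continuousOn_neg (fun s hs => ⟨by linarith [hs.2], by linarith [hs.1]⟩)
  contL := h.contU.comp continuousOn_neg (fun s hs => ⟨by linarith [hs.2], by linarith [hs.1]⟩)
  U_left := by simp [h.L_right]
  U_right := by simp [h.L_left]
  L_left := by simp [h.U_right]
  L_right := by simp [h.U_left]
  U_pos := fun s hs => h.L_pos _ ⟨by linarith [hs.2], by linarith [hs.1]⟩
  L_pos := fun s hs => h.U_pos _ ⟨by linarith [hs.2], by linarith [hs.1]⟩
  derivU := fun s hs => by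
    refine ((h.derivL (-s) ⟨by linarith [hs.2], by linarith [hs.1]⟩).comp s
      (hasDerivAt_neg s)).congr_deriv ?_
    ring
  derivL := fun s hs => by
    refine ((h.derivU (-s) ⟨by linarith [hs.2], by linarith [hs.1]⟩).comp s
      (hasDerivAt_neg s)).congr_deriv ?_
    rw [neg_neg]
    ring
  lo_left := by simpa using h.hi_right
  hi_right := by simpa using h.lo_left

lemma inRegion_reflect {s w : ℝ} :
    InRegion (-b) (-a) (fun s => L (-s)) (fun s => U (-s)) (-s) (-w) ↔ InRegion a b U L s w := by
  simp only [InRegion, neg_neg]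
  constructor <;> rintro ⟨h1, h2, h3, h4⟩ <;> refine ⟨?_, ?_, ?_, ?_⟩ <;> linarith

lemma inInner_reflect {s w : ℝ} :
    InInner (-b) (-a) (fun s => L (-s)) (fun s => U (-s)) (-s) (-w) ↔ InInner a b U L s w := by
  simp only [InInner, neg_neg]
  constructor <;> rintro ⟨h1, h2, h3, h4⟩ <;> refine ⟨?_, ?_, ?_, ?_⟩ <;> linarith

lemma Traj.reflect {ψ ω : ℝ → ℝ} {t₀ t₁ : ℝ} (h : Traj lo hi ψ ω t₀ t₁) :
    Traj (fun s w => -hi (-s) (-w)) (fun s w => -lo (-s) (-w)) (fun t => -ψ t) (fun t => -ω t)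
      t₀ t₁ where
  contψ := h.contψ.neg
  contω := h.contω.neg
  derivψ := fun t ht => (h.derivψ t ht).neg
  derivω := fun t ht h0 => by
    obtain ⟨α, h1, h2, h3⟩ := h.derivω t ht (by simpa using h0)
    exact ⟨-α, by simpa using h2, by simpa using h1, h3.neg⟩
  up_right := fun t ht h0 h1 => by
    filter_upwards [h.down_right t ht (by simpa using h0) (by simpa using h1)] with s hs
    linarith
  up_left := fun t ht h0 h1 => by
    filter_upwards [h.down_left t ht (by simpa using h0) (by simpa using h1)] with s hs
    linarith
  down_right := fun t ht h0 h1 => by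
    filter_upwards [h.up_right t ht (by simpa using h0) (by simpa using h1)] with s hs
    linarith
  down_left := fun t ht h0 h1 => by
    filter_upwards [h.up_left t ht (by simpa using h0) (by simpa using h1)] with s hs
    linarith

end reflect

/-- Only continuity of the two bounds is assumed, since the set is also used for arcs that do not
close up to a loop. -/
lemma isOpen_between {γ β : ℝ} {U L : ℝ → ℝ} (hU : ContinuousOn U (Icc γ β))
    (hL : ContinuousOn L (Icc γ β)) : IsOpen {p : ℝ × ℝ | InInner γ β U L p.1 p.2} := by
  have hO : IsOpen {p : ℝ × ℝ | p.1 ∈ Ioo γ β} := isOpen_Ioo.preimage continuous_fst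
  have hU : ContinuousOn (fun p : ℝ × ℝ => U p.1) {p : ℝ × ℝ | p.1 ∈ Ioo γ β} :=
    (hU.mono Ioo_subset_Icc_self).comp continuousOn_fst (fun p hp => hp)
  have hL : ContinuousOn (fun p : ℝ × ℝ => L p.1) {p : ℝ × ℝ | p.1 ∈ Ioo γ β} :=
    (hL.mono Ioo_subset_Icc_self).comp continuousOn_fst (fun p hp => hp)
  have h1 := (hU.sub continuousOn_snd).isOpen_inter_preimage hO isOpen_Ioi (t := Ioi (0 : ℝ))
  have h2 := (hL.add continuousOn_snd).isOpen_inter_preimage hO isOpen_Ioi (t := Ioi (0 : ℝ))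
  convert h1.inter h2 using 1
  ext p
  simp only [InInner, mem_ofPred_eq, mem_inter_iff, mem_Ioo, mem_preimage, mem_Ioi]
  constructor
  · rintro ⟨h1, h2, h3, h4⟩
    exact ⟨⟨⟨h1, h2⟩, by simp; linarith⟩, ⟨h1, h2⟩, by simp; linarith⟩
  · rintro ⟨⟨⟨h1, h2⟩, h3⟩, -, h4⟩
    simp at h3 h4
    exact ⟨h1, h2, by linarith, by linarith⟩

lemma isClosed_between {γ β : ℝ} {U L : ℝ → ℝ} (hU : ContinuousOn U (Icc γ β))
    (hL : ContinuousOn L (Icc γ β)) : IsClosed {p : ℝ × ℝ | InRegion γ β U L p.1 p.2} := by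
  have hO : IsClosed {p : ℝ × ℝ | p.1 ∈ Icc γ β} := isClosed_Icc.preimage continuous_fst
  have hU : ContinuousOn (fun p : ℝ × ℝ => U p.1) {p : ℝ × ℝ | p.1 ∈ Icc γ β} :=
    hU.comp continuousOn_fst (fun p hp => hp)
  have hL : ContinuousOn (fun p : ℝ × ℝ => L p.1) {p : ℝ × ℝ | p.1 ∈ Icc γ β} :=
    hL.comp continuousOn_fst (fun p hp => hp)
  have h1 := (hU.sub continuousOn_snd).preimage_isClosed_of_isClosed hO isClosed_Ici
    (t := Ici (0 : ℝ))
  have h2 := (hL.add continuousOn_snd).preimage_isClosed_of_isClosed hO isClosed_Ici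
    (t := Ici (0 : ℝ))
  convert h1.inter h2 using 1
  ext p
  simp only [InRegion, mem_ofPred_eq, mem_inter_iff, mem_Icc, mem_preimage, mem_Ici]
  constructor
  · rintro ⟨h1, h2, h3, h4⟩
    exact ⟨⟨⟨h1, h2⟩, by simp; linarith⟩, ⟨h1, h2⟩, by simp; linarith⟩
  · rintro ⟨⟨⟨h1, h2⟩, h3⟩, -, h4⟩
    simp at h3 h4
    exact ⟨h1, h2, by linarith, by linarith⟩

namespace Loop
variable {lo hi : ℝ → ℝ → ℝ} {a b : ℝ} {U L : ℝ → ℝ} (h : Loop lo hi a b U L)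
include h

lemma U_nonneg {s : ℝ} (h1 : a ≤ s) (h2 : s ≤ b) : 0 ≤ U s := by
  rcases h1.eq_or_lt with rfl | h1
  · rw [h.U_left]
  rcases h2.eq_or_lt with rfl | h2
  · rw [h.U_right]
  exact (h.U_pos s ⟨h1, h2⟩).le

lemma L_nonneg {s : ℝ} (h1 : a ≤ s) (h2 : s ≤ b) : 0 ≤ L s := by
  rcases h1.eq_or_lt with rfl | h1
  · rw [h.L_left]
  rcases h2.eq_or_lt with rfl | h2
  · rw [h.L_right]
  exact (h.L_pos s ⟨h1, h2⟩).le

lemma mem_Ioo_of_U_ne {s : ℝ} (h1 : a ≤ s) (h2 : s ≤ b) (h3 : U s ≠ 0) : s ∈ Ioo a b :=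
  ⟨h1.lt_of_ne (fun e => h3 (e ▸ h.U_left)), h2.lt_of_ne (fun e => h3 (e ▸ h.U_right))⟩

lemma mem_Ioo_of_L_ne {s : ℝ} (h1 : a ≤ s) (h2 : s ≤ b) (h3 : L s ≠ 0) : s ∈ Ioo a b :=
  ⟨h1.lt_of_ne (fun e => h3 (e ▸ h.L_left)), h2.lt_of_ne (fun e => h3 (e ▸ h.L_right))⟩

lemma onLoop_inRegion {s w : ℝ} (hs : OnLoop a b U L s w) : InRegion a b U L s w := by
  obtain ⟨h1, h2, h3⟩ := hs
  have hU := h.U_nonneg h1 h2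
  have hL := h.L_nonneg h1 h2
  refine ⟨h1, h2, ?_, ?_⟩ <;> rcases h3 with h3 | h3 <;> linarith

omit h in
lemma not_inInner_of_onLoop {s w : ℝ} (hs : OnLoop a b U L s w) : ¬ InInner a b U L s w := by
  rintro ⟨h1, h2, h3, h4⟩
  rcases hs.2.2 with h5 | h5 <;> linarith

/-- Over an end point of [a, b] both arcs have height zero, so the region there is a single point of
the loop. -/
lemma inInner_or_onLoop {s w : ℝ} (hs : InRegion a b U L s w) :
    InInner a b U L s w ∨ OnLoop a b U L s w := by
  by_cases h5 : OnLoop a b U L s w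
  · exact Or.inr h5
  left
  obtain ⟨h1, h2, h3, h4⟩ := hs
  have h6 : w ≠ U s := fun e => h5 ⟨h1, h2, Or.inl e⟩
  have h7 : w ≠ -L s := fun e => h5 ⟨h1, h2, Or.inr e⟩
  refine ⟨h1.lt_of_ne ?_, h2.lt_of_ne ?_, h3.lt_of_ne h7.symm, h4.lt_of_ne h6⟩
  · rintro rfl
    rw [h.L_left] at h3; rw [h.U_left] at h4 h6
    exact h6 (by linarith)
  · rintro rfl
    rw [h.L_right] at h3; rw [h.U_right] at h4 h6
    exact h6 (by linarith)

omit h in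
lemma inInner_inRegion {s w : ℝ} (hs : InInner a b U L s w) : InRegion a b U L s w :=
  ⟨hs.1.le, hs.2.1.le, hs.2.2.1.le, hs.2.2.2.le⟩

lemma isOpen_inner : IsOpen {p : ℝ × ℝ | InInner a b U L p.1 p.2} := isOpen_between h.contU h.contL

lemma isClosed_region : IsClosed {p : ℝ × ℝ | InRegion a b U L p.1 p.2} :=
  isClosed_between h.contU h.contL

/-- Upper-half comparison: `ω² - U(ψ)²` keeps its sign along trajectories above `ω = 0`. -/
lemma comparison_upper (hlip : LocLip hi) {ψ ω : ℝ → ℝ} {t₀ t₁ s t : ℝ}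
    (hT : Traj lo hi ψ ω t₀ t₁) (h0 : t₀ ≤ s) (hst : s ≤ t) (h1 : t ≤ t₁)
    (hin : ∀ r ∈ Ioo s t, 0 < ω r ∧ ψ r ∈ Ioo a b) (hs : ψ s ∈ Icc a b) (ht : ψ t ∈ Icc a b) :
    (ω s ^ 2 ≤ U (ψ s) ^ 2 → ω t ^ 2 ≤ U (ψ t) ^ 2) ∧
      (ω s ^ 2 < U (ψ s) ^ 2 → ω t ^ 2 < U (ψ t) ^ 2) := by
  have hsub : Icc s t ⊆ Icc t₀ t₁ := Icc_subset_Icc h0 h1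
  have cψ := hT.contψ.mono hsub
  have cω := hT.contω.mono hsub
  have hmaps : MapsTo ψ (Icc s t) (Icc a b) := by
    intro r hr
    rcases hr.1.eq_or_lt with rfl | h2
    · exact hs
    rcases hr.2.eq_or_lt with rfl | h3
    · exact ht
    exact Ioo_subset_Icc_self (hin r ⟨h2, h3⟩).2
  have cU : ContinuousOn (fun r => U (ψ r)) (Icc s t) := h.contU.comp cψ hmaps
  obtain ⟨R₁, hR₁⟩ := isCompact_Icc.exists_bound_of_continuousOn cψ
  obtain ⟨R₂, hR₂⟩ := isCompact_Icc.exists_bound_of_continuousOn cω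
  obtain ⟨R₃, hR₃⟩ := isCompact_Icc.exists_bound_of_continuousOn cU
  obtain ⟨K, hK, hlip⟩ := hlip (max R₁ (max R₂ R₃))
  have key := nonpos_and_neg_of_deriv_le_mul_abs (D := fun r => ω r ^ 2 - U (ψ r) ^ 2)
    (D' := fun r => 2 * ω r * deriv ω r - 2 * U (ψ r) * (hi (ψ r) (U (ψ r)) / U (ψ r) * ω r))
    (K := 2 * K) hst ((cω.pow 2).sub (cU.pow 2)) ?_ ?_
  · simpa using key
  · intro r hr
    obtain ⟨hω, hψ⟩ := hin r hr
    have hr' : r ∈ Ioo t₀ t₁ := ⟨h0.trans_lt hr.1, hr.2.trans_le h1⟩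
    obtain ⟨α, -, -, h3⟩ := hT.derivω r hr' hω.ne'
    have h4 := (h.derivU _ hψ).comp r (hT.derivψ r hr')
    refine ((h3.pow 2).sub (h4.pow 2)).congr_deriv ?_
    rw [h3.deriv]; simp
  · intro r hr
    obtain ⟨hω, hψ⟩ := hin r hr
    have hr' : r ∈ Ioo t₀ t₁ := ⟨h0.trans_lt hr.1, hr.2.trans_le h1⟩
    obtain ⟨α, -, h2, h3⟩ := hT.derivω r hr' hω.ne'
    rw [h3.deriv]
    have hU := h.U_pos _ hψ
    have hrI := Ioo_subset_Icc_self hr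
    have e1 : 2 * U (ψ r) * (hi (ψ r) (U (ψ r)) / U (ψ r) * ω r)
        = 2 * ω r * hi (ψ r) (U (ψ r)) := by field_simp
    have e2 := hlip (ψ r) (ω r) (ψ r) (U (ψ r)) ((hR₁ r hrI).trans (le_max_left _ _))
      ((hR₂ r hrI).trans ((le_max_left _ _).trans (le_max_right _ _)))
      ((hR₁ r hrI).trans (le_max_left _ _))
      ((hR₃ r hrI).trans ((le_max_right _ _).trans (le_max_right _ _)))
    rw [sub_self, abs_zero, zero_add] at e2
    have e3 := (le_abs_self _).trans e2
    -- Squares are compared because the factor ω of the derivative is absorbed by ω + U, so that no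
    -- division by a height vanishing at the corners occurs.
    have e4 : |ω r ^ 2 - U (ψ r) ^ 2| = |ω r - U (ψ r)| * (ω r + U (ψ r)) := by
      rw [sq_sub_sq, abs_mul, abs_of_pos (add_pos hω hU), mul_comm]
    simp only [e1, e4]
    have e5 := mul_nonneg (mul_nonneg hK (abs_nonneg (ω r - U (ψ r)))) hU.le
    nlinarith

end Loop

/-! ### Invariance of the regions bounded by a loop. -/

namespace Traj
variable {lo hi : ℝ → ℝ → ℝ} {ψ ω : ℝ → ℝ} {t₀ t₁ : ℝ} (hT : Traj lo hi ψ ω t₀ t₁)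
include hT

lemma tendsto_right {t : ℝ} (ht : t ∈ Ico t₀ t₁) :
    Tendsto ψ (𝓝[>] t) (𝓝 (ψ t)) ∧ Tendsto ω (𝓝[>] t) (𝓝 (ω t)) :=
  ⟨(hT.contψ t ⟨ht.1, ht.2.le⟩).mono_left (Icc_mem_right ht),
    (hT.contω t ⟨ht.1, ht.2.le⟩).mono_left (Icc_mem_right ht)⟩

lemma tendsto_left {t : ℝ} (ht : t ∈ Ioc t₀ t₁) :
    Tendsto ψ (𝓝[<] t) (𝓝 (ψ t)) ∧ Tendsto ω (𝓝[<] t) (𝓝 (ω t)) :=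
  ⟨(hT.contψ t ⟨ht.1.le, ht.2⟩).mono_left (Icc_mem_left ht),
    (hT.contω t ⟨ht.1.le, ht.2⟩).mono_left (Icc_mem_left ht)⟩

lemma ψ_lt {s t : ℝ} (h0 : t₀ ≤ s) (hst : s < t) (h1 : t ≤ t₁) (hpos : ∀ r ∈ Ioo s t, 0 < ω r) :
    ψ s < ψ t := by
  have : StrictMonoOn ψ (Icc s t) := by
    refine strictMonoOn_of_deriv_pos (convex_Icc _ _) (hT.contψ.mono (Icc_subset_Icc h0 h1)) ?_
    intro r hr
    rw [interior_Icc] at hr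
    rw [(hT.derivψ r ⟨h0.trans_lt hr.1, hr.2.trans_le h1⟩).deriv]
    exact hpos r hr
  exact this ⟨le_rfl, hst.le⟩ ⟨hst.le, le_rfl⟩ hst

/-- Just after leaving the left corner, or a point of the upper arc, a trajectory is in the open
upper half plane above `(a, b)`. -/
lemma eventually_right {a b : ℝ} {U L : ℝ → ℝ} (h : Loop lo hi a b U L) {t : ℝ}
    (ht : t ∈ Ico t₀ t₁)
    (hp : (0 < ω t ∧ ψ t ∈ Ioo a b) ∨ (ω t = 0 ∧ ψ t = a)) :
    ∀ᶠ s in 𝓝[>] t, s ∈ Ioo t t₁ ∧ ∀ r ∈ Ioc t s, 0 < ω r ∧ ψ r ∈ Ioo a b := by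
  obtain ⟨cψ, cω⟩ := hT.tendsto_right ht
  have hpos : ∀ᶠ s in 𝓝[>] t, 0 < ω s := by
    rcases hp with hp | hp
    · exact cω.eventually_const_lt hp.1
    · exact hT.up_right t ht hp.1 (by rw [hp.2]; exact h.lo_left)
  have hb : ∀ᶠ s in 𝓝[>] t, ψ s < b := by
    refine cψ.eventually_lt_const ?_
    rcases hp with hp | hp
    · exact hp.2.2
    · rw [hp.2]; exact h.lt
  have ha : a ≤ ψ t := by
    rcases hp with hp | hp
    · exact hp.2.1.le
    · exact hp.2.ge
  have hev := hpos.and hb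
  rw [Filter.Eventually, mem_nhdsGT_iff_exists_Ioo_subset] at hev
  obtain ⟨c, hc, hsub⟩ := hev
  have hc' : t < min c t₁ := lt_min hc ht.2
  filter_upwards [Ioo_mem_nhdsGT hc'] with s hs
  refine ⟨⟨hs.1, hs.2.trans_le (min_le_right _ _)⟩, fun r hr => ?_⟩
  have hr' : r ∈ Ioo t c := ⟨hr.1, hr.2.trans_lt (hs.2.trans_le (min_le_left _ _))⟩
  refine ⟨(hsub hr').1, ?_, (hsub hr').2⟩
  refine ha.trans_lt (hT.ψ_lt ht.1 hr.1 (hr.2.trans (hs.2.trans_le (min_le_right _ _)).le) ?_)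
  intro q hq
  exact (hsub ⟨hq.1, hq.2.trans hr'.2⟩).1

/-- Just before reaching the right corner, or a point of the upper arc, a trajectory is in the open
upper half plane above `(a, b)`. -/
lemma eventually_left {a b : ℝ} {U L : ℝ → ℝ} (h : Loop lo hi a b U L) {t : ℝ}
    (ht : t ∈ Ioc t₀ t₁)
    (hp : (0 < ω t ∧ ψ t ∈ Ioo a b) ∨ (ω t = 0 ∧ ψ t = b)) :
    ∀ᶠ s in 𝓝[<] t, s ∈ Ioo t₀ t ∧ ∀ r ∈ Ico s t, 0 < ω r ∧ ψ r ∈ Ioo a b := by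
  obtain ⟨cψ, cω⟩ := hT.tendsto_left ht
  have hpos : ∀ᶠ s in 𝓝[<] t, 0 < ω s := by
    rcases hp with hp | hp
    · exact cω.eventually_const_lt hp.1
    · exact hT.down_left t ht hp.1 (by rw [hp.2]; exact h.hi_right)
  have hb : ∀ᶠ s in 𝓝[<] t, a < ψ s := by
    refine cψ.eventually_const_lt ?_
    rcases hp with hp | hp
    · exact hp.2.1
    · rw [hp.2]; exact h.lt
  have ha : ψ t ≤ b := by
    rcases hp with hp | hp
    · exact hp.2.2.le
    · exact hp.2.le
  have hev := hpos.and hb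
  rw [Filter.Eventually, mem_nhdsLT_iff_exists_Ioo_subset] at hev
  obtain ⟨c, hc, hsub⟩ := hev
  have hc' : max c t₀ < t := max_lt hc ht.1
  filter_upwards [Ioo_mem_nhdsLT hc'] with s hs
  refine ⟨⟨(le_max_right _ _).trans_lt hs.1, hs.2⟩, fun r hr => ?_⟩
  have hr' : r ∈ Ioo c t := ⟨((le_max_left _ _).trans_lt hs.1).trans_le hr.1, hr.2⟩
  refine ⟨(hsub hr').1, (hsub hr').2, ?_⟩
  refine (hT.ψ_lt (((le_max_right _ _).trans_lt hs.1).le.trans hr.1) hr.2 ht.2 ?_).trans_le ha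
  intro q hq
  exact (hsub ⟨hr'.1.trans hq.1, hq.2⟩).1

/-- The trajectory stays above ω = 0 for a short time, so the lower bound is free and the upper one
is `comparison_upper`. -/
lemma eventually_inRegion_upper {a b : ℝ} {U L : ℝ → ℝ} (h : Loop lo hi a b U L)
    (hlip : LocLip hi) {t : ℝ} (ht : t ∈ Ico t₀ t₁) (hin : InRegion a b U L (ψ t) (ω t))
    (hp : (0 < ω t ∧ ψ t ∈ Ioo a b) ∨ (ω t = 0 ∧ ψ t = a)) :
    ∀ᶠ s in 𝓝[>] t, InRegion a b U L (ψ s) (ω s) := by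
  filter_upwards [hT.eventually_right h ht hp] with s hs
  obtain ⟨hs1, hs2⟩ := hs
  have h1 := hs2 s ⟨hs1.1, le_rfl⟩
  have h0 : 0 ≤ ω t := by
    rcases hp with hp | hp
    exacts [hp.1.le, hp.1.ge]
  have h2 := (h.comparison_upper hlip hT ht.1 hs1.1.le hs1.2.le
    (fun r hr => hs2 r ⟨hr.1, hr.2.le⟩) ⟨hin.1, hin.2.1⟩ (Ioo_subset_Icc_self h1.2)).1
    (pow_le_pow_left₀ h0 hin.2.2.2 2)
  have h3 := h.U_pos _ h1.2
  have h4 := h.L_pos _ h1.2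
  exact ⟨h1.2.1.le, h1.2.2.le, by linarith [h1.1], le_of_sq_le_sq h2 h3.le⟩

/-- In forward time the left corner is left through the upper half plane and the right corner
through the lower one, so each boundary point belongs to one of the two half-plane comparisons. -/
lemma eventually_inRegion {a b : ℝ} {U L : ℝ → ℝ} (h : Loop lo hi a b U L)
    (hhi : LocLip hi) (hlo : LocLip lo) {t : ℝ} (ht : t ∈ Ico t₀ t₁)
    (hin : InRegion a b U L (ψ t) (ω t)) :
    ∀ᶠ s in 𝓝[>] t, InRegion a b U L (ψ s) (ω s) := by
  rcases h.inInner_or_onLoop hin with hi' | hc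
  · obtain ⟨cψ, cω⟩ := hT.tendsto_right ht
    have := (cψ.prodMk_nhds cω).eventually (h.isOpen_inner.mem_nhds hi')
    filter_upwards [this] with s hs using Loop.inInner_inRegion hs
  obtain ⟨h1, h2, h3⟩ := hc
  have case1 : (0 < ω t ∧ ψ t ∈ Ioo a b) ∨ (ω t = 0 ∧ ψ t = a) →
      ∀ᶠ s in 𝓝[>] t, InRegion a b U L (ψ s) (ω s) := hT.eventually_inRegion_upper h hhi ht hin
  have case2 : (ω t < 0 ∧ ψ t ∈ Ioo a b) ∨ (ω t = 0 ∧ ψ t = b) →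
      ∀ᶠ s in 𝓝[>] t, InRegion a b U L (ψ s) (ω s) := by
    intro hp
    have := hT.reflect.eventually_inRegion_upper h.reflect hlo.reflect ht
      (inRegion_reflect.2 hin) (hp.imp
        (fun hp => ⟨by linarith [hp.1], by linarith [hp.2.2], by linarith [hp.2.1]⟩)
        (fun hp => ⟨by linarith [hp.1], by linarith [hp.2]⟩))
    filter_upwards [this] with s hs using inRegion_reflect.1 hs
  by_cases ha : ψ t = a
  · have : ω t = 0 := by rw [ha, h.U_left, h.L_left] at h3; simpa using h3
    exact case1 (Or.inr ⟨this, ha⟩)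
  by_cases hb : ψ t = b
  · have : ω t = 0 := by rw [hb, h.U_right, h.L_right] at h3; simpa using h3
    exact case2 (Or.inr ⟨this, hb⟩)
  have hI : ψ t ∈ Ioo a b := ⟨lt_of_le_of_ne h1 (Ne.symm ha), lt_of_le_of_ne h2 hb⟩
  rcases h3 with h3 | h3
  · exact case1 (Or.inl ⟨h3 ▸ h.U_pos _ hI, hI⟩)
  · exact case2 (Or.inl ⟨by rw [h3]; linarith [h.L_pos _ hI], hI⟩)

/-- The closed region bounded by an extremal loop is forward invariant. -/
theorem inRegion_of_inRegion {a b : ℝ} {U L : ℝ → ℝ} (h : Loop lo hi a b U L)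
    (hhi : LocLip hi) (hlo : LocLip lo) (h0 : InRegion a b U L (ψ t₀) (ω t₀)) :
    ∀ t ∈ Icc t₀ t₁, InRegion a b U L (ψ t) (ω t) := by
  intro t ht
  have hle : t₀ ≤ t₁ := ht.1.trans ht.2
  have hcl : IsClosed ({t | InRegion a b U L (ψ t) (ω t)} ∩ Icc t₀ t₁) := by
    rw [inter_comm]
    exact (hT.contψ.prodMk hT.contω).preimage_isClosed_of_isClosed isClosed_Icc h.isClosed_region
  refine hcl.Icc_subset_of_forall_exists_gt h0 ?_ ht
  rintro x ⟨hx, hx'⟩ y hy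
  have := (hT.eventually_inRegion h hhi hlo hx' hx).and (Ioc_mem_nhdsGT hy)
  obtain ⟨z, hz1, hz2⟩ := this.exists
  exact ⟨z, hz1, hz2⟩

/-- Shortly before the arrival the trajectory is above ω = 0 and strictly below U; the strict
comparison then still holds at the arrival time. -/
lemma not_first_onLoop_upper {a b : ℝ} {U L : ℝ → ℝ} (h : Loop lo hi a b U L)
    (hhi : LocLip hi) {t : ℝ} (ht : t ∈ Ioc t₀ t₁)
    (hin : ∀ s ∈ Ico t₀ t, InInner a b U L (ψ s) (ω s))
    (hc : OnLoop a b U L (ψ t) (ω t))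
    (hp : (0 < ω t ∧ ψ t ∈ Ioo a b) ∨ (ω t = 0 ∧ ψ t = b)) : False := by
  obtain ⟨s, hs1, hs2⟩ := (hT.eventually_left h ht hp).exists
  have h1 := hs2 s ⟨le_rfl, hs1.2⟩
  have h2 := hin s ⟨hs1.1.le, hs1.2⟩
  have h3 := (h.comparison_upper hhi hT hs1.1.le hs1.2.le ht.2
    (fun r hr => hs2 r ⟨hr.1.le, hr.2⟩) (Ioo_subset_Icc_self h1.2) ⟨hc.1, hc.2.1⟩).2
    (pow_lt_pow_left₀ h2.2.2.2 h1.1.le two_ne_zero)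
  rcases hp with hp | hp
  · rcases hc.2.2 with h4 | h4
    · rw [h4] at h3; exact lt_irrefl _ h3
    · have := h.L_pos _ hp.2; linarith [hp.1]
  · rw [hp.1, hp.2, h.U_right] at h3; exact lt_irrefl _ h3

/-- The open region bounded by an extremal loop is forward invariant. -/
theorem inInner_of_inInner {a b : ℝ} {U L : ℝ → ℝ} (h : Loop lo hi a b U L)
    (hhi : LocLip hi) (hlo : LocLip lo) (h0 : InInner a b U L (ψ t₀) (ω t₀)) :
    ∀ t ∈ Icc t₀ t₁, InInner a b U L (ψ t) (ω t) := by
  intro t ht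
  have hR := hT.inRegion_of_inRegion h hhi hlo (Loop.inInner_inRegion h0)
  by_contra hcon
  set Z := Icc t₀ t₁ ∩ (fun t => (ψ t, ω t)) ⁻¹' {p | InInner a b U L p.1 p.2}ᶜ
  have hZ : IsClosed Z := (hT.contψ.prodMk hT.contω).preimage_isClosed_of_isClosed isClosed_Icc
    h.isOpen_inner.isClosed_compl
  have hZc : IsCompact Z := isCompact_Icc.of_isClosed_subset hZ inter_subset_left
  have hm := hZc.sInf_mem ⟨t, ht, hcon⟩
  set τ := sInf Z
  have hlt : t₀ < τ := lt_of_le_of_ne hm.1.1 (fun e => hm.2 (e ▸ h0))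
  have hin : ∀ s ∈ Ico t₀ τ, InInner a b U L (ψ s) (ω s) := by
    intro s hs
    by_contra hs'
    exact absurd (csInf_le hZc.bddBelow ⟨⟨hs.1, hs.2.le.trans hm.1.2⟩, hs'⟩) (not_le.2 hs.2)
  have hc : OnLoop a b U L (ψ τ) (ω τ) :=
    (h.inInner_or_onLoop (hR τ hm.1)).resolve_left hm.2
  have hτ : τ ∈ Ioc t₀ t₁ := ⟨hlt, hm.1.2⟩
  -- The corners are now paired with the half plane from which they are reached: the right one from
  -- above, the left one from below.
  have case1 := hT.not_first_onLoop_upper h hhi hτ hin hc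
  have case2 : (ω τ < 0 ∧ ψ τ ∈ Ioo a b) ∨ (ω τ = 0 ∧ ψ τ = a) → False := by
    intro hp
    refine hT.reflect.not_first_onLoop_upper h.reflect hlo.reflect hτ
      (fun s hs => inInner_reflect.2 (hin s hs)) ?_ (hp.imp
        (fun hp => ⟨by linarith [hp.1], by linarith [hp.2.2], by linarith [hp.2.1]⟩)
        (fun hp => ⟨by linarith [hp.1], by linarith [hp.2]⟩))
    obtain ⟨h1, h2, h3⟩ := hc
    refine ⟨by linarith, by linarith, ?_⟩
    simp only [neg_neg]
    rcases h3 with h3 | h3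
    · right; rw [h3]
    · left; rw [h3, neg_neg]
  obtain ⟨h1, h2, h3⟩ := hc
  by_cases ha : ψ τ = a
  · have : ω τ = 0 := by rw [ha, h.U_left, h.L_left] at h3; simpa using h3
    exact case2 (Or.inr ⟨this, ha⟩)
  by_cases hb : ψ τ = b
  · have : ω τ = 0 := by rw [hb, h.U_right, h.L_right] at h3; simpa using h3
    exact case1 (Or.inr ⟨this, hb⟩)
  have hI : ψ τ ∈ Ioo a b := ⟨lt_of_le_of_ne h1 (Ne.symm ha), lt_of_le_of_ne h2 hb⟩
  rcases h3 with h3 | h3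
  · exact case1 (Or.inl ⟨h3 ▸ h.U_pos _ hI, hI⟩)
  · exact case2 (Or.inl ⟨by rw [h3]; linarith [h.L_pos _ hI], hI⟩)

end Traj

/-! ### Closed orbits of the extremal system are loops. -/

/-- The acceleration of the extremal system along `(ψ, ω)`. -/
def extAcc (lo hi : ℝ → ℝ → ℝ) (ψ ω : ℝ → ℝ) (t : ℝ) : ℝ :=
  if 0 ≤ ω t then hi (ψ t) (ω t) else lo (ψ t) (ω t)

/-- A periodic Caratheodory solution of the extremal system which runs through a simple closed
curve. -/
structure ExtremalOrbit (lo hi : ℝ → ℝ → ℝ) (ψ ω : ℝ → ℝ) (T : ℝ) : Prop where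
  T_pos : 0 < T
  perψ : Function.Periodic ψ T
  perω : Function.Periodic ω T
  inj : ∀ s t, ψ s = ψ t → ω s = ω t → ∃ n : ℤ, t - s = n * T
  derivψ : ∀ t, HasDerivAt ψ (ω t) t
  contω : Continuous ω
  acc_int : ∀ s t, IntervalIntegrable (extAcc lo hi ψ ω) volume s t
  acc_eq : ∀ s t, ω t - ω s = ∫ r in s..t, extAcc lo hi ψ ω r

/-- Positivity is required only just to the right of s, so that s may itself be a zero, as it is at
a crossing of ω = 0. -/
lemma exists_first_zero {g : ℝ → ℝ} (hg : Continuous g) {s t : ℝ} (hst : s < t) (ht : g t = 0)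
    (hs : ∀ᶠ r in 𝓝[>] s, 0 < g r) :
    ∃ τ ∈ Ioc s t, g τ = 0 ∧ ∀ r ∈ Ioo s τ, 0 < g r := by
  rw [Filter.Eventually, mem_nhdsGT_iff_exists_Ioo_subset] at hs
  obtain ⟨c, hc, hsub⟩ := hs
  have hc : s < c := hc
  have hct : c ≤ t := by
    by_contra! h
    have : 0 < g t := hsub ⟨hst, h⟩
    linarith
  set Z := Icc c t ∩ g ⁻¹' Iic 0
  have hZ : IsCompact Z := isCompact_Icc.inter_right (isClosed_Iic.preimage hg)
  have hm := hZ.sInf_mem ⟨t, ⟨hct, le_rfl⟩, ht.le⟩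
  set τ := sInf Z
  have hpos : ∀ r ∈ Ioo s τ, 0 < g r := by
    intro r hr
    rcases lt_or_ge r c with h | h
    · exact hsub ⟨hr.1, h⟩
    by_contra! h'
    exact absurd (csInf_le hZ.bddBelow ⟨⟨h, hr.2.le.trans hm.1.2⟩, h'⟩) (not_le.2 hr.2)
  have hsτ : s < τ := hc.trans_le hm.1.1
  refine ⟨τ, ⟨hsτ, hm.1.2⟩, le_antisymm hm.2 ?_, hpos⟩
  refine ge_of_tendsto ((hg.tendsto τ).mono_left (nhdsWithin_le_nhds (s := Iio τ))) ?_
  filter_upwards [Ioo_mem_nhdsLT hsτ] with r hr using (hpos r hr).le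

/-- Along an arc with ω > 0 the coordinate ψ is strictly increasing and can replace time as
parameter. The inverse is continuous up to the ends, where ω may vanish, but differentiable only
inside. -/
lemma exists_arc_inverse {f f' : ℝ → ℝ} {s t : ℝ} (hst : s < t)
    (hf : ∀ r, HasDerivAt f (f' r) r) (hpos : ∀ r ∈ Ioo s t, 0 < f' r) :
    f s < f t ∧ ∃ τ : ℝ → ℝ, ContinuousOn τ (Icc (f s) (f t)) ∧
      (∀ x ∈ Icc (f s) (f t), τ x ∈ Icc s t ∧ f (τ x) = x) ∧
      (∀ r ∈ Icc s t, f r ∈ Icc (f s) (f t) ∧ τ (f r) = r) ∧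
      (∀ x ∈ Ioo (f s) (f t), τ x ∈ Ioo s t ∧ HasDerivAt τ (f' (τ x))⁻¹ x) := by
  have hc : Continuous f := continuous_iff_continuousAt.2 fun r => (hf r).continuousAt
  have hmono : StrictMonoOn f (Icc s t) := by
    refine strictMonoOn_of_deriv_pos (convex_Icc _ _) hc.continuousOn fun r hr => ?_
    rw [interior_Icc] at hr
    rw [(hf r).deriv]; exact hpos r hr
  have hl : s ∈ Icc s t := ⟨le_rfl, hst.le⟩
  have hr : t ∈ Icc s t := ⟨hst.le, le_rfl⟩
  have hmaps : ∀ r ∈ Icc s t, f r ∈ Icc (f s) (f t) := fun r h =>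
    ⟨hmono.monotoneOn hl h h.1, hmono.monotoneOn h hr h.2⟩
  have hsurj : SurjOn f (Icc s t) (Icc (f s) (f t)) := by
    have := intermediate_value_Icc hst.le (hc.continuousOn (s := Icc s t))
    exact this
  set τ := Function.invFunOn f (Icc s t)
  have h1 : ∀ x ∈ Icc (f s) (f t), τ x ∈ Icc s t ∧ f (τ x) = x := fun x hx =>
    ⟨Function.invFunOn_mem (hsurj hx), Function.invFunOn_eq (hsurj hx)⟩
  have h2 : ∀ r ∈ Icc s t, τ (f r) = r := fun r h =>
    hmono.injOn (h1 _ (hmaps r h)).1 h (h1 _ (hmaps r h)).2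
  have h3 : ∀ x ∈ Ioo (f s) (f t), τ x ∈ Ioo s t := by
    intro x hx
    obtain ⟨h4, h5⟩ := h1 x (Ioo_subset_Icc_self hx)
    refine ⟨lt_of_le_of_ne h4.1 ?_, lt_of_le_of_ne h4.2 ?_⟩
    · intro e; rw [← e] at h5; exact hx.1.ne h5
    · intro e; rw [e] at h5; exact hx.2.ne h5.symm
  have hτc : ContinuousOn τ (Icc (f s) (f t)) := by
    have hmonoτ : StrictMonoOn τ (Icc (f s) (f t)) := by
      intro x hx y hy hxy
      by_contra! h
      have := hmono.monotoneOn (h1 y hy).1 (h1 x hx).1 h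
      rw [(h1 y hy).2, (h1 x hx).2] at this
      exact absurd hxy (not_lt.2 this)
    have himg : τ '' Icc (f s) (f t) = Icc s t := by
      ext r
      constructor
      · rintro ⟨x, hx, rfl⟩; exact (h1 x hx).1
      · intro h; exact ⟨f r, hmaps r h, h2 r h⟩
    intro x hx
    have h6 : Continuous (fun x : Icc (f s) (f t) => ((hmonoτ.orderIso _ _ x : τ '' _) : ℝ)) := by
      have : OrdConnected (τ '' Icc (f s) (f t)) := by rw [himg]; infer_instance
      exact continuous_subtype_val.comp (hmonoτ.orderIso _ _).continuous
    exact continuousOn_iff_continuous_domRestrict.2 h6 x hx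
  refine ⟨hmono hl hr hst, τ, hτc, h1, fun r h => ⟨hmaps r h, h2 r h⟩, fun x hx => ⟨h3 x hx, ?_⟩⟩
  have hI := Icc_mem_nhds hx.1 hx.2
  refine HasDerivAt.of_local_left_inverse (hτc.continuousAt hI) (hf _)
    (hpos _ (h3 x hx)).ne' ?_
  filter_upwards [hI] with y hy using (h1 y hy).2

namespace ExtremalOrbit
variable {lo hi : ℝ → ℝ → ℝ} {ψ ω : ℝ → ℝ} {T : ℝ} (hO : ExtremalOrbit lo hi ψ ω T)
include hO

lemma contψ : Continuous ψ := continuous_iff_continuousAt.2 fun t => (hO.derivψ t).continuousAt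

/-- A Caratheodory solution is a classical one wherever its acceleration agrees locally with a
continuous function; off ω = 0 that function is one of the two branches. -/
lemma hasDerivAt_of_acc_eq {g : ℝ → ℝ} (hg : Continuous g) {t : ℝ}
    (h : ∀ᶠ r in 𝓝 t, extAcc lo hi ψ ω r = g r) : HasDerivAt ω (g t) t := by
  have h1 : HasDerivAt (fun τ => ω t + ∫ r in t..τ, g r) (g t) t :=
    (intervalIntegral.integral_hasDerivAt_right (hg.intervalIntegrable _ _)
      (hg.stronglyMeasurableAtFilter _ _) hg.continuousAt).const_add _
  refine h1.congr_of_eventuallyEq ?_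
  obtain ⟨ε, hε, hb⟩ := Metric.eventually_nhds_iff_ball.1 h
  filter_upwards [Metric.ball_mem_nhds t hε] with τ hτ
  have : ∫ r in t..τ, extAcc lo hi ψ ω r = ∫ r in t..τ, g r := by
    refine intervalIntegral.integral_congr fun r hr => hb r ?_
    have hoc : OrdConnected (Metric.ball t ε) := by rw [Real.ball_eq_Ioo]; infer_instance
    exact hoc.uIcc_subset (Metric.mem_ball_self hε) hτ hr
  rw [← this, ← hO.acc_eq]; ring

lemma deriv_upper (hhi : LocLip hi) {t : ℝ} (ht : 0 < ω t) : HasDerivAt ω (hi (ψ t) (ω t)) t := by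
  refine hO.hasDerivAt_of_acc_eq (g := fun t => hi (ψ t) (ω t))
    (hhi.continuous.comp (hO.contψ.prodMk hO.contω)) ?_
  filter_upwards [(hO.contω.tendsto t).eventually_const_lt ht] with r hr
  simp [extAcc, hr.le]

lemma deriv_lower (hlo : LocLip lo) {t : ℝ} (ht : ω t < 0) : HasDerivAt ω (lo (ψ t) (ω t)) t := by
  refine hO.hasDerivAt_of_acc_eq (g := fun t => lo (ψ t) (ω t))
    (hlo.continuous.comp (hO.contψ.prodMk hO.contω)) ?_
  filter_upwards [(hO.contω.tendsto t).eventually_lt_const ht] with r hr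
  simp [extAcc, not_le.2 hr]

/-- On ω = 0 the derivative of ω need not exist. Both branches of the acceleration are negative
nearby, however, so the integral equation gives strict decrease. -/
lemma anti_of_hi_neg (hle : ∀ s w, lo s w ≤ hi s w) (hhi : LocLip hi) {t : ℝ}
    (h0 : ω t = 0) (ht : hi (ψ t) 0 < 0) :
    ∃ δ > 0, StrictAntiOn ω (Ioo (t - δ) (t + δ)) := by
  have : ∀ᶠ r in 𝓝 t, hi (ψ r) (ω r) < 0 := by
    have := (hhi.continuous.comp (hO.contψ.prodMk hO.contω)).tendsto t
    refine this.eventually_lt_const ?_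
    simpa [h0] using ht
  obtain ⟨δ, hδ, hb⟩ := Metric.eventually_nhds_iff_ball.1 this
  rw [Real.ball_eq_Ioo] at hb
  refine ⟨δ, hδ, fun r hr s hs hrs => ?_⟩
  have h1 : 0 < ∫ q in r..s, -extAcc lo hi ψ ω q := by
    refine intervalIntegral.intervalIntegral_pos_of_pos_on (hO.acc_int r s).neg ?_ hrs
    intro q hq
    have h2 := hb q ⟨hr.1.trans hq.1, hq.2.trans hs.2⟩
    have h3 := hle (ψ q) (ω q)
    simp only [extAcc]
    split_ifs <;> linarith
  rw [intervalIntegral.integral_neg, ← hO.acc_eq] at h1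
  linarith

lemma mono_of_lo_pos (hle : ∀ s w, lo s w ≤ hi s w) (hlo : LocLip lo) {t : ℝ}
    (h0 : ω t = 0) (ht : 0 < lo (ψ t) 0) :
    ∃ δ > 0, StrictMonoOn ω (Ioo (t - δ) (t + δ)) := by
  have : ∀ᶠ r in 𝓝 t, 0 < lo (ψ r) (ω r) := by
    have := (hlo.continuous.comp (hO.contψ.prodMk hO.contω)).tendsto t
    refine this.eventually_const_lt ?_
    simpa [h0] using ht
  obtain ⟨δ, hδ, hb⟩ := Metric.eventually_nhds_iff_ball.1 this
  rw [Real.ball_eq_Ioo] at hb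
  refine ⟨δ, hδ, fun r hr s hs hrs => ?_⟩
  have h1 : 0 < ∫ q in r..s, extAcc lo hi ψ ω q := by
    refine intervalIntegral.intervalIntegral_pos_of_pos_on (hO.acc_int r s) ?_ hrs
    intro q hq
    have h2 := hb q ⟨hr.1.trans hq.1, hq.2.trans hs.2⟩
    have h3 := hle (ψ q) (ω q)
    simp only [extAcc]
    split_ifs <;> linarith
  rw [← hO.acc_eq] at h1
  linarith

lemma down_crossing (hle : ∀ s w, lo s w ≤ hi s w) (hhi : LocLip hi) {t : ℝ}
    (h0 : ω t = 0) (ht : hi (ψ t) 0 < 0) :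
    (∀ᶠ s in 𝓝[<] t, 0 < ω s) ∧ ∀ᶠ s in 𝓝[>] t, ω s < 0 := by
  obtain ⟨δ, hδ, hanti⟩ := hO.anti_of_hi_neg hle hhi h0 ht
  have hm : t ∈ Ioo (t - δ) (t + δ) := ⟨by linarith, by linarith⟩
  constructor
  · filter_upwards [Ioo_mem_nhdsLT hm.1] with s hs
    rw [← h0]; exact hanti ⟨hs.1, hs.2.trans hm.2⟩ hm hs.2
  · filter_upwards [Ioo_mem_nhdsGT hm.2] with s hs
    rw [← h0]; exact hanti hm ⟨hm.1.trans hs.1, hs.2⟩ hs.1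

lemma up_crossing (hle : ∀ s w, lo s w ≤ hi s w) (hlo : LocLip lo) {t : ℝ}
    (h0 : ω t = 0) (ht : 0 < lo (ψ t) 0) :
    (∀ᶠ s in 𝓝[<] t, ω s < 0) ∧ ∀ᶠ s in 𝓝[>] t, 0 < ω s := by
  obtain ⟨δ, hδ, hanti⟩ := hO.mono_of_lo_pos hle hlo h0 ht
  have hm : t ∈ Ioo (t - δ) (t + δ) := ⟨by linarith, by linarith⟩
  constructor
  · filter_upwards [Ioo_mem_nhdsLT hm.1] with s hs
    rw [← h0]; exact hanti ⟨hs.1, hs.2.trans hm.2⟩ hm hs.2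
  · filter_upwards [Ioo_mem_nhdsGT hm.2] with s hs
    rw [← h0]; exact hanti hm ⟨hm.1.trans hs.1, hs.2⟩ hs.1

lemma ne_of_lt_of_lt {s t : ℝ} (h1 : s < t) (h2 : t < s + T) (h3 : ψ s = ψ t) : ω s ≠ ω t := by
  intro h4
  obtain ⟨n, hn⟩ := hO.inj s t h3 h4
  have hT := hO.T_pos
  have hn0 : 0 < (n : ℝ) := by
    by_contra! h
    nlinarith
  have hn1 : (n : ℝ) < 1 := by
    by_contra! h
    nlinarith
  have : 0 < n := by exact_mod_cast hn0
  have : n < 1 := by exact_mod_cast hn1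
  omega

/-- At its zeros of `ω`, an extremal orbit crosses `ω = 0` transversally. -/
lemma transversal (hlo : LocLip lo) (hhi : LocLip hi) {t₀ : ℝ} (h0 : ω t₀ = 0) :
    0 < lo (ψ t₀) 0 ∨ hi (ψ t₀) 0 < 0 := by
  -- Otherwise lo ≤ 0 ≤ hi at the point, and a Gronwall estimate backwards in time makes the orbit
  -- stationary there, against injectivity within a period.
  by_contra! hcon
  obtain ⟨hl, hh⟩ := hcon
  have hT := hO.T_pos
  obtain ⟨R₁, hR₁⟩ := (isCompact_Icc (a := t₀ - T) (b := t₀)).exists_bound_of_continuousOn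
    hO.contψ.continuousOn
  obtain ⟨R₂, hR₂⟩ := (isCompact_Icc (a := t₀ - T) (b := t₀)).exists_bound_of_continuousOn
    hO.contω.continuousOn
  set R := max R₁ R₂
  obtain ⟨K₁, hK₁, hlip₁⟩ := hlo R
  obtain ⟨K₂, hK₂, hlip₂⟩ := hhi R
  set K := K₁ + K₂ + 1
  have hK : 0 < K := by positivity
  -- The bound T/2 keeps the interval shorter than a period; 1/(4K) makes 2Kδ ≤ 1/2, a contraction
  -- factor.
  set δ := min (T / 2) (1 / (4 * K))
  have hδ : 0 < δ := by positivity
  have hδT : δ < T := (min_le_left _ _).trans_lt (by linarith)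
  have hδK : δ * K ≤ 1 / 4 := by
    have : δ ≤ 1 / (4 * K) := min_le_right _ _
    calc δ * K ≤ 1 / (4 * K) * K := by gcongr
      _ = 1 / 4 := by field_simp
  set n : ℝ → ℝ := fun t => max |ψ t - ψ t₀| |ω t| with hn
  have hnc : Continuous n := ((hO.contψ.sub continuous_const).abs).max hO.contω.abs
  obtain ⟨ts, hts, hmax⟩ := (isCompact_Icc (a := t₀ - δ) (b := t₀)).exists_isMaxOn
    ⟨t₀, by constructor <;> linarith⟩ hnc.continuousOn
  set N := n ts with hN
  have hmax : ∀ t ∈ Icc (t₀ - δ) t₀, n t ≤ N := fun t ht => hmax ht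
  have hN0 : 0 ≤ N := (abs_nonneg _).trans (le_max_left _ _)
  have hsub : Icc (t₀ - δ) t₀ ⊆ Icc (t₀ - T) t₀ := Icc_subset_Icc_left (by linarith)
  have hbd : ∀ t ∈ Icc (t₀ - δ) t₀, |ψ t| ≤ R ∧ |ω t| ≤ R := fun t ht =>
    ⟨(hR₁ t (hsub ht)).trans (le_max_left _ _), (hR₂ t (hsub ht)).trans (le_max_right _ _)⟩
  have hm0 : t₀ ∈ Icc (t₀ - δ) t₀ := ⟨by linarith, le_rfl⟩
  have hR0 : |(0 : ℝ)| ≤ R := by have := (hbd t₀ hm0).2; rwa [h0] at this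
  have hψ : ∀ t ∈ Icc (t₀ - δ) t₀, |ψ t - ψ t₀| ≤ N * δ := by
    intro t ht
    have := (convex_Icc (t₀ - δ) t₀).norm_image_sub_le_of_norm_hasDerivWithin_le (f := ψ)
      (f' := ω) (C := N) (fun x _ => (hO.derivψ x).hasDerivWithinAt)
      (fun x hx => (le_max_right _ _).trans (hmax x hx)) hm0 ht
    refine this.trans ?_
    gcongr
    rw [Real.norm_eq_abs, abs_le]
    constructor <;> linarith [ht.1, ht.2]
  have hhi' : ∀ t ∈ Icc (t₀ - δ) t₀, -(2 * K * N) ≤ hi (ψ t) (ω t) := by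
    intro t ht
    have h1 := hlip₂ (ψ t) (ω t) (ψ t₀) 0 (hbd t ht).1 (hbd t ht).2 (hbd t₀ hm0).1 hR0
    rw [sub_zero] at h1
    have h2 := hmax t ht
    have h3 : |ψ t - ψ t₀| ≤ N := (le_max_left _ _).trans h2
    have h4 : |ω t| ≤ N := (le_max_right _ _).trans h2
    have h5 : K₂ * (|ψ t - ψ t₀| + |ω t|) ≤ K * (N + N) := by gcongr; simp only [K]; linarith
    have h6 := (abs_le.1 h1).1
    linarith
  have hlo' : ∀ t ∈ Icc (t₀ - δ) t₀, lo (ψ t) (ω t) ≤ 2 * K * N := by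
    intro t ht
    have h1 := hlip₁ (ψ t) (ω t) (ψ t₀) 0 (hbd t ht).1 (hbd t ht).2 (hbd t₀ hm0).1 hR0
    rw [sub_zero] at h1
    have h2 := hmax t ht
    have h3 : |ψ t - ψ t₀| ≤ N := (le_max_left _ _).trans h2
    have h4 : |ω t| ≤ N := (le_max_right _ _).trans h2
    have h5 : K₁ * (|ψ t - ψ t₀| + |ω t|) ≤ K * (N + N) := by gcongr; simp only [K]; linarith
    have h6 := (abs_le.1 h1).2
    linarith
  -- From t up to the next zero of ω only one branch acts. For ω > 0 it is hi ≥ -2KN, for ω < 0 it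
  -- is lo ≤ 2KN, and these one-sided bounds are exactly the ones needed when the zero lies at the
  -- later end.
  have hω : ∀ t ∈ Icc (t₀ - δ) t₀, |ω t| ≤ 2 * K * N * δ := by
    intro t ht
    rcases lt_trichotomy (ω t) 0 with hneg | hz | hpos
    · have htt : t < t₀ := lt_of_le_of_ne ht.2 (fun e => by rw [e] at hneg; linarith)
      obtain ⟨τ, hτ, hτ0, hlt⟩ := exists_first_zero (g := fun r => -ω r) hO.contω.neg htt
        (by simp [h0]) (by
          have := ((hO.contω.neg.tendsto t).eventually_const_lt (neg_pos.2 hneg))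
          exact nhdsWithin_le_nhds this)
      have h1 : ∫ r in t..τ, extAcc lo hi ψ ω r ≤ ∫ r in t..τ, (2 * K * N) := by
        refine intervalIntegral.integral_mono_on_of_le_Ioo hτ.1.le (hO.acc_int t τ) (by simp) ?_
        intro r hr
        have h2 : ω r < 0 := by have := hlt r hr; linarith
        rw [extAcc, if_neg (not_le.2 h2)]
        exact hlo' r ⟨by linarith [hr.1, ht.1], by linarith [hr.2, hτ.2]⟩
      rw [← hO.acc_eq, intervalIntegral.integral_const, smul_eq_mul] at h1
      have h3 : ω τ = 0 := by simpa using hτ0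
      rw [abs_of_neg hneg]
      have h4 : τ - t ≤ δ := by linarith [ht.1, hτ.2]
      have h5 : (τ - t) * (2 * K * N) ≤ δ * (2 * K * N) := by gcongr
      linarith
    · rw [hz, abs_zero]; positivity
    · have htt : t < t₀ := lt_of_le_of_ne ht.2 (fun e => by rw [e] at hpos; linarith)
      obtain ⟨τ, hτ, hτ0, hlt⟩ := exists_first_zero hO.contω htt h0
        (nhdsWithin_le_nhds ((hO.contω.tendsto t).eventually_const_lt hpos))
      have h1 : ∫ r in t..τ, -(2 * K * N) ≤ ∫ r in t..τ, extAcc lo hi ψ ω r := by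
        refine intervalIntegral.integral_mono_on_of_le_Ioo hτ.1.le (by simp) (hO.acc_int t τ) ?_
        intro r hr
        rw [extAcc, if_pos (hlt r hr).le]
        exact hhi' r ⟨by linarith [hr.1, ht.1], by linarith [hr.2, hτ.2]⟩
      rw [← hO.acc_eq, intervalIntegral.integral_const, smul_eq_mul] at h1
      rw [abs_of_pos hpos]
      have h4 : τ - t ≤ δ := by linarith [ht.1, hτ.2]
      have h5 : (τ - t) * (2 * K * N) ≤ δ * (2 * K * N) := by gcongr
      linarith
  have hK1 : 1 ≤ K := by simp only [K]; linarith
  have hNz : N = 0 := by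
    have h1 : N ≤ max (N * δ) (2 * K * N * δ) := max_le_max (hψ ts hts) (hω ts hts)
    have h2 : N * δ ≤ 2 * K * N * δ := by
      have : 0 ≤ N * δ := by positivity
      nlinarith
    rw [max_eq_right h2] at h1
    nlinarith
  have hm1 : t₀ - δ ∈ Icc (t₀ - δ) t₀ := ⟨le_rfl, by linarith⟩
  have e1 := hψ _ hm1
  have e2 := hω _ hm1
  rw [hNz] at e1 e2
  have e3 : ψ (t₀ - δ) = ψ t₀ := by
    have := abs_nonpos_iff.1 (e1.trans_eq (zero_mul _)); linarith
  have e4 : ω (t₀ - δ) = ω t₀ := by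
    have := abs_nonpos_iff.1 (e2.trans_eq (by ring)); linarith
  exact hO.ne_of_lt_of_lt (by linarith) (by linarith) e3 e4

end ExtremalOrbit

namespace ExtremalOrbit
variable {lo hi : ℝ → ℝ → ℝ} {ψ ω : ℝ → ℝ} {T : ℝ} (hO : ExtremalOrbit lo hi ψ ω T)
include hO

lemma strictMono_of_pos {s t : ℝ} (hst : s < t) (h : ∀ r ∈ Ioo s t, 0 < ω r) : ψ s < ψ t :=
  (exists_arc_inverse hst hO.derivψ h).1

/-- If after an upper arc and a lower arc the orbit crosses upwards at a point other than the
starting point, it is trapped between the two arcs. -/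
lemma no_inward_spiral {t₀ t₁ t₂ : ℝ} (h01 : t₀ < t₁) (h12 : t₁ < t₂) (h2T : t₂ < t₀ + T)
    (hup : ∀ r ∈ Ioo t₀ t₁, 0 < ω r) (hdown : ∀ r ∈ Ioo t₁ t₂, ω r < 0)
    (hω₁ : ω t₁ = 0) (hω₂ : ω t₂ = 0)
    (hr : ∀ᶠ s in 𝓝[>] t₂, 0 < ω s) (hψ : ψ t₀ < ψ t₂) : False := by
  obtain ⟨hab, τ₁, c₁, m₁, l₁, i₁⟩ := exists_arc_inverse h01 hO.derivψ hup
  obtain ⟨hgb, τ₂', c₂', m₂', l₂', i₂'⟩ := exists_arc_inverse (f := fun r => -ψ r)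
    (f' := fun r => -ω r) h12 (fun r => (hO.derivψ r).neg) (fun r hr => neg_pos.2 (hdown r hr))
  set γ := ψ t₂
  set β := ψ t₁
  have hγβ : γ < β := by simp only [γ, β]; linarith
  set U : ℝ → ℝ := fun x => ω (τ₁ x)
  set L : ℝ → ℝ := fun x => -ω (τ₂' (-x))
  have hUc : ContinuousOn U (Icc γ β) :=
    hO.contω.comp_continuousOn (c₁.mono (Icc_subset_Icc_left hψ.le))
  have hLc : ContinuousOn L (Icc γ β) :=
    (hO.contω.comp_continuousOn (c₂'.comp continuousOn_neg
      (fun x hx => ⟨by simp only [β] at hx; linarith [hx.2], by linarith [hx.1]⟩))).neg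
  have hUγ : 0 < U γ := by
    exact hup _ (i₁ γ ⟨hψ, hγβ⟩).1
  have hUβ : U β = 0 := by simp only [U, β]; rw [(l₁ t₁ ⟨h01.le, le_rfl⟩).2, hω₁]
  have hLβ : L β = 0 := by
    simp only [L, β]; rw [(l₂' t₁ ⟨le_rfl, h12.le⟩).2, hω₁, neg_zero]
  have hLγ : L γ = 0 := by
    simp only [L, γ]; rw [(l₂' t₂ ⟨h12.le, le_rfl⟩).2, hω₂, neg_zero]
  have hLnn : ∀ x ∈ Icc γ β, 0 ≤ L x := by
    intro x hx
    rcases hx.1.eq_or_lt with rfl | h1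
    · exact hLγ.ge
    rcases hx.2.eq_or_lt with rfl | h2
    · exact hLβ.ge
    have := hdown _ (i₂' (-x) ⟨by linarith, by linarith⟩).1
    simp only [L]; linarith
  -- Q is the set of times spent between the two arcs, over the part [γ, β] of the base where both
  -- exist.
  set Q : Set ℝ := (fun t => (ψ t, ω t)) ⁻¹' {p | InInner γ β U L p.1 p.2} with hQ
  have hQo : IsOpen Q := (isOpen_between hUc hLc).preimage (hO.contψ.prodMk hO.contω)
  have hstart : ∀ᶠ s in 𝓝[>] t₂, s ∈ Q := by
    rw [Filter.Eventually, mem_nhdsGT_iff_exists_Ioo_subset] at hr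
    obtain ⟨c, hc, hsub⟩ := hr
    have hψr : Tendsto ψ (𝓝[>] t₂) (𝓝[Icc γ β] γ) := by
      refine tendsto_nhdsWithin_iff.2 ⟨(hO.contψ.tendsto t₂).mono_left nhdsWithin_le_nhds, ?_⟩
      filter_upwards [Ioo_mem_nhdsGT hc, nhdsWithin_le_nhds
        ((hO.contψ.tendsto t₂).eventually_lt_const hγβ)] with s hs hs'
      exact ⟨(hO.strictMono_of_pos hs.1 (fun r hr => hsub ⟨hr.1, hr.2.trans hs.2⟩)).le, hs'.le⟩
    have hU' : Tendsto (fun s => U (ψ s) - ω s) (𝓝[>] t₂) (𝓝 (U γ - 0)) :=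
      ((hUc γ ⟨le_rfl, hγβ.le⟩).tendsto.comp hψr).sub
        (by rw [← hω₂]; exact (hO.contω.tendsto t₂).mono_left nhdsWithin_le_nhds)
    filter_upwards [Ioo_mem_nhdsGT hc, nhdsWithin_le_nhds
        ((hO.contψ.tendsto t₂).eventually_lt_const hγβ),
        hU'.eventually_const_lt (by simpa using hUγ)] with s hs hs' hs''
    have h1 := hO.strictMono_of_pos hs.1 (fun r hr => hsub ⟨hr.1, hr.2.trans hs.2⟩)
    have h2 : 0 < ω s := hsub hs
    have h3 := hLnn (ψ s) ⟨h1.le, hs'.le⟩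
    exact ⟨h1, hs', by simp only; linarith, by simp only; linarith⟩
  rw [Filter.Eventually, mem_nhdsGT_iff_exists_Ioo_subset] at hstart
  obtain ⟨c, hc, hsub⟩ := hstart
  have hc : t₂ < c := hc
  -- By periodicity the orbit comes back to ψ t₀, which lies to the left of γ, so it must leave the
  -- trap.
  have hend : t₀ + T ∉ Q := by
    intro h
    have h1 := h.1
    simp only [hO.perψ t₀] at h1
    linarith
  have hcT : c ≤ t₀ + T := by
    by_contra! h
    exact hend (hsub ⟨h2T, h⟩)
  set Z := Icc c (t₀ + T) ∩ Qᶜ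
  have hZ : IsCompact Z := isCompact_Icc.inter_right hQo.isClosed_compl
  have hm := hZ.sInf_mem ⟨t₀ + T, ⟨hcT, le_rfl⟩, hend⟩
  set τ := sInf Z
  have h2τ : t₂ < τ := hc.trans_le hm.1.1
  have hbefore : ∀ r ∈ Ioo t₂ τ, r ∈ Q := by
    intro r hr
    rcases lt_or_ge r c with h | h
    · exact hsub ⟨hr.1, h⟩
    by_contra h'
    exact absurd (csInf_le hZ.bddBelow ⟨⟨h, hr.2.le.trans hm.1.2⟩, h'⟩) (not_le.2 hr.2)
  have hR : InRegion γ β U L (ψ τ) (ω τ) := by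
    have h1 : Tendsto (fun t => (ψ t, ω t)) (𝓝[<] τ) (𝓝 (ψ τ, ω τ)) :=
      ((hO.contψ.prodMk hO.contω).tendsto τ).mono_left nhdsWithin_le_nhds
    refine (isClosed_between hUc hLc).mem_of_tendsto h1 ?_
    filter_upwards [Ioo_mem_nhdsLT h2τ] with r hr
    obtain ⟨h3, h4, h5, h6⟩ := hbefore r hr
    exact ⟨h3.le, h4.le, h5.le, h6.le⟩
  obtain ⟨r1, r2, r3, r4⟩ := hR
  have hτT : τ < t₀ + T := by
    refine lt_of_le_of_ne hm.1.2 fun e => ?_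
    rw [e, hO.perψ] at r1
    exact absurd hψ (not_lt.2 r1)
  -- Leaving through one of the arcs would repeat a point of the orbit within less than a period.
  have notU : ω τ ≠ U (ψ τ) := by
    intro e
    obtain ⟨h1, h2⟩ := m₁ (ψ τ) ⟨hψ.le.trans r1, r2⟩
    exact hO.ne_of_lt_of_lt (h1.2.trans_lt (h12.trans h2τ)) (by linarith [h1.1]) h2 e.symm
  have notL : ω τ ≠ -L (ψ τ) := by
    intro e
    obtain ⟨h1, h2⟩ := m₂' (-ψ τ) ⟨by linarith, by linarith⟩
    refine hO.ne_of_lt_of_lt (h1.2.trans_lt h2τ) (by linarith [h1.1]) (neg_injective h2) ?_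
    simp only [L] at e; linarith
  have r3' := lt_of_le_of_ne r3 notL.symm
  have r4' := lt_of_le_of_ne r4 notU
  have hβ' : ψ τ < β := lt_of_le_of_ne r2 (fun e => notU (by
    rw [e, hLβ] at r3; rw [e, hUβ] at r4 ⊢; linarith))
  -- Leaving through the side ψ = γ is impossible: there L γ = 0, so ω > 0 and ψ was smaller just
  -- before.
  have hγ' : γ < ψ τ := by
    refine lt_of_le_of_ne r1 (fun e => ?_)
    have hpos : 0 < ω τ := by
      rw [← e, hLγ] at r3'; linarith
    have := (hO.contω.tendsto τ).eventually_const_lt hpos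
    obtain ⟨ε, hε, hb⟩ := Metric.eventually_nhds_iff_ball.1 this
    rw [Real.ball_eq_Ioo] at hb
    set s := max ((t₂ + τ) / 2) (τ - ε / 2)
    have hs1 : s < τ := max_lt (by linarith) (by linarith)
    have hs2 : t₂ < s := lt_of_lt_of_le (by linarith) (le_max_left _ _)
    have hs3 : τ - ε < s := lt_of_lt_of_le (by linarith) (le_max_right _ _)
    have h1 := hO.strictMono_of_pos hs1
      (fun r hr => hb r ⟨hs3.trans hr.1, by linarith [hr.2]⟩)
    have h2 := (hbefore s ⟨hs2, hs1⟩).1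
    simp only at h2
    linarith
  exact hm.2 ⟨hγ', hβ', r3', r4'⟩

/-- A closed orbit of the extremal system consists of one upper and one lower arc. -/
theorem exists_loop (hle : ∀ s w, lo s w ≤ hi s w) (hlo : LocLip lo) (hhi : LocLip hi) :
    ∃ a b U L, Loop lo hi a b U L ∧
      ∀ s w, OnLoop a b U L s w ↔ ∃ t, ψ t = s ∧ ω t = w := by
  have hT := hO.T_pos
  obtain ⟨t₀, -, hmin'⟩ := (isCompact_Icc (a := 0) (b := T)).exists_isMinOn
    ⟨0, le_rfl, hT.le⟩ hO.contψ.continuousOn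
  have hmin : ∀ t, ψ t₀ ≤ ψ t := by
    intro t
    obtain ⟨y, hy, e⟩ := hO.perψ.exists_mem_Ico₀ hT t
    rw [e]; exact hmin' (Ico_subset_Icc_self hy)
  have hω₀ : ω t₀ = 0 :=
    (IsLocalMin.hasDerivAt_eq_zero (Eventually.of_forall hmin) (hO.derivψ t₀))
  -- At the minimum of ψ a downward crossing is excluded: it would be preceded by ω > 0, hence by
  -- smaller values of ψ.
  have hlo₀ : 0 < lo (ψ t₀) 0 := by
    refine (hO.transversal hlo hhi hω₀).resolve_right fun hneg => ?_
    have h1 := (hO.down_crossing hle hhi hω₀ hneg).1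
    rw [Filter.Eventually, mem_nhdsLT_iff_exists_Ioo_subset] at h1
    obtain ⟨c, hc, hsub⟩ := h1
    exact absurd (hO.strictMono_of_pos hc hsub) (not_lt.2 (hmin c))
  have hωT : ω (t₀ + T) = 0 := by rw [hO.perω, hω₀]
  obtain ⟨t₁, ht₁, hω₁, hup⟩ := exists_first_zero hO.contω (s := t₀) (t := t₀ + T) (by linarith)
    hωT (hO.up_crossing hle hlo hω₀ hlo₀).2
  have hhi₁ : hi (ψ t₁) 0 < 0 := by
    refine (hO.transversal hlo hhi hω₁).resolve_left fun hpos => ?_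
    obtain ⟨r, hr1, hr2⟩ := ((hO.up_crossing hle hlo hω₁ hpos).1.and
      (Ioo_mem_nhdsLT ht₁.1)).exists
    linarith [hup r hr2]
  have ht₁T : t₁ < t₀ + T := by
    refine lt_of_le_of_ne ht₁.2 fun e => ?_
    rw [e, hO.perψ] at hhi₁
    linarith [hle (ψ t₀) 0]
  obtain ⟨t₂, ht₂, hω₂, hdown'⟩ := exists_first_zero (g := fun t => -ω t) hO.contω.neg ht₁T
    (by simp [hωT]) (by
      filter_upwards [(hO.down_crossing hle hhi hω₁ hhi₁).2] with s hs using neg_pos.2 hs)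
  have hω₂ : ω t₂ = 0 := by simpa using hω₂
  have hdown : ∀ r ∈ Ioo t₁ t₂, ω r < 0 := fun r hr => neg_pos.1 (hdown' r hr)
  -- A second upward crossing before the end of the period would lie strictly to the right of the
  -- minimum, which `no_inward_spiral` forbids.
  have ht₂T : t₂ = t₀ + T := by
    by_contra hne
    have hlt : t₂ < t₀ + T := lt_of_le_of_ne ht₂.2 hne
    have h1 : ψ t₀ ≠ ψ t₂ := fun e =>
      hO.ne_of_lt_of_lt (ht₁.1.trans ht₂.1) hlt e (hω₀.trans hω₂.symm)
    have hlo₂ : 0 < lo (ψ t₂) 0 := by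
      refine (hO.transversal hlo hhi hω₂).resolve_right fun hneg => ?_
      obtain ⟨r, hr1, hr2⟩ := ((hO.down_crossing hle hhi hω₂ hneg).1.and
        (Ioo_mem_nhdsLT ht₂.1)).exists
      linarith [hdown r hr2]
    exact hO.no_inward_spiral ht₁.1 ht₂.1 hlt hup hdown hω₁ hω₂
      (hO.up_crossing hle hlo hω₂ hlo₂).2 (lt_of_le_of_ne (hmin t₂) h1)
  have hψ₂ : ψ t₂ = ψ t₀ := by rw [ht₂T, hO.perψ]
  obtain ⟨hab, τ₁, c₁, m₁, l₁, i₁⟩ := exists_arc_inverse ht₁.1 hO.derivψ hup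
  obtain ⟨-, τ₂, c₂, m₂, l₂, i₂⟩ := exists_arc_inverse (f := fun r => -ψ r)
    (f' := fun r => -ω r) ht₂.1 (fun r => (hO.derivψ r).neg) (fun r hr => neg_pos.2 (hdown r hr))
  have hneg : ∀ x, x ∈ Icc (ψ t₀) (ψ t₁) → -x ∈ Icc (-ψ t₁) (-ψ t₂) := fun x hx =>
    ⟨by linarith [hx.2], by rw [hψ₂]; linarith [hx.1]⟩
  have hneg' : ∀ x, x ∈ Ioo (ψ t₀) (ψ t₁) → -x ∈ Ioo (-ψ t₁) (-ψ t₂) := fun x hx =>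
    ⟨by linarith [hx.2], by rw [hψ₂]; linarith [hx.1]⟩
  refine ⟨ψ t₀, ψ t₁, fun x => ω (τ₁ x), fun x => -ω (τ₂ (-x)), ⟨hab, ?_, ?_, ?_, ?_, ?_, ?_, ?_,
    ?_, ?_, ?_, hlo₀, hhi₁⟩, ?_⟩
  · exact hO.contω.comp_continuousOn c₁
  · exact (hO.contω.comp_continuousOn (c₂.comp continuousOn_neg hneg)).neg
  · rw [(l₁ t₀ ⟨le_rfl, ht₁.1.le⟩).2, hω₀]
  · rw [(l₁ t₁ ⟨ht₁.1.le, le_rfl⟩).2, hω₁]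
  · rw [← hψ₂, (l₂ t₂ ⟨ht₂.1.le, le_rfl⟩).2, hω₂, neg_zero]
  · rw [(l₂ t₁ ⟨le_rfl, ht₂.1.le⟩).2, hω₁, neg_zero]
  · intro x hx
    exact hup _ (i₁ x hx).1
  · intro x hx
    exact neg_pos.2 (hdown _ (i₂ _ (hneg' x hx)).1)
  · intro x hx
    obtain ⟨h1, h2⟩ := i₁ x hx
    refine ((hO.deriv_upper hhi (hup _ h1)).comp x h2).congr_deriv ?_
    rw [(m₁ x (Ioo_subset_Icc_self hx)).2, div_eq_mul_inv]
  · intro x hx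
    obtain ⟨h1, h2⟩ := i₂ _ (hneg' x hx)
    have h3 := (m₂ _ (hneg x (Ioo_subset_Icc_self hx))).2
    have h3' : ψ (τ₂ (-x)) = x := neg_injective h3
    have h4 := ((hO.deriv_lower hlo (hdown _ h1)).comp x (h2.comp x (hasDerivAt_neg x))).neg
    refine h4.congr_deriv ?_
    rw [h3', neg_neg, div_eq_mul_inv]; ring
  · intro s w
    constructor
    · rintro ⟨h1, h2, h3 | h3⟩
      · exact ⟨τ₁ s, (m₁ s ⟨h1, h2⟩).2, h3.symm⟩
      · exact ⟨τ₂ (-s), neg_injective (m₂ _ (hneg s ⟨h1, h2⟩)).2, by rw [h3]; ring⟩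
    · rintro ⟨t, rfl, rfl⟩
      obtain ⟨y, hy, e1, e2⟩ : ∃ y ∈ Ico t₀ (t₀ + T), ψ t = ψ y ∧ ω t = ω y := by
        refine ⟨toIcoMod hT t₀ t, toIcoMod_mem_Ico hT t₀ t, ?_, ?_⟩
        · rw [toIcoMod]; exact ((hO.perψ.sub_zsmul_eq _)).symm
        · rw [toIcoMod]; exact ((hO.perω.sub_zsmul_eq _)).symm
      rw [e1, e2]
      rcases le_total y t₁ with h | h
      · obtain ⟨h1, h2⟩ := l₁ y ⟨hy.1, h⟩
        exact ⟨h1.1, h1.2, Or.inl (by simp only; rw [h2])⟩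
      · obtain ⟨h1, h2⟩ := l₂ y ⟨h, by rw [ht₂T]; exact hy.2.le⟩
        refine ⟨hmin y, by linarith [h1.1], Or.inr ?_⟩
        simp only; rw [h2, neg_neg]

/-- A closed orbit of one extremal system is a trajectory of any larger differential inclusion. -/
theorem traj (hle : ∀ s w, lo s w ≤ hi s w) (hlo : LocLip lo) (hhi : LocLip hi)
    {lo' hi' : ℝ → ℝ → ℝ} (h1 : ∀ s w, lo' s w ≤ lo s w) (h2 : ∀ s w, hi s w ≤ hi' s w)
    (t₀ t₁ : ℝ) : Traj lo' hi' ψ ω t₀ t₁ where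
  contψ := hO.contψ.continuousOn
  contω := hO.contω.continuousOn
  derivψ := fun t _ => hO.derivψ t
  derivω := fun t _ h0 => by
    rcases lt_or_gt_of_ne h0 with h | h
    · exact ⟨_, h1 _ _, (hle _ _).trans (h2 _ _), hO.deriv_lower hlo h⟩
    · exact ⟨_, (h1 _ _).trans (hle _ _), h2 _ _, hO.deriv_upper hhi h⟩
  up_right := fun t _ h0 h => (hO.up_crossing hle hlo h0 (h.trans_le (h1 _ _))).2
  up_left := fun t _ h0 h => (hO.up_crossing hle hlo h0 (h.trans_le (h1 _ _))).1
  down_right := fun t _ h0 h => (hO.down_crossing hle hhi h0 ((h2 _ _).trans_lt h)).2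
  down_left := fun t _ h0 h => (hO.down_crossing hle hhi h0 ((h2 _ _).trans_lt h)).1

end ExtremalOrbit

/-! ### Sublevel sets of V^CC. -/

section VCC
variable {P : Matrix (Fin 4) (Fin 4) ℝ}

lemma VCC_zero : VCC P 0 = 0 := by simp [VCC]

lemma VCC_smul (c : ℝ) (x : Fin 4 → ℝ) : VCC P (c • x) = c ^ 2 * VCC P x := by
  simp only [VCC, mulVec_smul, smul_dotProduct, dotProduct_smul, smul_eq_mul]; ring

lemma continuous_VCC : Continuous (VCC P) := by
  unfold VCC
  exact continuous_id.dotProduct (Continuous.matrix_mulVec continuous_const continuous_id)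

lemma VCC_pos (hP : P.PosDef) {x : Fin 4 → ℝ} (hx : x ≠ 0) : 0 < VCC P x := by
  have := hP.dotProduct_mulVec_pos hx
  simpa [VCC] using this

lemma VCC_nonneg (hP : P.PosDef) (x : Fin 4 → ℝ) : 0 ≤ VCC P x := by
  by_cases hx : x = 0
  · rw [hx, VCC_zero]
  · exact (VCC_pos hP hx).le

/-- Minimum over the unit sphere, extended by homogeneity of degree two. -/
lemma exists_coercive (hP : P.PosDef) : ∃ c > 0, ∀ x, c * ‖x‖ ^ 2 ≤ VCC P x := by
  have hne : (Metric.sphere (0 : Fin 4 → ℝ) 1).Nonempty := NormedSpace.sphere_nonempty.2 zero_le_one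
  obtain ⟨y, hy, hmin⟩ := (isCompact_sphere (0 : Fin 4 → ℝ) 1).exists_isMinOn hne
    continuous_VCC.continuousOn
  have hy0 : y ≠ 0 := by
    rintro rfl; simp at hy
  refine ⟨VCC P y, VCC_pos hP hy0, fun x => ?_⟩
  by_cases hx : x = 0
  · simp [hx, VCC_zero]
  have hn : ‖x‖ ≠ 0 := norm_ne_zero_iff.2 hx
  have h1 : VCC P y ≤ VCC P (‖x‖⁻¹ • x) := hmin (by simp [norm_smul, hn])
  have h2 : VCC P x = ‖x‖ ^ 2 * VCC P (‖x‖⁻¹ • x) := by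
    rw [VCC_smul]; field_simp
  rw [h2, mul_comm]
  gcongr

lemma isCompact_VCC_le (hP : P.PosDef) (V : ℝ) : IsCompact {x | VCC P x ≤ V} := by
  obtain ⟨c, hc, h⟩ := exists_coercive hP
  refine Metric.isCompact_of_isClosed_isBounded (isClosed_le continuous_VCC continuous_const) ?_
  refine (Metric.isBounded_closedBall (x := (0 : Fin 4 → ℝ)) (r := V / c + 1)).subset fun x hx => ?_
  rw [mem_closedBall_zero_iff]
  have h1 : c * ‖x‖ ^ 2 ≤ V := (h x).trans hx
  have h2 : ‖x‖ ^ 2 ≤ V / c := by rw [le_div_iff₀ hc]; linarith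
  nlinarith [sq_nonneg (‖x‖ - 1)]

/-- From a point of a sublevel set, every direction leads to every higher level. -/
lemma exists_VCC_eq (hP : P.PosDef) {x q : Fin 4 → ℝ} (hq : q ≠ 0) {V : ℝ} (hx : VCC P x < V) :
    ∃ s > (0 : ℝ), VCC P (x + s • q) = V := by
  obtain ⟨c, hc, h⟩ := exists_coercive hP
  have hcont : Continuous (fun s : ℝ => VCC P (x + s • q)) := continuous_VCC.comp (by fun_prop)
  have hn : 0 < ‖q‖ := norm_pos_iff.2 hq
  have hV : 0 < V := (VCC_nonneg hP x).trans_lt hx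
  set s₁ := (V / c + 1 + ‖x‖) / ‖q‖
  have hs₁ : 0 ≤ s₁ := by positivity
  have h1 : V ≤ VCC P (x + s₁ • q) := by
    have h2 : V / c + 1 ≤ ‖x + s₁ • q‖ := by
      have h3 : ‖s₁ • q‖ = V / c + 1 + ‖x‖ := by
        rw [norm_smul, Real.norm_of_nonneg hs₁]; simp only [s₁]; field_simp
      have h4 := norm_sub_le (x + s₁ • q) x
      rw [add_sub_cancel_left, h3] at h4
      linarith
    have h5 : V / c ≤ ‖x + s₁ • q‖ ^ 2 := by
      have : 0 < V / c := by positivity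
      nlinarith
    calc V = c * (V / c) := by field_simp
      _ ≤ c * ‖x + s₁ • q‖ ^ 2 := by gcongr
      _ ≤ _ := h _
  obtain ⟨s, hs, e⟩ := intermediate_value_Icc hs₁ hcont.continuousOn
    (show V ∈ Icc _ _ from ⟨by simpa using hx.le, h1⟩)
  refine ⟨s, lt_of_le_of_ne hs.1 ?_, e⟩
  rintro rfl
  simp only [zero_smul, add_zero] at e
  linarith

end VCC

/-! ### Dependence of f and of the extremal accelerations on x and on the level. -/

namespace InverterSystem
variable (S : InverterSystem) {P : Matrix (Fin 4) (Fin 4) ℝ}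

lemma continuous_denominator : Continuous (fun x : Fin 4 → ℝ => S.μ - S.ν ⬝ᵥ x) := by fun_prop

lemma denominator_ne_zero {x : Fin 4 → ℝ} (h : S.Nonsingular x) : S.μ - S.ν ⬝ᵥ x ≠ 0 :=
  sub_ne_zero.2 (Ne.symm h)

/-- Sublevel sets are star-shaped about 0, where the denominator is μ. If it had another sign at x,
then it would vanish at a multiple c x with c² ≤ 1, still in the sublevel set. -/
lemma denominator_mul_pos (hP : P.PosDef) {Vmax : ℝ} (hns : ∀ x, VCC P x ≤ Vmax → S.Nonsingular x)
    {x : Fin 4 → ℝ} (hx : VCC P x ≤ Vmax) : 0 < (S.μ - S.ν ⬝ᵥ x) * S.μ := by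
  by_contra! hneg
  have hμ := S.μ_ne_zero
  have hμ2 : 0 < S.μ ^ 2 := by positivity
  have h1 : S.μ ^ 2 ≤ (S.ν ⬝ᵥ x) * S.μ := by nlinarith
  set d := S.ν ⬝ᵥ x with hd
  have hd0 : d ≠ 0 := by
    intro h; rw [h] at h1; nlinarith
  set c := S.μ / d with hc
  have hcd : c * d = S.μ := by rw [hc]; field_simp
  have hc2 : c ^ 2 ≤ 1 := by
    have h2 : S.μ ^ 2 ≤ d ^ 2 := by nlinarith [sq_nonneg (d - S.μ)]
    rw [hc, div_pow, div_le_one (by positivity)]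
    exact h2
  refine hns (c • x) ?_ ?_
  · rw [VCC_smul]
    nlinarith [VCC_nonneg hP x]
  · rw [dotProduct_smul, smul_eq_mul, ← hd, hcd]

/-- The pairs `(θ, ω)` where `f(θ, ω, x)` depends on `x`. -/
def Nondegenerate (p : ℝ × ℝ) : Prop := S.μ • S.h p.2 ≠ S.g p.1 p.2 • S.ν

/-- Where `f(θ, ω, ·)` depends on `x`, its values can be decreased and increased by moving to any
higher level of `VCC`. -/
lemma exists_f_lt_and_gt (hP : P.PosDef) {Vmax : ℝ}
    (hns : ∀ x, VCC P x ≤ Vmax → S.Nonsingular x) {p : ℝ × ℝ} (hp : S.Nondegenerate p)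
    {x : Fin 4 → ℝ} {V : ℝ} (hx : VCC P x < V) (hV : V ≤ Vmax) :
    (∃ y, VCC P y = V ∧ S.f p.1 p.2 y < S.f p.1 p.2 x) ∧
      ∃ y, VCC P y = V ∧ S.f p.1 p.2 x < S.f p.1 p.2 y := by
  set N := S.g p.1 p.2 - S.h p.2 ⬝ᵥ x with hN
  set D := S.μ - S.ν ⬝ᵥ x with hD
  have hDx := S.denominator_mul_pos hP hns (hx.le.trans hV)
  have hD0 : D ≠ 0 := left_ne_zero_of_mul hDx.ne'
  -- D² times the gradient of f in x. Along this direction the fractional linear function f has the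
  -- exact increment given in `key`, of the sign of the step.
  set q : Fin 4 → ℝ := N • S.ν - D • S.h p.2 with hq
  have hq0 : q ≠ 0 := by
    intro h0
    have h1 : D • S.h p.2 = N • S.ν := (sub_eq_zero.1 h0).symm
    have h2 : S.h p.2 = (N / D) • S.ν := by
      rw [div_eq_inv_mul, mul_smul, ← h1, smul_smul, inv_mul_cancel₀ hD0, one_smul]
    apply hp
    rw [h2, smul_smul]
    congr 1
    rw [h2, smul_dotProduct, smul_eq_mul] at hN
    have h3 : S.ν ⬝ᵥ x = S.μ - D := by rw [hD]; ring
    rw [h3] at hN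
    field_simp at hN ⊢
    linarith
  have hqq : 0 < q ⬝ᵥ q := by
    have := dotProduct_star_self_pos_iff.2 hq0
    simpa using this
  have key : ∀ s : ℝ, S.μ - S.ν ⬝ᵥ (x + s • q) ≠ 0 → S.f p.1 p.2 (x + s • q) - S.f p.1 p.2 x
      = s * (q ⬝ᵥ q) / (D * (S.μ - S.ν ⬝ᵥ (x + s • q))) := by
    intro s hs
    have e : q ⬝ᵥ q = N * (S.ν ⬝ᵥ q) - D * (S.h p.2 ⬝ᵥ q) := by
      conv_lhs => rw [hq]
      rw [sub_dotProduct, smul_dotProduct, smul_dotProduct, smul_eq_mul, smul_eq_mul]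
    simp only [InverterSystem.f]
    rw [div_sub_div _ _ hs hD0, mul_comm D, e]
    congr 1
    rw [dotProduct_add, dotProduct_add, dotProduct_smul, dotProduct_smul, smul_eq_mul, smul_eq_mul,
      hN, hD]
    ring
  have hprod : ∀ y, VCC P y = V → 0 < D * (S.μ - S.ν ⬝ᵥ y) := by
    intro y hy
    have h1 := S.denominator_mul_pos hP hns (hy.le.trans hV)
    have h2 : 0 < S.μ ^ 2 := by have := S.μ_ne_zero; positivity
    have h3 := mul_pos hDx h1
    by_contra! h4
    nlinarith
  constructor
  · obtain ⟨s, hs, e⟩ := exists_VCC_eq hP (neg_ne_zero.2 hq0) hx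
    have e' : x + s • -q = x + (-s) • q := by rw [smul_neg, neg_smul]
    rw [e'] at e
    refine ⟨_, e, ?_⟩
    have h1 := hprod _ e
    have h2 := key (-s) (right_ne_zero_of_mul h1.ne')
    have h3 : -s * (q ⬝ᵥ q) / (D * (S.μ - S.ν ⬝ᵥ (x + -s • q))) < 0 :=
      div_neg_of_neg_of_pos (by nlinarith) h1
    linarith
  · obtain ⟨s, hs, e⟩ := exists_VCC_eq hP hq0 hx
    refine ⟨_, e, ?_⟩
    have h1 := hprod _ e
    have h2 := key s (right_ne_zero_of_mul h1.ne')
    have h3 : 0 < s * (q ⬝ᵥ q) / (D * (S.μ - S.ν ⬝ᵥ (x + s • q))) := by positivity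
    linarith

variable (P) in
/-- The minimum of `f(θ, ω, x)` over `VCC x ≤ V`. -/
def fMin (V : ℝ) (p : ℝ × ℝ) : ℝ := sInf ((fun x => S.f p.1 p.2 x) '' {x | VCC P x ≤ V})

variable (P) in
/-- The maximum of `f(θ, ω, x)` over `VCC x ≤ V`. -/
def fMax (V : ℝ) (p : ℝ × ℝ) : ℝ := sSup ((fun x => S.f p.1 p.2 x) '' {x | VCC P x ≤ V})

lemma continuousOn_f (p : ℝ × ℝ) {E : Set (Fin 4 → ℝ)} (hE : ∀ x ∈ E, S.Nonsingular x) :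
    ContinuousOn (fun x => S.f p.1 p.2 x) E := by
  unfold InverterSystem.f
  refine ContinuousOn.div ?_ S.continuous_denominator.continuousOn
    (fun x hx => S.denominator_ne_zero (hE x hx))
  fun_prop

section extrema
variable {V : ℝ} (hP : P.PosDef) (hV : 0 ≤ V) (hns : ∀ x, VCC P x ≤ V → S.Nonsingular x)
include hP hV hns

lemma exists_isLeast_fMin (p : ℝ × ℝ) :
    ∃ x, VCC P x ≤ V ∧ S.f p.1 p.2 x = S.fMin P V p ∧
      ∀ y, VCC P y ≤ V → S.fMin P V p ≤ S.f p.1 p.2 y := by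
  obtain ⟨x, hx, hmin⟩ := (isCompact_VCC_le hP V).exists_isMinOn
    ⟨0, by simp [VCC_zero, hV]⟩ (S.continuousOn_f p hns)
  have hL : IsLeast ((fun x => S.f p.1 p.2 x) '' {x | VCC P x ≤ V}) (S.f p.1 p.2 x) :=
    ⟨⟨x, hx, rfl⟩, by rintro _ ⟨y, hy, rfl⟩; exact hmin hy⟩
  have e : S.fMin P V p = S.f p.1 p.2 x := hL.csInf_eq
  exact ⟨x, hx, e.symm, fun y hy => by rw [e]; exact hmin hy⟩

lemma exists_isGreatest_fMax (p : ℝ × ℝ) :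
    ∃ x, VCC P x ≤ V ∧ S.f p.1 p.2 x = S.fMax P V p ∧
      ∀ y, VCC P y ≤ V → S.f p.1 p.2 y ≤ S.fMax P V p := by
  obtain ⟨x, hx, hmax⟩ := (isCompact_VCC_le hP V).exists_isMaxOn
    ⟨0, by simp [VCC_zero, hV]⟩ (S.continuousOn_f p hns)
  have hL : IsGreatest ((fun x => S.f p.1 p.2 x) '' {x | VCC P x ≤ V}) (S.f p.1 p.2 x) :=
    ⟨⟨x, hx, rfl⟩, by rintro _ ⟨y, hy, rfl⟩; exact hmax hy⟩
  have e : S.fMax P V p = S.f p.1 p.2 x := hL.csSup_eq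
  exact ⟨x, hx, e.symm, fun y hy => by rw [e]; exact hmax hy⟩

/-- The constant is uniform in x, which is what survives taking minima and maxima over x. The
denominator is bounded away from zero by compactness. -/
lemma exists_lipschitz_f (R : ℝ) : ∃ K, 0 ≤ K ∧ ∀ x, VCC P x ≤ V → ∀ θ ω θ' ω' : ℝ,
    |θ| ≤ R → |ω| ≤ R → |θ'| ≤ R → |ω'| ≤ R →
      |S.f θ ω x - S.f θ' ω' x| ≤ K * (|θ - θ'| + |ω - ω'|) := by
  obtain ⟨Kg, hg⟩ := S.g_smooth.contDiffOn.exists_lipschitzOnWith one_ne_zero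
    ((convex_Icc (-R) R).prod (convex_Icc (-R) R)) (isCompact_Icc.prod isCompact_Icc)
  obtain ⟨Kh, hh⟩ := S.h_smooth.contDiffOn.exists_lipschitzOnWith one_ne_zero
    (convex_Icc (-R) R) isCompact_Icc
  have hE := isCompact_VCC_le hP V
  obtain ⟨r, hr⟩ := hE.exists_bound_of_continuousOn (f := fun x => x) continuousOn_id
  obtain ⟨x₀, hx₀, hmin⟩ := hE.exists_isMinOn ⟨0, by simp [VCC_zero, hV]⟩
    S.continuous_denominator.abs.continuousOn
  set c := |S.μ - S.ν ⬝ᵥ x₀| with hc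
  have hc0 : 0 < c := abs_pos.2 (S.denominator_ne_zero (hns x₀ hx₀))
  have hr0 : 0 ≤ r := (norm_nonneg _).trans (hr x₀ hx₀)
  refine ⟨(Kg + Kh * (4 * r)) / c, by positivity, fun x hx θ ω θ' ω' h1 h2 h3 h4 => ?_⟩
  have hD : c ≤ |S.μ - S.ν ⬝ᵥ x| := hmin hx
  have hD0 := S.denominator_ne_zero (hns x hx)
  rw [abs_le] at h1 h2 h3 h4
  have e1 : |S.g θ ω - S.g θ' ω'| ≤ Kg * (|θ - θ'| + |ω - ω'|) := by
    have := hg.dist_le_mul (θ, ω) ⟨h1, h2⟩ (θ', ω') ⟨h3, h4⟩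
    rw [Real.dist_eq, Prod.dist_eq, Real.dist_eq, Real.dist_eq] at this
    refine this.trans ?_
    gcongr
    exact max_le (by linarith [abs_nonneg (ω - ω')]) (by linarith [abs_nonneg (θ - θ')])
  have e2 : |(S.h ω - S.h ω') ⬝ᵥ x| ≤ Kh * (4 * r) * (|θ - θ'| + |ω - ω'|) := by
    have h5 := hh.dist_le_mul ω h2 ω' h4
    rw [dist_eq_norm, Real.dist_eq] at h5
    have h6 : |(S.h ω - S.h ω') ⬝ᵥ x| ≤ ∑ _i : Fin 4, (Kh * |ω - ω'|) * r := by
      rw [dotProduct]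
      refine (Finset.abs_sum_le_sum_abs _ _).trans (Finset.sum_le_sum fun i _ => ?_)
      rw [abs_mul]
      gcongr
      · exact (norm_le_pi_norm (S.h ω - S.h ω') i).trans h5
      · exact (norm_le_pi_norm x i).trans (hr x hx)
    rw [Finset.sum_const, Finset.card_univ, Fintype.card_fin, nsmul_eq_mul] at h6
    refine h6.trans ?_
    have : 0 ≤ Kh * (4 * r) * |θ - θ'| := by positivity
    push_cast
    nlinarith
  have e3 : S.f θ ω x - S.f θ' ω' x
      = ((S.g θ ω - S.g θ' ω') - (S.h ω - S.h ω') ⬝ᵥ x) / (S.μ - S.ν ⬝ᵥ x) := by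
    simp only [InverterSystem.f]
    rw [← sub_div, sub_dotProduct]; congr 1; ring
  rw [e3, abs_div, div_le_iff₀ (hc0.trans_le hD)]
  have e4 : |(S.g θ ω - S.g θ' ω') - (S.h ω - S.h ω') ⬝ᵥ x|
      ≤ (Kg + Kh * (4 * r)) * (|θ - θ'| + |ω - ω'|) :=
    (abs_sub _ _).trans (by linarith)
  refine e4.trans ?_
  have : (Kg + Kh * (4 * r)) / c * (|θ - θ'| + |ω - ω'|) * c
      = (Kg + Kh * (4 * r)) * (|θ - θ'| + |ω - ω'|) := by field_simp
  rw [← this]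
  gcongr

end extrema

/-- `ψ = θ - κ ω` satisfies `ψ' = ω` along solutions. -/
def κ : ℝ := S.kp / S.ki

variable (P) in
/-- The maximal acceleration of `ω`, as a function of `ψ = θ - κ ω` and `ω`. -/
def accHi (V : ℝ) (s w : ℝ) : ℝ := -S.ki * S.fMin P V (s + S.κ * w, w)

variable (P) in
/-- The minimal acceleration of `ω`, as a function of `ψ = θ - κ ω` and `ω`. -/
def accLo (V : ℝ) (s w : ℝ) : ℝ := -S.ki * S.fMax P V (s + S.κ * w, w)

lemma κ_pos : 0 < S.κ := div_pos S.kp_pos S.ki_pos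

section acc
variable {V : ℝ} (hP : P.PosDef) (hV : 0 ≤ V) (hns : ∀ x, VCC P x ≤ V → S.Nonsingular x)
include hP hV hns

lemma acc_mem {x : Fin 4 → ℝ} (hx : VCC P x ≤ V) (s w : ℝ) :
    S.accLo P V s w ≤ -S.ki * S.f (s + S.κ * w) w x ∧
      -S.ki * S.f (s + S.κ * w) w x ≤ S.accHi P V s w := by
  obtain ⟨-, -, -, h1⟩ := S.exists_isLeast_fMin hP hV hns (s + S.κ * w, w)
  obtain ⟨-, -, -, h2⟩ := S.exists_isGreatest_fMax hP hV hns (s + S.κ * w, w)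
  have h1 := h1 x hx
  have h2 := h2 x hx
  have := S.ki_pos
  simp only [accLo, accHi]
  simp only at h1 h2
  constructor <;> nlinarith

lemma accLo_le_accHi (s w : ℝ) : S.accLo P V s w ≤ S.accHi P V s w := by
  have := S.acc_mem hP hV hns (x := 0) (by rwa [VCC_zero]) s w
  exact this.1.trans this.2

lemma exists_lipschitz_shear (R : ℝ) : ∃ K, 0 ≤ K ∧ ∀ x, VCC P x ≤ V → ∀ s w s' w' : ℝ,
    |s| ≤ R → |w| ≤ R → |s'| ≤ R → |w'| ≤ R →
      |S.f (s + S.κ * w) w x - S.f (s' + S.κ * w') w' x| ≤ K * (|s - s'| + |w - w'|) := by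
  obtain ⟨K, hK, h⟩ := S.exists_lipschitz_f hP hV hns (R + S.κ * R)
  have hκ := S.κ_pos
  refine ⟨K * (1 + S.κ), by positivity, fun x hx s w s' w' h1 h2 h3 h4 => ?_⟩
  have hR : 0 ≤ R := (abs_nonneg _).trans h1
  have hb : ∀ s w : ℝ, |s| ≤ R → |w| ≤ R → |s + S.κ * w| ≤ R + S.κ * R := by
    intro s w h1 h2
    refine (abs_add_le _ _).trans ?_
    rw [abs_mul, abs_of_pos hκ]
    gcongr
  have hb' : ∀ w : ℝ, |w| ≤ R → |w| ≤ R + S.κ * R := fun w h => by nlinarith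
  refine (h x hx _ _ _ _ (hb s w h1 h2) (hb' w h2) (hb s' w' h3 h4) (hb' w' h4)).trans ?_
  rw [mul_assoc]
  gcongr
  have : |s + S.κ * w - (s' + S.κ * w')| ≤ |s - s'| + S.κ * |w - w'| := by
    rw [← abs_of_pos hκ, ← abs_mul, abs_of_pos hκ]
    refine le_of_eq_of_le ?_ (abs_add_le _ _)
    congr 1; ring
  nlinarith [abs_nonneg (s - s'), abs_nonneg (w - w')]

lemma locLip_accHi : LocLip (S.accHi P V) := by
  intro R
  obtain ⟨K, hK, h⟩ := S.exists_lipschitz_shear hP hV hns R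
  have hki := S.ki_pos
  refine ⟨S.ki * K, by positivity, ?_⟩
  have aux : ∀ s w s' w' : ℝ, |s| ≤ R → |w| ≤ R → |s'| ≤ R → |w'| ≤ R →
      S.accHi P V s w - S.accHi P V s' w' ≤ S.ki * K * (|s - s'| + |w - w'|) := by
    intro s w s' w' h1 h2 h3 h4
    -- The minimizer at one point competes at the other one, so the difference of minima is bounded
    -- by a difference at the same x.
    obtain ⟨x, hx, e, -⟩ := S.exists_isLeast_fMin hP hV hns (s + S.κ * w, w)
    obtain ⟨-, -, -, h'⟩ := S.exists_isLeast_fMin hP hV hns (s' + S.κ * w', w')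
    have h5 := (abs_le.1 (h x hx s w s' w' h1 h2 h3 h4)).1
    have h6 := h' x hx
    simp only at e h6
    simp only [accHi]
    rw [← e]
    nlinarith
  intro s w s' w' h1 h2 h3 h4
  rw [abs_le]
  refine ⟨?_, aux s w s' w' h1 h2 h3 h4⟩
  have := aux s' w' s w h3 h4 h1 h2
  rw [abs_sub_comm s' s, abs_sub_comm w' w] at this
  linarith

lemma locLip_accLo : LocLip (S.accLo P V) := by
  intro R
  obtain ⟨K, hK, h⟩ := S.exists_lipschitz_shear hP hV hns R
  have hki := S.ki_pos
  refine ⟨S.ki * K, by positivity, ?_⟩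
  have aux : ∀ s w s' w' : ℝ, |s| ≤ R → |w| ≤ R → |s'| ≤ R → |w'| ≤ R →
      S.accLo P V s w - S.accLo P V s' w' ≤ S.ki * K * (|s - s'| + |w - w'|) := by
    intro s w s' w' h1 h2 h3 h4
    obtain ⟨x, hx, e, -⟩ := S.exists_isGreatest_fMax hP hV hns (s' + S.κ * w', w')
    obtain ⟨-, -, -, h'⟩ := S.exists_isGreatest_fMax hP hV hns (s + S.κ * w, w)
    have h5 := (abs_le.1 (h x hx s w s' w' h1 h2 h3 h4)).1
    have h6 := h' x hx
    simp only at e h6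
    simp only [accLo]
    rw [← e]
    nlinarith
  intro s w s' w' h1 h2 h3 h4
  rw [abs_le]
  refine ⟨?_, aux s w s' w' h1 h2 h3 h4⟩
  have := aux s' w' s w h3 h4 h1 h2
  rw [abs_sub_comm s' s, abs_sub_comm w' w] at this
  linarith

end acc

section mono
variable {V V' : ℝ} (hP : P.PosDef) (hV : 0 ≤ V) (hVV : V ≤ V')
  (hns : ∀ x, VCC P x ≤ V' → S.Nonsingular x)
include hP hV hVV hns

lemma accHi_mono (s w : ℝ) : S.accHi P V s w ≤ S.accHi P V' s w := by
  obtain ⟨x, hx, e, -⟩ := S.exists_isLeast_fMin hP hV (fun x hx => hns x (hx.trans hVV))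
    (s + S.κ * w, w)
  have := (S.acc_mem hP (hV.trans hVV) hns (hx.trans hVV) s w).2
  simp only [accHi] at this ⊢
  rwa [← e]

lemma accLo_anti (s w : ℝ) : S.accLo P V' s w ≤ S.accLo P V s w := by
  obtain ⟨x, hx, e, -⟩ := S.exists_isGreatest_fMax hP hV (fun x hx => hns x (hx.trans hVV))
    (s + S.κ * w, w)
  have := (S.acc_mem hP (hV.trans hVV) hns (hx.trans hVV) s w).1
  simp only [accLo] at this ⊢
  rwa [← e]

end mono

/-- At nondegenerate points, the bounds on the acceleration are exceeded at every higher level. -/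
lemma exists_acc_gt_and_lt (hP : P.PosDef) {V V' : ℝ} (hV : 0 ≤ V) (hVV : V < V')
    (hns : ∀ x, VCC P x ≤ V' → S.Nonsingular x) {s w : ℝ}
    (hp : S.Nondegenerate (s + S.κ * w, w)) :
    (∃ y, VCC P y = V' ∧ S.accHi P V s w < -S.ki * S.f (s + S.κ * w) w y) ∧
      ∃ y, VCC P y = V' ∧ -S.ki * S.f (s + S.κ * w) w y < S.accLo P V s w := by
  have hki := S.ki_pos
  constructor
  · obtain ⟨x, hx, e, -⟩ := S.exists_isLeast_fMin hP hV (fun x hx => hns x (hx.trans hVV.le))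
      (s + S.κ * w, w)
    obtain ⟨y, hy, hlt⟩ := (S.exists_f_lt_and_gt hP hns hp (hx.trans_lt hVV) le_rfl).1
    refine ⟨y, hy, ?_⟩
    simp only [accHi]
    rw [← e]
    simp only at hlt ⊢
    nlinarith
  · obtain ⟨x, hx, e, -⟩ := S.exists_isGreatest_fMax hP hV (fun x hx => hns x (hx.trans hVV.le))
      (s + S.κ * w, w)
    obtain ⟨y, hy, hlt⟩ := (S.exists_f_lt_and_gt hP hns hp (hx.trans_lt hVV) le_rfl).2
    refine ⟨y, hy, ?_⟩
    simp only [accLo]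
    rw [← e]
    simp only at hlt ⊢
    nlinarith

/-- At nondegenerate points, `x = 0` does not give an extremal acceleration. -/
lemma acc_zero_lt_and_gt (hP : P.PosDef) {V : ℝ} (hV : 0 < V)
    (hns : ∀ x, VCC P x ≤ V → S.Nonsingular x) {s w : ℝ}
    (hp : S.Nondegenerate (s + S.κ * w, w)) :
    -S.ki * S.f (s + S.κ * w) w 0 < S.accHi P V s w ∧
      S.accLo P V s w < -S.ki * S.f (s + S.κ * w) w 0 := by
  have hki := S.ki_pos
  obtain ⟨⟨y, hy, h1⟩, z, hz, h2⟩ := S.exists_f_lt_and_gt hP hns hp (x := 0)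
    (by rwa [VCC_zero]) le_rfl
  have h3 := (S.acc_mem hP hV.le hns hy.le s w).2
  have h4 := (S.acc_mem hP hV.le hns hz.le s w).1
  simp only at h1 h2
  constructor <;> nlinarith

end InverterSystem

/-! ### The closed region of a curve made of two graphs. -/

section closedRegion
variable {lo hi : ℝ → ℝ → ℝ} {a b : ℝ} {U L : ℝ → ℝ} {κ : ℝ} {C : Set (ℝ × ℝ)}

lemma Loop.isBounded_region (h : Loop lo hi a b U L) (κ : ℝ) :
    Bornology.IsBounded {p : ℝ × ℝ | InRegion a b U L (p.1 - κ * p.2) p.2} := by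
  obtain ⟨M, hM⟩ := isCompact_Icc.exists_bound_of_continuousOn h.contU
  obtain ⟨M', hM'⟩ := isCompact_Icc.exists_bound_of_continuousOn h.contL
  have hK : IsCompact ((fun q : ℝ × ℝ => (q.1 + κ * q.2, q.2)) '' (Icc a b ×ˢ Icc (-M') M)) :=
    (isCompact_Icc.prod isCompact_Icc).image (by fun_prop)
  refine hK.isBounded.subset ?_
  rintro p ⟨h1, h2, h3, h4⟩
  refine ⟨(p.1 - κ * p.2, p.2), ⟨⟨h1, h2⟩, ?_, ?_⟩, by ext <;> simp⟩
  · have := (le_abs_self _).trans (hM' _ ⟨h1, h2⟩)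
    simp only; linarith
  · have := (le_abs_self _).trans (hM _ ⟨h1, h2⟩)
    simp only; linarith

/-- The ray is connected and unbounded, hence so is the component containing it; only the second
coordinate is used to measure its length. -/
lemma not_isBounded_component_of_ray {p e : ℝ × ℝ} (he : e.2 ≠ 0)
    (h : ∀ r : ℝ, 0 ≤ r → p + r • e ∉ C) : ¬ Bornology.IsBounded (connectedComponentIn Cᶜ p) := by
  intro hb
  have hpre : IsPreconnected ((fun r : ℝ => p + r • e) '' Ici 0) :=
    isPreconnected_Ici.image _ (by fun_prop)
  have hsub : (fun r : ℝ => p + r • e) '' Ici 0 ⊆ connectedComponentIn Cᶜ p := by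
    refine hpre.subset_connectedComponentIn ⟨0, self_mem_Ici, by simp⟩ ?_
    rintro _ ⟨r, hr, rfl⟩
    exact h r hr
  obtain ⟨M, hM⟩ := (hb.subset hsub).exists_norm_le
  have hM0 : 0 ≤ M := (norm_nonneg _).trans (hM p ⟨0, self_mem_Ici, by simp⟩)
  have he' : 0 < |e.2| := abs_pos.2 he
  set r := (M + |p.2| + 1) / |e.2|
  have hr : 0 ≤ r := by positivity
  have h1 := (norm_snd_le _).trans (hM _ ⟨r, hr, rfl⟩)
  have h2 : |r * e.2| = M + |p.2| + 1 := by
    rw [abs_mul, abs_of_nonneg hr]; simp only [r]; field_simp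
  have h3 : |r * e.2| ≤ |p.2 + r * e.2| + |p.2| := by
    have := abs_sub (p.2 + r * e.2) p.2
    rwa [add_sub_cancel_left] at this
  have h4 : |p.2 + r * e.2| ≤ M := h1
  linarith

/-- The closed region bounded by a loop is the region between its two arcs. -/
lemma Loop.mem_closedRegion_iff (h : Loop lo hi a b U L)
    (hC : ∀ p : ℝ × ℝ, p ∈ C ↔ OnLoop a b U L (p.1 - κ * p.2) p.2) (p : ℝ × ℝ) :
    p ∈ closedRegion C ↔ InRegion a b U L (p.1 - κ * p.2) p.2 := by
  have hφ : Continuous (fun p : ℝ × ℝ => (p.1 - κ * p.2, p.2)) := by fun_prop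
  constructor
  · rintro (hp | ⟨hp, hb⟩)
    · exact h.onLoop_inRegion ((hC p).1 hp)
    by_contra hn
    -- The escape rays keep ψ fixed: a point outside the region can move up or down its own column
    -- without meeting the loop.
    have hcoord : ∀ r : ℝ, (p + r • (κ, (1 : ℝ))).1 - κ * (p + r • (κ, (1 : ℝ))).2
        = p.1 - κ * p.2 := by intro r; simp; ring
    have hcoord' : ∀ r : ℝ, (p + r • (-κ, (-1 : ℝ))).1 - κ * (p + r • (-κ, (-1 : ℝ))).2
        = p.1 - κ * p.2 := by intro r; simp; ring
    by_cases h5 : p.2 < -L (p.1 - κ * p.2)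
    · refine not_isBounded_component_of_ray (p := p) (e := (-κ, -1)) (by simp) (fun r hr => ?_) hb
      rw [hC, hcoord']
      rintro ⟨h1, h2, h3⟩
      have hU := h.U_nonneg h1 h2
      have hL := h.L_nonneg h1 h2
      simp at h3
      rcases h3 with h3 | h3 <;> linarith
    · refine not_isBounded_component_of_ray (p := p) (e := (κ, 1)) (by simp) (fun r hr => ?_) hb
      rw [hC, hcoord]
      rintro ⟨h1, h2, h3⟩
      have hU := h.U_nonneg h1 h2
      have hL := h.L_nonneg h1 h2
      have h6 : U (p.1 - κ * p.2) < p.2 := by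
        by_contra! h6
        exact hn ⟨h1, h2, not_lt.1 h5, h6⟩
      simp at h3
      rcases h3 with h3 | h3 <;> linarith
  · intro hp
    rcases h.inInner_or_onLoop hp with hi' | hc
    · have hpC : p ∉ C := fun hc => Loop.not_inInner_of_onLoop ((hC p).1 hc) hi'
      refine Or.inr ⟨hpC, ?_⟩
      have hsub : connectedComponentIn Cᶜ p ⊆
          {q : ℝ × ℝ | InInner a b U L (q.1 - κ * q.2) q.2} := by
        refine isPreconnected_connectedComponentIn.subset_left_of_subset_union
          (h.isOpen_inner.preimage hφ) (h.isClosed_region.isOpen_compl.preimage hφ) ?_ ?_ ?_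
        · rw [Set.disjoint_left]
          intro q h1 h2
          exact h2 (Loop.inInner_inRegion h1)
        · intro q hq
          have hq' := connectedComponentIn_subset _ _ hq
          by_cases h1 : InRegion a b U L (q.1 - κ * q.2) q.2
          · exact Or.inl ((h.inInner_or_onLoop h1).resolve_right fun h2 => hq' ((hC q).2 h2))
          · exact Or.inr h1
        · exact ⟨p, mem_connectedComponentIn hpC, hi'⟩
      exact (h.isBounded_region κ).subset fun q hq => Loop.inInner_inRegion (hsub hq)
    · exact Or.inl ((hC p).2 hc)

lemma Loop.mem_inner_iff (h : Loop lo hi a b U L)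
    (hC : ∀ p : ℝ × ℝ, p ∈ C ↔ OnLoop a b U L (p.1 - κ * p.2) p.2) (p : ℝ × ℝ) :
    p ∈ closedRegion C \ C ↔ InInner a b U L (p.1 - κ * p.2) p.2 := by
  rw [Set.mem_sdiff, h.mem_closedRegion_iff hC, hC]
  exact ⟨fun h' => (h.inInner_or_onLoop h'.1).resolve_right h'.2,
    fun h' => ⟨Loop.inInner_inRegion h', fun h'' => Loop.not_inInner_of_onLoop h'' h'⟩⟩

end closedRegion

/-! ### Closed orbits of the comparison system in sheared coordinates. -/

namespace InverterSystem
variable (S : InverterSystem) {P : Matrix (Fin 4) (Fin 4) ℝ}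

lemma extAcc_eq (V : ℝ) (u : ℝ → ℝ × ℝ) (t : ℝ) :
    extAcc (S.accLo P V) (S.accHi P V) (fun t => (u t).1 - S.κ * (u t).2) (fun t => (u t).2) t
      = (S.compField P V (u t)).2 := by
  have e : (u t).1 - S.κ * (u t).2 + S.κ * (u t).2 = (u t).1 := by ring
  simp only [extAcc, accLo, accHi, compField, fStar, fMin, fMax, e]
  split_ifs <;> rfl

lemma extremalOrbit_of_isClosedOrbit {V : ℝ} {C : Set (ℝ × ℝ)} (h : S.IsClosedOrbit P V C) :
    ∃ (T : ℝ) (u : ℝ → ℝ × ℝ), ExtremalOrbit (S.accLo P V) (S.accHi P V)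
      (fun t => (u t).1 - S.κ * (u t).2) (fun t => (u t).2) T ∧ range u = C := by
  obtain ⟨T, u, hT, hper, hinj, hu, hr⟩ := h
  have hint : ∀ s t, IntervalIntegrable (fun r => S.compField P V (u r)) volume s t :=
    fun s t => (hu s).1.symm.trans (hu t).1
  have hcont : Continuous u := by
    have : u = fun t => u 0 + ∫ s in (0 : ℝ)..t, S.compField P V (u s) := funext fun t => (hu t).2
    rw [this]
    exact continuous_const.add (intervalIntegral.continuous_primitive hint 0)
  have hint2 : ∀ s t, IntervalIntegrable (fun r => (S.compField P V (u r)).2) volume s t :=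
    fun s t => ⟨(hint s t).1.snd, (hint s t).2.snd⟩
  have hint1 : ∀ s t, IntervalIntegrable (fun r => (S.compField P V (u r)).1) volume s t :=
    fun s t => ⟨(hint s t).1.fst, (hint s t).2.fst⟩
  have h2 : ∀ t, (u t).2 = (u 0).2 + ∫ s in (0 : ℝ)..t, (S.compField P V (u s)).2 := by
    intro t
    have := ContinuousLinearMap.intervalIntegral_comp_comm (ContinuousLinearMap.snd ℝ ℝ ℝ)
      (hu t).1
    simp only [ContinuousLinearMap.coe_snd'] at this
    rw [this]
    conv_lhs => rw [(hu t).2]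
    rfl
  have h1 : ∀ t, (u t).1 = (u 0).1 + ∫ s in (0 : ℝ)..t, (S.compField P V (u s)).1 := by
    intro t
    have := ContinuousLinearMap.intervalIntegral_comp_comm (ContinuousLinearMap.fst ℝ ℝ ℝ)
      (hu t).1
    simp only [ContinuousLinearMap.coe_fst'] at this
    rw [this]
    conv_lhs => rw [(hu t).2]
    rfl
  have hκ : S.κ * S.ki = S.kp := div_mul_cancel₀ _ S.ki_pos.ne'
  -- The discontinuous terms cancel in ψ, which therefore is the integral of the continuous function
  -- ω and is differentiable everywhere.
  have hψ : ∀ t, (u t).1 - S.κ * (u t).2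
      = (u 0).1 - S.κ * (u 0).2 + ∫ s in (0 : ℝ)..t, (u s).2 := by
    intro t
    have e : ∀ s, (u s).2 = (S.compField P V (u s)).1 - S.κ * (S.compField P V (u s)).2 := by
      intro s; simp only [compField]; rw [← hκ]; ring
    have e2 : ∫ s in (0 : ℝ)..t, (u s).2 = (∫ s in (0 : ℝ)..t, (S.compField P V (u s)).1)
        - S.κ * ∫ s in (0 : ℝ)..t, (S.compField P V (u s)).2 := by
      rw [← intervalIntegral.integral_const_mul, ← intervalIntegral.integral_sub (hint1 0 t)
        ((hint2 0 t).const_mul _)]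
      exact intervalIntegral.integral_congr fun s _ => e s
    rw [e2, h1 t, h2 t]; ring
  refine ⟨T, u, ⟨hT, fun t => by simp only [hper t], fun t => by simp only [hper t], ?_, ?_,
    continuous_snd.comp hcont, ?_, ?_⟩, hr⟩
  · intro s t e1 e2
    change (u s).2 = (u t).2 at e2
    rw [e2] at e1
    have e : u s = u t := Prod.ext (by linarith) e2
    have hs : u (toIcoMod hT 0 s) = u s := by rw [toIcoMod]; exact hper.sub_zsmul_eq _
    have ht : u (toIcoMod hT 0 t) = u t := by rw [toIcoMod]; exact hper.sub_zsmul_eq _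
    have hs' := toIcoMod_mem_Ico hT 0 s
    have ht' := toIcoMod_mem_Ico hT 0 t
    rw [zero_add] at hs' ht'
    have := hinj hs' ht' (by rw [hs, ht, e])
    refine ⟨toIcoDiv hT 0 t - toIcoDiv hT 0 s, ?_⟩
    rw [toIcoMod, toIcoMod] at this
    push_cast
    simp only [zsmul_eq_mul] at this
    linarith
  · intro t
    have hc2 : Continuous fun s => (u s).2 := continuous_snd.comp hcont
    have := (intervalIntegral.integral_hasDerivAt_right (hc2.intervalIntegrable 0 t)
      (hc2.stronglyMeasurableAtFilter _ _) hc2.continuousAt).const_add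
        ((u 0).1 - S.κ * (u 0).2)
    refine this.congr_of_eventuallyEq (Eventually.of_forall fun s => hψ s)
  · intro s t
    exact (hint2 s t).congr (fun r _ => (S.extAcc_eq V u r).symm)
  · intro s t
    have e : ∫ r in s..t, extAcc (S.accLo P V) (S.accHi P V)
        (fun t => (u t).1 - S.κ * (u t).2) (fun t => (u t).2) r
        = ∫ r in s..t, (S.compField P V (u r)).2 :=
      intervalIntegral.integral_congr fun r _ => S.extAcc_eq V u r
    rw [e, h2 t, h2 s, ← intervalIntegral.integral_interval_sub_left (hint2 0 t) (hint2 0 s)]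
    ring

end InverterSystem

/-! ### The family of cycles: semicontinuity in V and filling. -/

namespace InverterSystem

/-- The standing assumptions on the family of limit cycles. -/
structure CycleFamily (S : InverterSystem) (P : Matrix (Fin 4) (Fin 4) ℝ) (Vbar Vmax : ℝ)
    (C : ℝ → Set (ℝ × ℝ)) : Prop where
  posDef : P.PosDef
  Vbar_pos : 0 < Vbar
  lt : Vbar < Vmax
  nonsing : ∀ x, VCC P x ≤ Vmax → S.Nonsingular x
  family : S.IsLimitCycleFamily P Vbar C

namespace CycleFamily
variable {S : InverterSystem} {P : Matrix (Fin 4) (Fin 4) ℝ} {Vbar Vmax : ℝ}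
  {C : ℝ → Set (ℝ × ℝ)} (H : S.CycleFamily P Vbar Vmax C)
include H

lemma nonsing' {V : ℝ} (hV : V ≤ Vbar) : ∀ x, VCC P x ≤ V → S.Nonsingular x :=
  fun x hx => H.nonsing x (hx.trans (hV.trans H.lt.le))

lemma zero : C 0 = {0} := H.family.1

lemma exists_loop {V : ℝ} (hV : V ∈ Ioc 0 Vbar) :
    ∃ a b U L, Loop (S.accLo P V) (S.accHi P V) a b U L ∧
      ∀ p : ℝ × ℝ, p ∈ C V ↔ OnLoop a b U L (p.1 - S.κ * p.2) p.2 := by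
  obtain ⟨T, u, hO, hr⟩ := S.extremalOrbit_of_isClosedOrbit (H.family.2.1 V hV).1
  obtain ⟨a, b, U, L, hl, hc⟩ := hO.exists_loop
    (S.accLo_le_accHi H.posDef hV.1.le (H.nonsing' hV.2))
    (S.locLip_accLo H.posDef hV.1.le (H.nonsing' hV.2))
    (S.locLip_accHi H.posDef hV.1.le (H.nonsing' hV.2))
  refine ⟨a, b, U, L, hl, fun p => ?_⟩
  rw [hc, ← hr]
  constructor
  · rintro ⟨t, rfl⟩; exact ⟨t, rfl, rfl⟩
  · rintro ⟨t, h1, h2⟩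
    refine ⟨t, Prod.ext ?_ h2⟩
    rw [h2] at h1; linarith

omit H in
lemma mem_iff_image {V : ℝ} {Γ : ℝ × ℝ → ℝ × ℝ}
    (hΓ : ∀ V ∈ Icc 0 Vbar, Function.Periodic (fun σ => Γ (V, σ)) 1 ∧
        range (fun σ => Γ (V, σ)) = C V) (hV : V ∈ Icc 0 Vbar) (p : ℝ × ℝ) :
    p ∈ C V ↔ ∃ σ ∈ Icc (0 : ℝ) 1, Γ (V, σ) = p := by
  rw [← (hΓ V hV).2]
  constructor
  · rintro ⟨σ, rfl⟩
    obtain ⟨y, hy, e⟩ := (hΓ V hV).1.exists_mem_Ico₀ one_pos σ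
    exact ⟨y, Ico_subset_Icc_self hy, e.symm⟩
  · rintro ⟨σ, -, rfl⟩; exact ⟨σ, rfl⟩

/-- By periodicity σ may be restricted to [0, 1], and the set is the projection of a compact set of
pairs (V, σ). -/
lemma isClosed_meets {A : Set (ℝ × ℝ)} (hA : IsClosed A) :
    IsClosed {V | V ∈ Icc 0 Vbar ∧ ∃ q ∈ C V, q ∈ A} := by
  obtain ⟨-, -, Γ, hΓ, -, hp, -⟩ := H.family
  have hK : IsCompact (Icc 0 Vbar ×ˢ Icc (0 : ℝ) 1 ∩ Γ ⁻¹' A) := by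
    refine (isCompact_Icc.prod isCompact_Icc).of_isClosed_subset ?_ inter_subset_left
    exact (hΓ.mono (prod_mono le_rfl (subset_univ _))).preimage_isClosed_of_isClosed
      (isClosed_Icc.prod isClosed_Icc) hA
  convert (hK.image continuous_fst).isClosed using 1
  ext V
  constructor
  · rintro ⟨hV, q, hq, hqA⟩
    obtain ⟨σ, hσ, rfl⟩ := (mem_iff_image hp hV q).1 hq
    exact ⟨(V, σ), ⟨⟨hV, hσ⟩, hqA⟩, rfl⟩
  · rintro ⟨⟨V, σ⟩, ⟨⟨hV, hσ⟩, hA⟩, rfl⟩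
    exact ⟨hV, _, (mem_iff_image hp hV _).2 ⟨σ, hσ, rfl⟩, hA⟩

lemma eventually_meets {A : Set (ℝ × ℝ)} (hA : IsOpen A) {V₀ : ℝ} (hV₀ : V₀ ∈ Icc 0 Vbar)
    (h : ∃ q ∈ C V₀, q ∈ A) : ∀ᶠ V in 𝓝[Icc 0 Vbar] V₀, ∃ q ∈ C V, q ∈ A := by
  obtain ⟨-, -, Γ, hΓ, -, hp, -⟩ := H.family
  obtain ⟨q, hq, hqA⟩ := h
  obtain ⟨σ, hσ, rfl⟩ := (mem_iff_image hp hV₀ q).1 hq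
  have h1 : ContinuousOn (fun V => Γ (V, σ)) (Icc 0 Vbar) :=
    hΓ.comp (by fun_prop) (fun V hV => ⟨hV, mem_univ _⟩)
  filter_upwards [(h1 V₀ hV₀).eventually (hA.mem_nhds hqA), self_mem_nhdsWithin] with V h2 hV
  exact ⟨_, (mem_iff_image hp hV _).2 ⟨σ, hσ, rfl⟩, h2⟩

lemma eventually_not_meets {A : Set (ℝ × ℝ)} (hA : IsClosed A) {V₀ : ℝ}
    (h : ∀ q ∈ C V₀, q ∉ A) : ∀ᶠ V in 𝓝[Icc 0 Vbar] V₀, ∀ q ∈ C V, q ∉ A := by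
  have h1 := (H.isClosed_meets hA).isOpen_compl.mem_nhds
    (show V₀ ∈ {V | V ∈ Icc 0 Vbar ∧ ∃ q ∈ C V, q ∈ A}ᶜ from fun ⟨_, q, hq, hqA⟩ => h q hq hqA)
  filter_upwards [nhdsWithin_le_nhds h1, self_mem_nhdsWithin] with V h2 hV q hq hqA
  exact h2 ⟨hV, q, hq, hqA⟩

/-- A point is in the closed region iff, on its line `θ - κ ω = const`, there are points of the
curve above and below it. -/
lemma mem_closedRegion_iff_column {V : ℝ} (hV : V ∈ Ioc 0 Vbar) (p : ℝ × ℝ) :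
    p ∈ closedRegion (C V) ↔
      (∃ q ∈ C V, q.1 - S.κ * q.2 = p.1 - S.κ * p.2 ∧ p.2 ≤ q.2) ∧
      (∃ q ∈ C V, q.1 - S.κ * q.2 = p.1 - S.κ * p.2 ∧ q.2 ≤ p.2) := by
  obtain ⟨a, b, U, L, hl, hc⟩ := H.exists_loop hV
  rw [hl.mem_closedRegion_iff hc]
  constructor
  · rintro ⟨h1, h2, h3, h4⟩
    set s := p.1 - S.κ * p.2
    refine ⟨⟨(s + S.κ * U s, U s), ?_, by simp, h4⟩, ⟨(s + S.κ * (-L s), -L s), ?_, by simp, h3⟩⟩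
    · rw [hc]; simp only [add_sub_cancel_right]; exact ⟨h1, h2, Or.inl rfl⟩
    · rw [hc]; simp only [add_sub_cancel_right]; exact ⟨h1, h2, Or.inr rfl⟩
  · rintro ⟨⟨q, hq, e, h⟩, ⟨q', hq', e', h'⟩⟩
    have k := hl.onLoop_inRegion ((hc q).1 hq)
    have k' := hl.onLoop_inRegion ((hc q').1 hq')
    rw [e] at k
    rw [e'] at k'
    exact ⟨k.1, k.2.1, k'.2.2.1.trans h', h.trans k.2.2.2⟩

lemma isClosed_region {V : ℝ} (hV : V ∈ Ioc 0 Vbar) : IsClosed (closedRegion (C V)) := by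
  obtain ⟨a, b, U, L, hl, hc⟩ := H.exists_loop hV
  have : closedRegion (C V) = (fun p : ℝ × ℝ => (p.1 - S.κ * p.2, p.2)) ⁻¹'
      {p | InRegion a b U L p.1 p.2} := by
    ext p; exact hl.mem_closedRegion_iff hc p
  rw [this]
  exact hl.isClosed_region.preimage (by fun_prop)

lemma isOpen_inner {V : ℝ} (hV : V ∈ Ioc 0 Vbar) : IsOpen (closedRegion (C V) \ C V) := by
  obtain ⟨a, b, U, L, hl, hc⟩ := H.exists_loop hV
  have : closedRegion (C V) \ C V = (fun p : ℝ × ℝ => (p.1 - S.κ * p.2, p.2)) ⁻¹'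
      {p | InInner a b U L p.1 p.2} := by
    ext p; exact hl.mem_inner_iff hc p
  rw [this]
  exact hl.isOpen_inner.preimage (by fun_prop)

lemma isCompact_region {V : ℝ} (hV : V ∈ Ioc 0 Vbar) : IsCompact (closedRegion (C V)) := by
  obtain ⟨a, b, U, L, hl, hc⟩ := H.exists_loop hV
  refine Metric.isCompact_of_isClosed_isBounded (H.isClosed_region hV) ?_
  refine (hl.isBounded_region S.κ).subset fun p hp => ?_
  exact (hl.mem_closedRegion_iff hc p).1 hp

/-- The curves with smaller parameter fill the closed region bounded by `C V`. -/
lemma exists_mem_of_mem_region {V : ℝ} (hV : V ∈ Ioc 0 Vbar) {p : ℝ × ℝ}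
    (hp : p ∈ closedRegion (C V)) : ∃ V' ∈ Icc 0 V, p ∈ C V' := by
  by_contra! hcon
  have hp0 : p ≠ 0 := by
    rintro rfl
    exact hcon 0 ⟨le_rfl, hV.1.le⟩ (by rw [H.zero]; rfl)
  set ψ := p.1 - S.κ * p.2 with hψ
  have hcψ : Continuous fun q : ℝ × ℝ => q.1 - S.κ * q.2 := by fun_prop
  have clψ : IsClosed {q : ℝ × ℝ | q.1 - S.κ * q.2 = ψ} := isClosed_eq hcψ continuous_const
  have A1 := H.isClosed_meets (A := {q | q.1 - S.κ * q.2 = ψ ∧ p.2 ≤ q.2})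
    (clψ.inter (isClosed_le continuous_const continuous_snd))
  have A2 := H.isClosed_meets (A := {q | q.1 - S.κ * q.2 = ψ ∧ q.2 ≤ p.2})
    (clψ.inter (isClosed_le continuous_snd continuous_const))
  -- For positive parameters, G consists of those whose closed region contains p. In this form it is
  -- visibly closed, and its least element is the parameter sought.
  set G := Icc 0 V ∩ ({V | V ∈ Icc 0 Vbar ∧ ∃ q ∈ C V, q ∈ {q | q.1 - S.κ * q.2 = ψ ∧ p.2 ≤ q.2}}
    ∩ {V | V ∈ Icc 0 Vbar ∧ ∃ q ∈ C V, q ∈ {q | q.1 - S.κ * q.2 = ψ ∧ q.2 ≤ p.2}}) with hG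
  have hGc : IsCompact G := isCompact_Icc.inter_right (A1.inter A2)
  have hVG : V ∈ G := by
    obtain ⟨h1, h2⟩ := (H.mem_closedRegion_iff_column hV p).1 hp
    exact ⟨⟨hV.1.le, le_rfl⟩, ⟨⟨hV.1.le, hV.2⟩, h1⟩, ⟨⟨hV.1.le, hV.2⟩, h2⟩⟩
  have hs := hGc.sInf_mem ⟨V, hVG⟩
  set s := sInf G
  obtain ⟨hs0, ⟨-, q₁, hq₁, e₁, l₁⟩, ⟨hsb, q₂, hq₂, e₂, l₂⟩⟩ := hs
  -- The curve of parameter 0 is the origin, which lies weakly above and below p on the column of p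
  -- only if p = 0.
  have hspos : 0 < s := by
    refine lt_of_le_of_ne hs0.1 fun e => ?_
    rw [← e, H.zero, mem_singleton_iff] at hq₁ hq₂
    rw [hq₁] at e₁ l₁
    rw [hq₂] at l₂
    simp only [Prod.snd_zero, Prod.fst_zero, mul_zero, sub_zero] at e₁ l₁ l₂
    have h2 : p.2 = 0 := le_antisymm l₁ l₂
    apply hp0
    refine Prod.ext ?_ h2
    rw [hψ, h2] at e₁
    simp only [Prod.fst_zero]; linarith
  have hsI : s ∈ Ioc 0 Vbar := ⟨hspos, hsb.2⟩
  obtain ⟨a, b, U, L, hl, hc⟩ := H.exists_loop hsI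
  have hin : InInner a b U L ψ p.2 := by
    rw [← hl.mem_inner_iff hc]
    exact ⟨(H.mem_closedRegion_iff_column hsI p).2 ⟨⟨q₁, hq₁, e₁, l₁⟩, ⟨q₂, hq₂, e₂, l₂⟩⟩,
      hcon s hs0⟩
  -- If p were strictly inside C s, it would stay inside for slightly smaller parameters: nearby
  -- curves still reach to the left and right of the column of p, and on that column they avoid the
  -- segment joining p to ω = 0.
  have ev1 := H.eventually_meets (A := {q | q.1 - S.κ * q.2 < ψ})
    (isOpen_lt hcψ continuous_const) hsb ⟨(a, 0), by
      rw [hc]; exact ⟨by simp, by simpa using hl.lt.le, by simp [hl.U_left]⟩, by simpa using hin.1⟩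
  have ev2 := H.eventually_meets (A := {q | ψ < q.1 - S.κ * q.2})
    (isOpen_lt continuous_const hcψ) hsb ⟨(b, 0), by
      rw [hc]; exact ⟨by simpa using hl.lt.le, by simp, by simp [hl.U_right]⟩,
      by simpa using hin.2.1⟩
  have ev3 := H.eventually_not_meets (A := {q | q.1 - S.κ * q.2 = ψ ∧ 0 ≤ q.2 ∧ q.2 ≤ p.2})
    (clψ.inter ((isClosed_le continuous_const continuous_snd).inter
      (isClosed_le continuous_snd continuous_const))) (V₀ := s) (by
      rintro q hq ⟨k1, k2, k3⟩
      obtain ⟨m1, m2, m3⟩ := (hc q).1 hq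
      rw [k1] at m1 m2 m3
      have := hl.L_pos ψ ⟨hin.1, hin.2.1⟩
      rcases m3 with m3 | m3
      · linarith [hin.2.2.2]
      · linarith)
  have ev4 := H.eventually_not_meets (A := {q | q.1 - S.κ * q.2 = ψ ∧ q.2 ≤ 0 ∧ p.2 ≤ q.2})
    (clψ.inter ((isClosed_le continuous_snd continuous_const).inter
      (isClosed_le continuous_const continuous_snd))) (V₀ := s) (by
      rintro q hq ⟨k1, k2, k3⟩
      obtain ⟨m1, m2, m3⟩ := (hc q).1 hq
      rw [k1] at m1 m2 m3
      have := hl.U_pos ψ ⟨hin.1, hin.2.1⟩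
      rcases m3 with m3 | m3
      · linarith
      · linarith [hin.2.2.1])
  have hle : 𝓝[<] s ≤ 𝓝[Icc 0 Vbar] s := Icc_mem_left ⟨hspos, hsb.2⟩
  have ev := (((ev1.and ev2).and (ev3.and ev4)).filter_mono hle).and (Ioo_mem_nhdsLT hspos)
  obtain ⟨V', ⟨⟨⟨q, hq, hqA⟩, ⟨q', hq', hqA'⟩⟩, h3, h4⟩, hV'⟩ := ev.exists
  have hV'I : V' ∈ Ioc 0 Vbar := ⟨hV'.1, hV'.2.le.trans hsb.2⟩
  obtain ⟨a', b', U', L', hl', hc'⟩ := H.exists_loop hV'I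
  have hψI : ψ ∈ Ioo a' b' :=
    ⟨((hc' q).1 hq).1.trans_lt hqA, lt_of_lt_of_le hqA' ((hc' q').1 hq').2.1⟩
  have hU := hl'.U_pos ψ hψI
  have hL := hl'.L_pos ψ hψI
  have onU : (ψ + S.κ * U' ψ, U' ψ) ∈ C V' := by
    rw [hc']; simp only [add_sub_cancel_right]; exact ⟨hψI.1.le, hψI.2.le, Or.inl rfl⟩
  have onL : (ψ + S.κ * (-L' ψ), -L' ψ) ∈ C V' := by
    rw [hc']; simp only [add_sub_cancel_right]; exact ⟨hψI.1.le, hψI.2.le, Or.inr rfl⟩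
  have k1 : p.2 < U' ψ := by
    by_contra! h
    exact h3 _ onU ⟨by simp, hU.le, h⟩
  have k2 : -L' ψ < p.2 := by
    by_contra! h
    exact h4 _ onL ⟨by simp, by simp [hL.le], h⟩
  have hmem : V' ∈ G := ⟨⟨hV'.1.le, hV'.2.le.trans hs0.2⟩,
    ⟨⟨hV'.1.le, hV'I.2⟩, _, onU, by simp, k1.le⟩, ⟨⟨hV'.1.le, hV'I.2⟩, _, onL, by simp, k2.le⟩⟩
  exact absurd (csInf_le hGc.bddBelow hmem) (not_le.2 hV'.2)

end CycleFamily
end InverterSystem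

/-! ### Nondegenerate points, nesting, and the function V^PLL. -/

namespace InverterSystem
namespace CycleFamily
variable {S : InverterSystem} {P : Matrix (Fin 4) (Fin 4) ℝ} {Vbar Vmax : ℝ}
  {C : ℝ → Set (ℝ × ℝ)} (H : S.CycleFamily P Vbar Vmax C)
include H

/-- If `f` does not depend on `x` near the line `ω = 0`, the comparison systems coincide there, so
their limit cycles cannot shrink to the origin. -/
lemma not_independent_of_x (hν : S.ν = 0) {ε : ℝ} (hε : 0 < ε)
    (hh : ∀ w, |w| ≤ ε → S.h w = 0) : False := by
  have hf : ∀ (p : ℝ × ℝ) (x : Fin 4 → ℝ), |p.2| ≤ ε → S.f p.1 p.2 x = S.g p.1 p.2 / S.μ := by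
    intro p x hp
    simp [InverterSystem.f, hν, hh _ hp]
  have hcomp : ∀ (V V' : ℝ) (p : ℝ × ℝ), 0 ≤ V → 0 ≤ V' → |p.2| ≤ ε →
      S.compField P V p = S.compField P V' p := by
    have himg : ∀ (V : ℝ) (p : ℝ × ℝ), 0 ≤ V → |p.2| ≤ ε →
        (fun x => S.f p.1 p.2 x) '' {x | VCC P x ≤ V} = {S.g p.1 p.2 / S.μ} := by
      intro V p hV hp
      ext y
      constructor
      · rintro ⟨x, -, rfl⟩; exact hf p x hp
      · rintro rfl; exact ⟨0, by simp [VCC_zero, hV], hf p 0 hp⟩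
    intro V V' p hV hV' hp
    simp only [compField, fStar, himg V p hV hp, himg V' p hV' hp]
  have horb : ∀ (V V' : ℝ) (D : Set (ℝ × ℝ)), 0 ≤ V → 0 ≤ V' → (∀ q ∈ D, |q.2| ≤ ε) →
      S.IsClosedOrbit P V D → S.IsClosedOrbit P V' D := by
    rintro V V' D hV hV' hD ⟨T, u, hT, hper, hinj, hu, hr⟩
    have e : (fun s => S.compField P V (u s)) = fun s => S.compField P V' (u s) :=
      funext fun s => hcomp V V' (u s) hV hV' (hD _ (hr ▸ mem_range_self s))
    refine ⟨T, u, hT, hper, hinj, fun t => ?_, hr⟩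
    rw [← e]; exact hu t
  have h0 : (0 : ℝ) ∈ Icc 0 Vbar := ⟨le_rfl, H.Vbar_pos.le⟩
  have hsmall := H.eventually_not_meets (A := {q | ε ≤ |q.2|})
    (isClosed_le continuous_const continuous_snd.abs) (V₀ := 0) (by
      rw [H.zero]; rintro q rfl; simpa using hε)
  rw [Filter.Eventually, mem_nhdsWithin_iff_exists_mem_nhds_inter] at hsmall
  obtain ⟨u, hu, hsub⟩ := hsmall
  obtain ⟨δ, hδ, hb⟩ := Metric.mem_nhds_iff.1 hu
  set η := min δ Vbar
  have hη : 0 < η := lt_min hδ H.Vbar_pos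
  have hI : ∀ V ∈ Ioo 0 η, V ∈ Ioc 0 Vbar := fun V hV =>
    ⟨hV.1, hV.2.le.trans (min_le_right _ _)⟩
  have hstrip : ∀ V ∈ Ioo 0 η, ∀ q ∈ C V, |q.2| ≤ ε := by
    intro V hV q hq
    have hVu : V ∈ u := hb (by
      rw [Metric.mem_ball, Real.dist_eq, sub_zero, abs_of_pos hV.1]
      exact hV.2.trans_le (min_le_left _ _))
    have := hsub ⟨hVu, (Ioc_subset_Icc_self (hI V hV))⟩ q hq
    simp only [mem_ofPred_eq, not_le] at this
    exact this.le
  -- All cycles in the strip are closed orbits of one and the same system, so isolation of C v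
  -- absorbs its neighbours; connectedness then makes the family constant.
  have hloc : ∀ v ∈ Ioo 0 η, ∀ᶠ V in 𝓝 v, C V = C v := by
    intro v hv
    obtain ⟨O, hO, hCO, huniq⟩ := (H.family.2.1 v (hI v hv)).2
    have h1 := H.eventually_not_meets (A := Oᶜ) hO.isClosed_compl (V₀ := v)
      (fun q hq => not_not.2 (hCO hq))
    have h2 : 𝓝 v ≤ 𝓝[Icc 0 Vbar] v := by
      refine le_inf le_rfl (le_principal_iff.2 ?_)
      filter_upwards [Ioo_mem_nhds hv.1 hv.2] with V hV using Ioc_subset_Icc_self (hI V hV)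
    filter_upwards [h2 h1, Ioo_mem_nhds hv.1 hv.2] with V hV hVI
    exact huniq _ (horb V v _ hVI.1.le hv.1.le (hstrip V hVI) (H.family.2.1 V (hI V hVI)).1)
      (fun q hq => not_not.1 (hV q hq))
  have hv₁ : η / 2 ∈ Ioo 0 η := ⟨by linarith, by linarith⟩
  have hconst : ∀ V ∈ Ioo 0 η, C V = C (η / 2) := by
    have hsub : Ioo 0 η ⊆ {V | ∀ᶠ V' in 𝓝 V, C V' = C (η / 2)} := by
      refine isPreconnected_Ioo.subset_of_closure_inter_subset isOpen_setOfPred_eventually_nhds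
        ⟨η / 2, hv₁, hloc _ hv₁⟩ ?_
      rintro v ⟨hvc, hv⟩
      obtain ⟨w, hw1, hw2⟩ := mem_closure_iff_nhds.1 hvc _ (hloc v hv)
      have hw2' : C w = C (η / 2) := hw2.self_of_nhds
      have : C v = C (η / 2) := by rw [← hw2']; exact hw1.symm
      rw [mem_ofPred_eq, ← this]; exact hloc v hv
    exact fun V hV => (hsub hV).self_of_nhds
  have hpt : ∀ q ∈ C (η / 2), q = 0 := by
    intro q hq
    have hcl := H.isClosed_meets (A := {q}) isClosed_singleton
    have : (0 : ℝ) ∈ {V | V ∈ Icc 0 Vbar ∧ ∃ q' ∈ C V, q' ∈ ({q} : Set (ℝ × ℝ))} := by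
      refine hcl.mem_of_tendsto (b := 𝓝[>] (0 : ℝ)) (f := id) nhdsWithin_le_nhds ?_
      filter_upwards [Ioo_mem_nhdsGT hη] with V hV
      exact ⟨Ioc_subset_Icc_self (hI V hV), q, by rw [id, hconst V hV]; exact hq, rfl⟩
    obtain ⟨-, q', hq', rfl⟩ := this
    rw [H.zero] at hq'; exact hq'
  obtain ⟨a, b, U, L, hl, hc⟩ := H.exists_loop (hI _ hv₁)
  have ha := hpt (a, 0) (by
    rw [hc]; exact ⟨by simp, by simpa using hl.lt.le, by simp [hl.U_left]⟩)
  have hb := hpt (b, 0) (by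
    rw [hc]; exact ⟨by simpa using hl.lt.le, by simp, by simp [hl.U_right]⟩)
  have := hl.lt
  rw [show a = 0 from congrArg Prod.fst ha, show b = 0 from congrArg Prod.fst hb] at this
  exact lt_irrefl _ this

/-- On every limit cycle of the family, `f` depends on `x` somewhere off the line `ω = 0`. -/
theorem exists_nondegenerate {V : ℝ} (hV : V ∈ Ioc 0 Vbar) :
    ∃ p ∈ C V, p.2 ≠ 0 ∧ S.Nondegenerate p := by
  by_contra! hcon
  obtain ⟨a, b, U, L, hl, hc⟩ := H.exists_loop hV
  have hdeg : ∀ p ∈ C V, p.2 ≠ 0 → S.μ • S.h p.2 = S.g p.1 p.2 • S.ν := fun p hp h0 =>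
    not_not.1 (hcon p hp h0)
  have hU : ∀ s ∈ Ioo a b, S.μ • S.h (U s) = S.g (s + S.κ * U s) (U s) • S.ν := fun s hs =>
    hdeg (s + S.κ * U s, U s) (by
      rw [hc]; simp only [add_sub_cancel_right]; exact ⟨hs.1.le, hs.2.le, Or.inl rfl⟩)
      (hl.U_pos s hs).ne'
  have hL : ∀ s ∈ Ioo a b, S.μ • S.h (-L s) = S.g (s + S.κ * (-L s)) (-L s) • S.ν := fun s hs =>
    hdeg (s + S.κ * (-L s), -L s) (by
      rw [hc]; simp only [add_sub_cancel_right]; exact ⟨hs.1.le, hs.2.le, Or.inr rfl⟩)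
      (neg_ne_zero.2 (hl.L_pos s hs).ne')
  have hcl : ∀ s ∈ Icc a b, S.μ • S.h (U s) = S.g (s + S.κ * U s) (U s) • S.ν := by
    have cU := hl.contU
    have c1 : ContinuousOn (fun s => S.μ • S.h (U s)) (Icc a b) := by
      have := S.h_smooth.continuous
      fun_prop
    have c2 : ContinuousOn (fun s => S.g (s + S.κ * U s) (U s) • S.ν) (Icc a b) := by
      have : ContinuousOn (fun s => (fun p : ℝ × ℝ => S.g p.1 p.2) (s + S.κ * U s, U s))
          (Icc a b) := S.g_smooth.continuous.comp_continuousOn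
        ((continuousOn_id.add (cU.const_mul _ |>.congr fun _ _ => rfl)).prodMk cU)
      exact this.smul continuousOn_const
    have hE : EqOn (fun s => S.μ • S.h (U s)) (fun s => S.g (s + S.κ * U s) (U s) • S.ν)
        (Icc a b) := by
      refine EqOn.of_subset_closure (s := Ioo a b) hU c1 c2 Ioo_subset_Icc_self ?_
      rw [closure_Ioo hl.lt.ne]
    exact hE
  have hA := hcl a ⟨le_rfl, hl.lt.le⟩
  have hB := hcl b ⟨hl.lt.le, le_rfl⟩
  rw [hl.U_left, mul_zero, add_zero] at hA
  rw [hl.U_right, mul_zero, add_zero] at hB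
  have h1 := (S.acc_mem H.posDef hV.1.le (H.nonsing' hV.2) (x := 0)
    (by rw [VCC_zero]; exact hV.1.le) a 0).1
  have h2 := (S.acc_mem H.posDef hV.1.le (H.nonsing' hV.2) (x := 0)
    (by rw [VCC_zero]; exact hV.1.le) b 0).2
  -- At x = 0 the acceleration is positive at the left corner and negative at the right one.
  have hlt : S.f b 0 0 ≠ S.f a 0 0 := by
    have := hl.lo_left
    have := hl.hi_right
    have := S.ki_pos
    rw [mul_zero, add_zero] at h1 h2
    intro e; rw [e] at h2; nlinarith
  have hg : S.g b 0 ≠ S.g a 0 := by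
    intro e; apply hlt; simp [InverterSystem.f, e]
  -- By continuity the degeneracy relation reaches both corners, where h is taken at the same
  -- argument 0 but g differs.
  have hν : S.ν = 0 := by
    have : (S.g b 0 - S.g a 0) • S.ν = 0 := by rw [sub_smul, ← hA, ← hB, sub_self]
    exact (smul_eq_zero.1 this).resolve_left (sub_ne_zero.2 hg)
  rw [hν] at hU hL hA
  have hz : ∀ w, S.μ • S.h w = 0 → S.h w = 0 := fun w hw =>
    (smul_eq_zero.1 hw).resolve_left S.μ_ne_zero
  set m := (a + b) / 2
  have hm : m ∈ Ioo a b := ⟨by simp only [m]; linarith [hl.lt], by simp only [m]; linarith [hl.lt]⟩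
  -- With ν = 0 the relation says h = 0 at every nonzero height attained on the cycle, and the two
  -- arcs attain all heights up to their values over the midpoint.
  refine H.not_independent_of_x hν (lt_min (hl.U_pos m hm) (hl.L_pos m hm)) fun w hw => ?_
  have hsub : Icc a m ⊆ Icc a b := Icc_subset_Icc_right hm.2.le
  rcases lt_trichotomy w 0 with hneg | rfl | hpos
  · rw [abs_of_neg hneg] at hw
    obtain ⟨s, hs, e⟩ := intermediate_value_Icc hm.1.le (hl.contL.mono hsub)
      (show -w ∈ Icc (L a) (L m) from ⟨by rw [hl.L_left]; linarith, hw.trans (min_le_right _ _)⟩)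
    have hsI : s ∈ Ioo a b := hl.mem_Ioo_of_L_ne hs.1 (hs.2.trans hm.2.le) (by rw [e]; linarith)
    have := hL s hsI
    rw [e, neg_neg, smul_zero] at this
    exact hz w this
  · exact hz 0 (by rw [hA, smul_zero])
  · rw [abs_of_pos hpos] at hw
    obtain ⟨s, hs, e⟩ := intermediate_value_Icc hm.1.le (hl.contU.mono hsub)
      (show w ∈ Icc (U a) (U m) from ⟨by rw [hl.U_left]; linarith, hw.trans (min_le_left _ _)⟩)
    have hsI : s ∈ Ioo a b := hl.mem_Ioo_of_U_ne hs.1 (hs.2.trans hm.2.le) (by rw [e]; linarith)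
    have := hU s hsI
    rw [e, smul_zero] at this
    exact hz w this

/-- A limit cycle cannot be contained in one with larger parameter. -/
lemma not_subset {V V' : ℝ} (hV' : 0 < V') (hVV : V' < V) (hV : V ≤ Vbar) : ¬ C V' ⊆ C V := by
  intro hsub
  have hVI : V ∈ Ioc 0 Vbar := ⟨hV'.trans hVV, hV⟩
  have hVI' : V' ∈ Ioc 0 Vbar := ⟨hV', hVV.le.trans hV⟩
  obtain ⟨p, hp, hp0, hnd⟩ := H.exists_nondegenerate hVI'
  obtain ⟨a, b, U, L, hl, hc⟩ := H.exists_loop hVI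
  obtain ⟨a', b', U', L', hl', hc'⟩ := H.exists_loop hVI'
  set s := p.1 - S.κ * p.2 with hs
  have hps : p = (s + S.κ * p.2, p.2) := by ext <;> simp [hs]
  rw [hps] at hnd
  -- If C V' were part of C V, the arcs would agree near the nondegenerate point and have equal
  -- slopes there, whereas the extremal accelerations for V' and V differ strictly.
  obtain ⟨⟨y, hy, hgt⟩, z, hz, hlt⟩ :=
    S.exists_acc_gt_and_lt H.posDef hV'.le hVV (H.nonsing' hV) hnd
  have hy' := (S.acc_mem H.posDef hVI.1.le (H.nonsing' hV) hy.le s p.2).2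
  have hz' := (S.acc_mem H.posDef hVI.1.le (H.nonsing' hV) hz.le s p.2).1
  have hUeq : ∀ r ∈ Ioo a' b', U' r = U r ∧ r ∈ Ioo a b := by
    intro r hr
    have hpos := hl'.U_pos r hr
    have := hsub ((hc' (r + S.κ * U' r, U' r)).2 (by
      simp only [add_sub_cancel_right]; exact ⟨hr.1.le, hr.2.le, Or.inl rfl⟩))
    rw [hc] at this
    simp only [add_sub_cancel_right] at this
    obtain ⟨h1, h2, h3⟩ := this
    have hL := hl.L_nonneg h1 h2
    have h3 : U' r = U r := h3.resolve_right (by intro e; linarith)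
    exact ⟨h3, hl.mem_Ioo_of_U_ne h1 h2 (by rw [← h3]; exact hpos.ne')⟩
  have hLeq : ∀ r ∈ Ioo a' b', L' r = L r ∧ r ∈ Ioo a b := by
    intro r hr
    have hpos := hl'.L_pos r hr
    have := hsub ((hc' (r + S.κ * (-L' r), -L' r)).2 (by
      simp only [add_sub_cancel_right]; exact ⟨hr.1.le, hr.2.le, Or.inr rfl⟩))
    rw [hc] at this
    simp only [add_sub_cancel_right] at this
    obtain ⟨h1, h2, h3⟩ := this
    have hU := hl.U_nonneg h1 h2
    have h3 : L' r = L r := by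
      have := h3.resolve_left (by intro e; linarith)
      linarith
    exact ⟨h3, hl.mem_Ioo_of_L_ne h1 h2 (by rw [← h3]; exact hpos.ne')⟩
  obtain ⟨h1, h2, h3⟩ := (hc' p).1 hp
  rw [← hs] at h1 h2 h3
  rcases h3 with h3 | h3
  · have hsI := hl'.mem_Ioo_of_U_ne h1 h2 (by rw [← h3]; exact hp0)
    obtain ⟨e1, hsI'⟩ := hUeq s hsI
    have d1 := hl'.derivU s hsI
    have d2 := hl.derivU s hsI'
    have d3 : HasDerivAt U (S.accHi P V' s (U' s) / U' s) s := d1.congr_of_eventuallyEq (by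
      filter_upwards [Ioo_mem_nhds hsI.1 hsI.2] with r hr using (hUeq r hr).1.symm)
    have := d3.unique d2
    rw [← e1, ← h3, div_left_inj' hp0] at this
    linarith
  · have hp0' : L' s ≠ 0 := by intro e; rw [e, neg_zero] at h3; exact hp0 h3
    have hsI := hl'.mem_Ioo_of_L_ne h1 h2 hp0'
    obtain ⟨e1, hsI'⟩ := hLeq s hsI
    have d1 := hl'.derivL s hsI
    have d2 := hl.derivL s hsI'
    have d3 : HasDerivAt L (S.accLo P V' s (-L' s) / L' s) s := d1.congr_of_eventuallyEq (by
      filter_upwards [Ioo_mem_nhds hsI.1 hsI.2] with r hr using (hLeq r hr).1.symm)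
    have := d3.unique d2
    rw [← e1, div_left_inj' hp0', ← h3] at this
    linarith

/-- A limit cycle which meets the closed region of one with larger parameter is contained in its
interior. -/
lemma subset_inner_of_meets {V V' : ℝ} (hV' : 0 < V') (hVV : V' < V) (hV : V ≤ Vbar) {q : ℝ × ℝ}
    (hq : q ∈ C V') (hqV : q ∈ closedRegion (C V)) : C V' ⊆ closedRegion (C V) \ C V := by
  have hVI : V ∈ Ioc 0 Vbar := ⟨hV'.trans hVV, hV⟩
  have hVI' : V' ∈ Ioc 0 Vbar := ⟨hV', hVV.le.trans hV⟩
  obtain ⟨a, b, U, L, hl, hc⟩ := H.exists_loop hVI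
  obtain ⟨T, u, hO, hr⟩ := S.extremalOrbit_of_isClosedOrbit (H.family.2.1 V' hVI').1
  have hhi := S.locLip_accHi H.posDef hVI.1.le (H.nonsing' hV)
  have hlo := S.locLip_accLo H.posDef hVI.1.le (H.nonsing' hV)
  have htraj := hO.traj (S.accLo_le_accHi H.posDef hV'.le (H.nonsing' hVI'.2))
    (S.locLip_accLo H.posDef hV'.le (H.nonsing' hVI'.2))
    (S.locLip_accHi H.posDef hV'.le (H.nonsing' hVI'.2))
    (S.accLo_anti H.posDef hV'.le hVV.le (H.nonsing' hV))
    (S.accHi_mono H.posDef hV'.le hVV.le (H.nonsing' hV))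
  have hT := hO.T_pos
  have hshift : ∀ s t : ℝ, ∃ t' ≥ t, u t' = u s := by
    intro s t
    obtain ⟨n, hn⟩ := exists_nat_gt ((t - s) / T)
    rw [div_lt_iff₀ hT] at hn
    refine ⟨s + n * T, by linarith, ?_⟩
    have e1 : (u (s + n * T)).1 - S.κ * (u (s + n * T)).2 = (u s).1 - S.κ * (u s).2 :=
      hO.perψ.nat_mul n s
    have e2 : (u (s + n * T)).2 = (u s).2 := hO.perω.nat_mul n s
    rw [e2] at e1
    exact Prod.ext (by linarith) e2
  rw [← hr] at hq
  obtain ⟨t₀, rfl⟩ := hq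
  have hreg : ∀ s, InRegion a b U L ((u s).1 - S.κ * (u s).2) (u s).2 := by
    intro s
    obtain ⟨t', ht', e⟩ := hshift s t₀
    have := (htraj t₀ t').inRegion_of_inRegion hl hhi hlo ((hl.mem_closedRegion_iff hc _).1 hqV)
      t' ⟨ht', le_rfl⟩
    rwa [e] at this
  by_cases hex : ∃ s, InInner a b U L ((u s).1 - S.κ * (u s).2) (u s).2
  · obtain ⟨s, hs⟩ := hex
    rw [← hr]
    rintro _ ⟨t, rfl⟩
    obtain ⟨t', ht', e⟩ := hshift t s
    have := (htraj s t').inInner_of_inInner hl hhi hlo hs t' ⟨ht', le_rfl⟩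
    simp only [e] at this
    exact (hl.mem_inner_iff hc _).2 this
  · push Not at hex
    refine absurd ?_ (H.not_subset hV' hVV hV)
    rw [← hr]
    rintro _ ⟨t, rfl⟩
    exact (hc _).2 ((hl.inInner_or_onLoop (hreg t)).resolve_left (hex t))

/-- The inside of C V is convex along columns, and a point of the smaller region lies between two
points of C V' on its column. -/
lemma inner_of_column {V V' : ℝ} (hV' : V' ∈ Ioc 0 Vbar) (hV : V ∈ Ioc 0 Vbar)
    (h : C V' ⊆ closedRegion (C V) \ C V) :
    closedRegion (C V') ⊆ closedRegion (C V) \ C V := by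
  intro p hp
  obtain ⟨a, b, U, L, hl, hc⟩ := H.exists_loop hV
  obtain ⟨⟨q, hq, e, l⟩, ⟨q', hq', e', l'⟩⟩ := (H.mem_closedRegion_iff_column hV' p).1 hp
  have k := (hl.mem_inner_iff hc q).1 (h hq)
  have k' := (hl.mem_inner_iff hc q').1 (h hq')
  rw [e] at k
  rw [e'] at k'
  exact (hl.mem_inner_iff hc p).2 ⟨k.1, k.2.1, k'.2.2.1.trans_le l', l.trans_lt k.2.2.2⟩

/-- The limit cycles are nested. -/
theorem nested {V V' : ℝ} (hV' : 0 < V') (hVV : V' < V) (hV : V ≤ Vbar) :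
    closedRegion (C V') ⊆ closedRegion (C V) \ C V := by
  have hVI : V ∈ Ioc 0 Vbar := ⟨hV'.trans hVV, hV⟩
  have hVI' : V' ∈ Ioc 0 Vbar := ⟨hV', hVV.le.trans hV⟩
  refine H.inner_of_column hVI' hVI ?_
  obtain ⟨a, b, U, L, hl, hc⟩ := H.exists_loop hVI
  obtain ⟨V₁, hV₁, p, hpV₁, hp⟩ : ∃ V₁ ∈ Ioo 0 V, ∃ p ∈ C V₁, p ∈ closedRegion (C V) \ C V := by
    set m := (a + b) / 2
    have hm : m ∈ Ioo a b :=
      ⟨by simp only [m]; linarith [hl.lt], by simp only [m]; linarith [hl.lt]⟩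
    have hU := hl.U_pos m hm
    have hL := hl.L_pos m hm
    -- An inner point other than the origin, so the filling property puts it on a cycle of parameter
    -- strictly between 0 and V.
    set p : ℝ × ℝ := (m + S.κ * (U m / 2), U m / 2)
    have hp : p ∈ closedRegion (C V) \ C V := by
      rw [hl.mem_inner_iff hc]
      simp only [p, add_sub_cancel_right]
      exact ⟨hm.1, hm.2, by linarith, by linarith⟩
    obtain ⟨V₁, hV₁, hpV₁⟩ := H.exists_mem_of_mem_region hVI hp.1
    refine ⟨V₁, ⟨lt_of_le_of_ne hV₁.1 ?_, lt_of_le_of_ne hV₁.2 ?_⟩, p, hpV₁, hp⟩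
    · rintro rfl
      rw [H.zero, mem_singleton_iff] at hpV₁
      have := (Prod.ext_iff.1 hpV₁).2
      simp only [p, Prod.snd_zero] at this
      linarith
    · rintro rfl
      exact hp.2 hpV₁
  obtain ⟨-, -, Γ, hΓ, -, hper, -⟩ := H.family
  have hmem : ∀ v ∈ Ioo 0 V, Γ (v, 0) ∈ C v := fun v hv =>
    (mem_iff_image hper ⟨hv.1.le, hv.2.le.trans hV⟩ _).2 ⟨0, ⟨le_rfl, zero_le_one⟩, rfl⟩
  have hcont : ContinuousOn (fun v => Γ (v, 0)) (Ioo 0 V) :=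
    hΓ.comp (by fun_prop) (fun v hv => ⟨⟨hv.1.le, hv.2.le.trans hV⟩, mem_univ _⟩)
  -- One point of each smaller cycle is followed as v varies. It never lies on C V, so by
  -- connectedness it stays inside once it is inside for V₁.
  have hsub : (fun v => Γ (v, 0)) '' Ioo 0 V ⊆ closedRegion (C V) \ C V := by
    refine (isPreconnected_Ioo.image _ hcont).subset_left_of_subset_union (H.isOpen_inner hVI)
      (H.isClosed_region hVI).isOpen_compl ?_ ?_ ?_
    · rw [Set.disjoint_left]; exact fun q h1 h2 => h2 h1.1
    · rintro _ ⟨v, hv, rfl⟩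
      by_cases h1 : Γ (v, 0) ∈ closedRegion (C V)
      · exact Or.inl (H.subset_inner_of_meets hv.1 hv.2 hV (hmem v hv) h1 (hmem v hv))
      · exact Or.inr h1
    · exact ⟨_, ⟨V₁, hV₁, rfl⟩, H.subset_inner_of_meets hV₁.1 hV₁.2 hV hpV₁ hp.1 (hmem V₁ hV₁)⟩
  have hv : V' ∈ Ioo 0 V := ⟨hV', hVV⟩
  exact H.subset_inner_of_meets hV' hVV hV (hmem V' hv) (hsub ⟨V', hv, rfl⟩).1

/-- The origin is a limit of points of cycles of small parameter, hence in the closed set Λ(V/2),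
which is nested in the inside of C V. -/
lemma zero_mem_inner {V : ℝ} (hV : V ∈ Ioc 0 Vbar) : (0 : ℝ × ℝ) ∈ closedRegion (C V) \ C V := by
  have h2 : V / 2 ∈ Ioc 0 Vbar := ⟨by linarith [hV.1], by linarith [hV.1, hV.2]⟩
  refine H.nested h2.1 (by linarith [hV.1]) hV.2 ?_
  obtain ⟨-, -, Γ, hΓ, -, hper, -⟩ := H.family
  have h00 : (0 : ℝ) ∈ Icc 0 Vbar := ⟨le_rfl, H.Vbar_pos.le⟩
  have h0 : Γ (0, 0) = 0 := by
    have := (mem_iff_image hper h00 (Γ (0, 0))).2 ⟨0, ⟨le_rfl, zero_le_one⟩, rfl⟩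
    rwa [H.zero] at this
  have hcont : ContinuousOn (fun v => Γ (v, 0)) (Icc 0 Vbar) :=
    hΓ.comp (by fun_prop) (fun v hv => ⟨hv, mem_univ _⟩)
  have htend : Tendsto (fun v => Γ (v, 0)) (𝓝[>] 0) (𝓝 0) := by
    have := (hcont 0 h00).mono_left (Icc_mem_right ⟨le_rfl, H.Vbar_pos⟩)
    simpa only [h0] using this
  refine (H.isClosed_region h2).mem_of_tendsto htend ?_
  filter_upwards [Ioo_mem_nhdsGT h2.1] with v hv
  refine (H.nested hv.1 hv.2 h2.2 (Or.inl ?_)).1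
  exact (mem_iff_image hper ⟨hv.1.le, hv.2.le.trans h2.2⟩ _).2 ⟨0, ⟨le_rfl, zero_le_one⟩, rfl⟩

lemma subset_inner {V V' : ℝ} (hV' : 0 ≤ V') (hVV : V' < V) (hV : V ≤ Vbar) :
    C V' ⊆ closedRegion (C V) \ C V := by
  rcases hV'.eq_or_lt with rfl | h
  · rw [H.zero, singleton_subset_iff]; exact H.zero_mem_inner ⟨hVV, hV⟩
  · exact fun p hp => H.nested h hVV hV (Or.inl hp)

lemma eq_of_mem {V V' : ℝ} (hV : V ∈ Icc 0 Vbar) (hV' : V' ∈ Icc 0 Vbar) {p : ℝ × ℝ}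
    (hp : p ∈ C V) (hp' : p ∈ C V') : V = V' := by
  rcases lt_trichotomy V V' with h | h | h
  · exact absurd hp' (H.subset_inner hV.1 h hV'.2 hp).2
  · exact h
  · exact absurd hp (H.subset_inner hV'.1 h hV.2 hp').2

lemma VPLL_eq {V : ℝ} (hV : V ∈ Icc 0 Vbar) {p : ℝ × ℝ} (hp : p ∈ C V) : VPLL Vbar C p = V := by
  have : {V | V ∈ Icc 0 Vbar ∧ p ∈ C V} = {V} := by
    ext V'
    exact ⟨fun h => H.eq_of_mem h.1 hV h.2 hp, fun h => by rw [mem_singleton_iff.1 h]; exact ⟨hV, hp⟩⟩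
  rw [VPLL, this, csInf_singleton]

lemma VPLL_spec {p : ℝ × ℝ} (hp : p ∈ closedRegion (C Vbar)) :
    VPLL Vbar C p ∈ Icc 0 Vbar ∧ p ∈ C (VPLL Vbar C p) := by
  obtain ⟨V, hV, hpV⟩ := H.exists_mem_of_mem_region ⟨H.Vbar_pos, le_rfl⟩ hp
  rw [H.VPLL_eq hV hpV]
  exact ⟨hV, hpV⟩

lemma VPLL_lt_iff {V : ℝ} (hV : V ∈ Ioc 0 Vbar) {p : ℝ × ℝ} (hp : p ∈ closedRegion (C Vbar)) :
    VPLL Vbar C p < V ↔ p ∈ closedRegion (C V) \ C V := by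
  obtain ⟨h1, h2⟩ := H.VPLL_spec hp
  constructor
  · exact fun h => H.subset_inner h1.1 h hV.2 h2
  · intro h
    obtain ⟨V', hV', hpV'⟩ := H.exists_mem_of_mem_region hV h.1
    rw [H.VPLL_eq ⟨hV'.1, hV'.2.trans hV.2⟩ hpV']
    exact lt_of_le_of_ne hV'.2 (fun e => h.2 (e ▸ hpV'))

lemma VPLL_le_iff {V : ℝ} (hV : V ∈ Ioc 0 Vbar) {p : ℝ × ℝ} (hp : p ∈ closedRegion (C Vbar)) :
    VPLL Vbar C p ≤ V ↔ p ∈ closedRegion (C V) := by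
  constructor
  · intro h
    rcases h.eq_or_lt with h | h
    · rw [← h]; exact Or.inl (H.VPLL_spec hp).2
    · exact ((H.VPLL_lt_iff hV hp).1 h).1
  · intro h
    by_cases hc : p ∈ C V
    · exact (H.VPLL_eq (Ioc_subset_Icc_self hV) hc).le
    · exact ((H.VPLL_lt_iff hV hp).2 ⟨h, hc⟩).le

lemma region_mono {V V' : ℝ} (hV : 0 < V) (hVV : V ≤ V') (hV' : V' ≤ Vbar) :
    closedRegion (C V) ⊆ closedRegion (C V') := by
  rcases hVV.eq_or_lt with rfl | h
  · rfl
  · exact fun p hp => (H.nested hV h hV' hp).1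

/-- Lower and upper semicontinuity are the closedness of the regions Λ(V) and the openness of their
interiors, via `VPLL_le_iff` and `VPLL_lt_iff`. -/
lemma continuousOn_VPLL : ContinuousOn (VPLL Vbar C) (closedRegion (C Vbar)) := by
  intro p hp
  have hm := (H.VPLL_spec hp).1
  refine tendsto_order.2 ⟨fun c hc => ?_, fun c hc => ?_⟩
  · rcases lt_or_ge c 0 with h | h
    · filter_upwards [self_mem_nhdsWithin] with q hq using h.trans_le (H.VPLL_spec hq).1.1
    · obtain ⟨d, hd1, hd2⟩ := exists_between hc
      have hd : d ∈ Ioc 0 Vbar := ⟨h.trans_lt hd1, hd2.le.trans hm.2⟩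
      have hp' : p ∉ closedRegion (C d) := fun h' =>
        absurd ((H.VPLL_le_iff hd hp).2 h') (not_le.2 hd2)
      filter_upwards [self_mem_nhdsWithin,
        nhdsWithin_le_nhds ((H.isClosed_region hd).isOpen_compl.mem_nhds hp')] with q hq hq'
      by_contra! hle
      exact hq' ((H.VPLL_le_iff hd hq).1 (hle.trans hd1.le))
  · rcases lt_or_ge Vbar c with h | h
    · filter_upwards [self_mem_nhdsWithin] with q hq using (H.VPLL_spec hq).1.2.trans_lt h
    · have hd : c ∈ Ioc 0 Vbar := ⟨hm.1.trans_lt hc, h⟩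
      filter_upwards [self_mem_nhdsWithin,
        nhdsWithin_le_nhds ((H.isOpen_inner hd).mem_nhds ((H.VPLL_lt_iff hd hp).1 hc))] with q hq hq'
      exact (H.VPLL_lt_iff hd hq).2 hq'

end CycleFamily
end InverterSystem

/-! ### Global flows of cut-off vector fields. -/

section ODE
variable {E : Type*} [NormedAddCommGroup E] [NormedSpace ℝ E]

/-- A bounded Lipschitz vector field has global integral curves. -/
theorem exists_global_integralCurve [CompleteSpace E] {G : E → E} {K : NNReal}
    (hG : LipschitzWith K G) {M : ℝ} (hM : ∀ z, ‖G z‖ ≤ M) (z₀ : E) :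
    ∃ ζ : ℝ → E, ζ 0 = z₀ ∧ ∀ t, HasDerivAt ζ (G (ζ t)) t := by
  have hM0 : 0 ≤ M := (norm_nonneg _).trans (hM z₀)
  lift M to NNReal using hM0
  have hloc : ∀ n : ℕ, ∃ α : ℝ → E, α 0 = z₀ ∧
      ∀ t ∈ Icc (-(n + 1 : ℝ)) (n + 1), HasDerivWithinAt α (G (α t)) (Icc (-(n + 1 : ℝ)) (n + 1)) t := by
    intro n
    have h0 : (0 : ℝ) ∈ Icc (-(n + 1 : ℝ)) (n + 1) := by
      constructor <;> [skip; skip] <;> [(have : (0 : ℝ) ≤ n := n.cast_nonneg; linarith); positivity]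
    have hPL : IsPicardLindelof (fun _ : ℝ => G) (tmin := -(n + 1 : ℝ)) (tmax := n + 1) ⟨0, h0⟩ z₀
        (M * (n + 1)) 0 M K :=
      { lipschitzOnWith := fun _ _ => hG.lipschitzOnWith
        continuousOn := fun _ _ => continuousOn_const
        norm_le := fun _ _ z _ => hM z
        mul_max_le := by simp }
    exact hPL.exists_eq_forall_mem_Icc_hasDerivWithinAt₀
  choose α hα0 hα using hloc
  have hα' : ∀ n : ℕ, ∀ t ∈ Ioo (-(n + 1 : ℝ)) (n + 1), HasDerivAt (α n) (G (α n t)) t :=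
    fun n t ht => (hα n t (Ioo_subset_Icc_self ht)).hasDerivAt (Icc_mem_nhds ht.1 ht.2)
  have huniq : ∀ n m : ℕ, n ≤ m → EqOn (α n) (α m) (Ioo (-(n + 1 : ℝ)) (n + 1)) := by
    intro n m hnm
    have hnm' : (n : ℝ) ≤ m := by exact_mod_cast hnm
    have hn : (0 : ℝ) ≤ n := n.cast_nonneg
    refine ODE_solution_unique_of_mem_Ioo (v := fun _ => G) (s := fun _ => univ) (K := K) (t₀ := 0)
      (fun _ _ => hG.lipschitzOnWith) ⟨by linarith, by linarith⟩
      (fun t ht => ⟨hα' n t ht, mem_univ _⟩)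
      (fun t ht => ⟨hα' m t ⟨by linarith [ht.1], by linarith [ht.2]⟩, mem_univ _⟩) ?_
    rw [hα0, hα0]
  have key : ∀ n : ℕ, ∀ t ∈ Ioo (-(n + 1 : ℝ)) (n + 1), α ⌈|t|⌉₊ t = α n t := by
    intro n t ht
    have h1 : |t| < n + 1 := abs_lt.2 ht
    have h2 : |t| ≤ ⌈|t|⌉₊ := Nat.le_ceil _
    rcases le_total n ⌈|t|⌉₊ with h | h
    · exact (huniq n _ h ht).symm
    · exact huniq _ n h (abs_lt.1 (by linarith))
  refine ⟨fun t => α ⌈|t|⌉₊ t, by simp [hα0], fun t => ?_⟩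
  have h2 : |t| ≤ ⌈|t|⌉₊ := Nat.le_ceil _
  have ht : t ∈ Ioo (-((⌈|t|⌉₊ : ℝ) + 1)) (⌈|t|⌉₊ + 1) := abs_lt.1 (by linarith)
  refine (hα' ⌈|t|⌉₊ t ht).congr_of_eventuallyEq ?_
  filter_upwards [Ioo_mem_nhds ht.1 ht.2] with s hs using key _ s hs

/-- A `C¹` vector field on an open set agrees near a given compact subset with a bounded Lipschitz
vector field on the whole space. -/
theorem exists_lipschitz_cutoff [FiniteDimensional ℝ E] {N K : Set E} (hN : IsOpen N)
    (hK : IsCompact K) (hKN : K ⊆ N) {F : E → E} (hF : ContDiffOn ℝ 1 F N) :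
    ∃ (G : E → E) (C : NNReal) (M : ℝ), LipschitzWith C G ∧ (∀ z, ‖G z‖ ≤ M) ∧
      ∀ z ∈ K, G =ᶠ[𝓝 z] F := by
  obtain ⟨K', hK', hKK', hK'N⟩ := exists_compact_between hK hN hKN
  obtain ⟨f, hf0, hf1, -⟩ := exists_contMDiffMap_zero_one_nhds_of_isClosed (modelWithCornersSelf ℝ E)
    (n := 1) isOpen_interior.isClosed_compl hK.isClosed
    (by rw [Set.disjoint_left]; exact fun x hx hx' => hx (hKK' hx'))
  have hfc : ContDiff ℝ 1 f := f.contMDiff.contDiff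
  set G : E → E := fun z => f z • F z
  have hG : ContDiff ℝ 1 G := by
    rw [contDiff_iff_contDiffAt]
    intro z
    by_cases hz : z ∈ interior K'
    · have hzN := hK'N (interior_subset hz)
      exact hfc.contDiffAt.smul (hF.contDiffAt (hN.mem_nhds hzN))
    · have h0 : ∀ᶠ x in 𝓝 z, f x = 0 := (eventually_nhdsSet_iff_forall.1 hf0) z hz
      have : G =ᶠ[𝓝 z] fun _ => 0 := by
        filter_upwards [h0] with x hx
        simp [G, hx]
      exact contDiffAt_const.congr_of_eventuallyEq this
  have hGs : HasCompactSupport G := by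
    refine HasCompactSupport.intro hK' fun x hx => ?_
    have h0 : f x = 0 :=
      ((eventually_nhdsSet_iff_forall.1 hf0) x (fun h => hx (interior_subset h))).self_of_nhds
    simp [G, h0]
  obtain ⟨C, hC⟩ := hG.lipschitzWith_of_hasCompactSupport hGs one_ne_zero
  obtain ⟨M, hM⟩ := hGs.exists_bound_of_continuous hG.continuous
  refine ⟨G, C, M, hC, hM, fun z hz => ?_⟩
  filter_upwards [(eventually_nhdsSet_iff_forall.1 hf1) z hz] with x hx
  simp [G, hx]

end ODE

/-! ### Solutions of the whole system as admissible trajectories. -/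

lemma eventually_pos_right {ω : ℝ → ℝ} {α t₀ t₁ t : ℝ} (h : HasDerivWithinAt ω α (Icc t₀ t₁) t)
    (ht : t ∈ Ico t₀ t₁) (h0 : ω t = 0) (hα : 0 < α) : ∀ᶠ s in 𝓝[>] t, 0 < ω s := by
  have h1 : HasDerivWithinAt ω α (Ioi t) t := h.mono_of_mem_nhdsWithin (Icc_mem_right ht
    self_mem_nhdsWithin)
  rw [hasDerivWithinAt_iff_tendsto_slope' (by simp)] at h1
  filter_upwards [h1.eventually_const_lt hα, self_mem_nhdsWithin] with s hs hts
  rw [slope_def_field, h0, sub_zero] at hs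
  have h2 : 0 < s - t := sub_pos.2 hts
  exact (div_pos_iff_of_pos_right h2).1 hs

lemma eventually_neg_left {ω : ℝ → ℝ} {α t₀ t₁ t : ℝ} (h : HasDerivWithinAt ω α (Icc t₀ t₁) t)
    (ht : t ∈ Ioc t₀ t₁) (h0 : ω t = 0) (hα : 0 < α) : ∀ᶠ s in 𝓝[<] t, ω s < 0 := by
  have h1 : HasDerivWithinAt ω α (Iio t) t := h.mono_of_mem_nhdsWithin (Icc_mem_left ht
    self_mem_nhdsWithin)
  rw [hasDerivWithinAt_iff_tendsto_slope' (by simp)] at h1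
  filter_upwards [h1.eventually_const_lt hα, self_mem_nhdsWithin] with s hs hts
  rw [slope_def_field, h0, sub_zero] at hs
  have h2 : s - t < 0 := sub_neg.2 hts
  by_contra! h3
  exact absurd hs (not_lt.2 (div_nonpos_of_nonneg_of_nonpos h3 h2.le))

namespace InverterSystem
variable {S : InverterSystem} {P : Matrix (Fin 4) (Fin 4) ℝ} {γ : ℝ}

lemma isOpen_nonsingular : IsOpen {z : State | S.Nonsingular z.2.2} := by
  have : Continuous fun z : State => S.ν ⬝ᵥ z.2.2 := by fun_prop
  exact isOpen_ne_fun this continuous_const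

lemma contDiffOn_field : ContDiffOn ℝ 1 S.field {z : State | S.Nonsingular z.2.2} := by
  have cx : ∀ i, ContDiff ℝ 1 fun z : State => z.2.2 i := fun i =>
    (contDiff_apply ℝ ℝ i).comp (contDiff_snd.comp contDiff_snd)
  have cω : ContDiff ℝ 1 fun z : State => z.2.1 := contDiff_fst.comp contDiff_snd
  have cg : ContDiff ℝ 1 fun z : State => S.g z.1 z.2.1 :=
    S.g_smooth.comp (contDiff_fst.prodMk cω)
  have ch : ∀ i, ContDiff ℝ 1 fun z : State => S.h z.2.1 i := fun i =>
    ((contDiff_apply ℝ ℝ i).comp S.h_smooth).comp cω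
  have cn : ContDiff ℝ 1 fun z : State => S.g z.1 z.2.1 - S.h z.2.1 ⬝ᵥ z.2.2 := by
    simp only [dotProduct]
    exact cg.sub (ContDiff.sum fun i _ => (ch i).mul (cx i))
  have cd : ContDiff ℝ 1 fun z : State => S.μ - S.ν ⬝ᵥ z.2.2 := by
    simp only [dotProduct]
    exact contDiff_const.sub (ContDiff.sum fun i _ => contDiff_const.mul (cx i))
  have cf : ContDiffOn ℝ 1 (fun z : State => S.f z.1 z.2.1 z.2.2)
      {z : State | S.Nonsingular z.2.2} :=
    cn.contDiffOn.div cd.contDiffOn fun z hz => S.denominator_ne_zero hz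
  have cA : ContDiff ℝ 1 fun z : State => S.A *ᵥ z.2.2 := by
    rw [contDiff_pi]
    intro i
    simp only [mulVec, dotProduct]
    exact ContDiff.sum fun j _ => contDiff_const.mul (cx j)
  exact ((contDiffOn_const.mul cf).add cω.contDiffOn).prodMk
    ((contDiffOn_const.mul cf).prodMk cA.contDiffOn)

/-- The derivative of `VCC` along `x' = A x`. -/
def VCCdot (S : InverterSystem) (P : Matrix (Fin 4) (Fin 4) ℝ) (x : Fin 4 → ℝ) : ℝ :=
  (S.A *ᵥ x) ⬝ᵥ (P *ᵥ x) + x ⬝ᵥ (P *ᵥ (S.A *ᵥ x))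

/-- Strictness away from 0 is what later makes Φ(V^CC) a strict barrier. -/
lemma IsCCLyapunov.VCCdot_lt (hP : S.IsCCLyapunov P γ) {x : Fin 4 → ℝ} (hx : x ≠ 0) :
    S.VCCdot P x < -γ * VCC P x := by
  have h := hP.2.2.dotProduct_mulVec_pos hx
  simp only [star_trivial, neg_mulVec, add_mulVec, smul_mulVec, dotProduct_neg, dotProduct_add,
    dotProduct_smul, smul_eq_mul] at h
  have e1 : x ⬝ᵥ ((S.Aᵀ * P) *ᵥ x) = (S.A *ᵥ x) ⬝ᵥ (P *ᵥ x) := by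
    rw [← mulVec_mulVec, dotProduct_mulVec, vecMul_transpose]
  have e2 : x ⬝ᵥ ((P * S.A) *ᵥ x) = x ⬝ᵥ (P *ᵥ (S.A *ᵥ x)) := by rw [mulVec_mulVec]
  rw [e1, e2] at h
  simp only [VCCdot, VCC]
  linarith

lemma IsCCLyapunov.VCCdot_le (hP : S.IsCCLyapunov P γ) (x : Fin 4 → ℝ) :
    S.VCCdot P x ≤ -γ * VCC P x := by
  by_cases hx : x = 0
  · simp [hx, VCCdot, VCC]
  · exact (hP.VCCdot_lt hx).le

lemma hasDerivWithinAt_dotProduct {u v : ℝ → Fin 4 → ℝ} {u' v' : Fin 4 → ℝ} {I : Set ℝ} {t : ℝ}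
    (hu : HasDerivWithinAt u u' I t) (hv : HasDerivWithinAt v v' I t) :
    HasDerivWithinAt (fun t => u t ⬝ᵥ v t) (u' ⬝ᵥ v t + u t ⬝ᵥ v') I t := by
  simp only [dotProduct, ← Finset.sum_add_distrib]
  exact HasDerivWithinAt.fun_sum fun i _ =>
    ((hasDerivWithinAt_pi.1 hu) i).mul ((hasDerivWithinAt_pi.1 hv) i)

namespace IsSolutionOn
variable {z : ℝ → State} {I : Set ℝ} (hz : S.IsSolutionOn z I)
include hz

lemma mono {J : Set ℝ} (h : J ⊆ I) : S.IsSolutionOn z J :=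
  fun t ht => ⟨(hz t (h ht)).1, (hz t (h ht)).2.mono h⟩

lemma continuousOn : ContinuousOn z I := fun t ht => (hz t ht).2.continuousWithinAt

lemma continuousOn_plane : ContinuousOn (fun t => ((z t).1, (z t).2.1)) I :=
  (by fun_prop : Continuous fun z : State => (z.1, z.2.1)).comp_continuousOn hz.continuousOn

lemma continuousOn_VCC : ContinuousOn (fun t => VCC P (z t).2.2) I :=
  continuous_VCC.comp_continuousOn
    ((by fun_prop : Continuous fun z : State => z.2.2).comp_continuousOn hz.continuousOn)

lemma hasDerivWithinAt_ω {t : ℝ} (ht : t ∈ I) :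
    HasDerivWithinAt (fun t => (z t).2.1) (-S.ki * S.f (z t).1 (z t).2.1 (z t).2.2) I t :=
  ((ContinuousLinearMap.fst ℝ ℝ (Fin 4 → ℝ)).comp
    (ContinuousLinearMap.snd ℝ ℝ (ℝ × (Fin 4 → ℝ)))).hasFDerivAt.comp_hasDerivWithinAt t (hz t ht).2

lemma hasDerivWithinAt_x {t : ℝ} (ht : t ∈ I) :
    HasDerivWithinAt (fun t => (z t).2.2) (S.A *ᵥ (z t).2.2) I t :=
  ((ContinuousLinearMap.snd ℝ ℝ (Fin 4 → ℝ)).comp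
    (ContinuousLinearMap.snd ℝ ℝ (ℝ × (Fin 4 → ℝ)))).hasFDerivAt.comp_hasDerivWithinAt t (hz t ht).2

lemma hasDerivWithinAt_ψ {t : ℝ} (ht : t ∈ I) :
    HasDerivWithinAt (fun t => (z t).1 - S.κ * (z t).2.1) (z t).2.1 I t := by
  have h1 : HasDerivWithinAt (fun t => (z t).1)
      (-S.kp * S.f (z t).1 (z t).2.1 (z t).2.2 + (z t).2.1) I t :=
    (ContinuousLinearMap.fst ℝ ℝ (ℝ × (Fin 4 → ℝ))).hasFDerivAt.comp_hasDerivWithinAt t (hz t ht).2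
  refine (h1.sub ((hz.hasDerivWithinAt_ω ht).const_mul S.κ)).congr_deriv ?_
  have hκ : S.κ * S.ki = S.kp := div_mul_cancel₀ _ S.ki_pos.ne'
  rw [← hκ]; ring

lemma hasDerivWithinAt_VCC {t : ℝ} (ht : t ∈ I) :
    HasDerivWithinAt (fun t => VCC P (z t).2.2) (S.VCCdot P (z t).2.2) I t := by
  have hx := hz.hasDerivWithinAt_x ht
  have hPx : HasDerivWithinAt (fun t => P *ᵥ (z t).2.2) (P *ᵥ (S.A *ᵥ (z t).2.2)) I t :=
    (LinearMap.toContinuousLinearMap (Matrix.mulVecLin P)).hasFDerivAt.comp_hasDerivWithinAt t hx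
  exact hasDerivWithinAt_dotProduct hx hPx

end IsSolutionOn

/-- The planar part of a solution is a trajectory of the comparison inclusion. -/
theorem IsSolutionOn.traj (hP : P.PosDef) {V : ℝ} (hV : 0 ≤ V)
    (hns : ∀ x, VCC P x ≤ V → S.Nonsingular x) {z : ℝ → State} {t₀ t₁ : ℝ}
    (hz : S.IsSolutionOn z (Icc t₀ t₁)) (hVz : ∀ t ∈ Icc t₀ t₁, VCC P (z t).2.2 ≤ V) :
    Traj (S.accLo P V) (S.accHi P V) (fun t => (z t).1 - S.κ * (z t).2.1) (fun t => (z t).2.1)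
      t₀ t₁ := by
  have hacc : ∀ t ∈ Icc t₀ t₁,
      S.accLo P V ((z t).1 - S.κ * (z t).2.1) (z t).2.1
        ≤ -S.ki * S.f (z t).1 (z t).2.1 (z t).2.2 ∧
      -S.ki * S.f (z t).1 (z t).2.1 (z t).2.2
        ≤ S.accHi P V ((z t).1 - S.κ * (z t).2.1) (z t).2.1 := by
    intro t ht
    have := S.acc_mem hP hV hns (hVz t ht) ((z t).1 - S.κ * (z t).2.1) (z t).2.1
    rwa [sub_add_cancel] at this
  refine ⟨fun t ht => (hz.hasDerivWithinAt_ψ ht).continuousWithinAt,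
    fun t ht => (hz.hasDerivWithinAt_ω ht).continuousWithinAt, fun t ht => ?_, fun t ht _ => ?_,
    fun t ht h0 h => ?_, fun t ht h0 h => ?_, fun t ht h0 h => ?_, fun t ht h0 h => ?_⟩
  · exact (hz.hasDerivWithinAt_ψ (Ioo_subset_Icc_self ht)).hasDerivAt (Icc_mem_nhds ht.1 ht.2)
  · have hI := Ioo_subset_Icc_self ht
    exact ⟨_, (hacc t hI).1, (hacc t hI).2,
      (hz.hasDerivWithinAt_ω hI).hasDerivAt (Icc_mem_nhds ht.1 ht.2)⟩
  · have hI := Ico_subset_Icc_self ht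
    have h1 := (hacc t hI).1
    simp only [h0] at h1 h
    exact eventually_pos_right (hz.hasDerivWithinAt_ω hI) ht h0 (by simp only [h0]; exact h.trans_le h1)
  · have hI := Ioc_subset_Icc_self ht
    have h1 := (hacc t hI).1
    simp only [h0] at h1 h
    exact eventually_neg_left (hz.hasDerivWithinAt_ω hI) ht h0 (by simp only [h0]; exact h.trans_le h1)
  · have hI := Ico_subset_Icc_self ht
    have h1 := (hacc t hI).2
    simp only [h0] at h1 h
    have := eventually_pos_right (hz.hasDerivWithinAt_ω hI).neg ht (by simpa using h0)
      (by simp only [h0]; linarith)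
    filter_upwards [this] with s hs using neg_pos.1 hs
  · have hI := Ioc_subset_Icc_self ht
    have h1 := (hacc t hI).2
    simp only [h0] at h1 h
    have := eventually_neg_left (hz.hasDerivWithinAt_ω hI).neg ht (by simpa using h0)
      (by simp only [h0]; linarith)
    filter_upwards [this] with s hs using neg_lt_zero.1 hs

/-- `VCC` decays exponentially along solutions. -/
theorem IsSolutionOn.VCC_le (hP : S.IsCCLyapunov P γ) {z : ℝ → State} {t₀ t₁ : ℝ}
    (hz : S.IsSolutionOn z (Icc t₀ t₁)) {t : ℝ} (ht : t ∈ Icc t₀ t₁) :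
    VCC P (z t).2.2 ≤ Real.exp (-γ * (t - t₀)) * VCC P (z t₀).2.2 := by
  have hanti : AntitoneOn (fun t => Real.exp (γ * (t - t₀)) * VCC P (z t).2.2) (Icc t₀ t₁) := by
    have hder : ∀ r ∈ Icc t₀ t₁, HasDerivWithinAt (fun t => Real.exp (γ * (t - t₀)) * VCC P (z t).2.2)
        (Real.exp (γ * (r - t₀)) * (γ * 1) * VCC P (z r).2.2
          + Real.exp (γ * (r - t₀)) * S.VCCdot P (z r).2.2) (Icc t₀ t₁) r := fun r hr =>
      (((hasDerivAt_id r).sub_const t₀).const_mul γ).exp.hasDerivWithinAt.mul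
        (hz.hasDerivWithinAt_VCC hr)
    refine antitoneOn_of_hasDerivWithinAt_nonpos (convex_Icc _ _)
      (fun r hr => (hder r hr).continuousWithinAt)
      (fun r hr => (hder r (interior_subset hr)).mono interior_subset) ?_
    intro r hr
    have h1 := hP.VCCdot_le (z r).2.2
    have h2 := Real.exp_pos (γ * (r - t₀))
    nlinarith
  have h1 := hanti ⟨le_rfl, ht.1.trans ht.2⟩ ht ht.1
  simp only [sub_self, mul_zero, Real.exp_zero, one_mul] at h1
  have h2 : Real.exp (-γ * (t - t₀)) * Real.exp (γ * (t - t₀)) = 1 := by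
    rw [← Real.exp_add]; ring_nf; exact Real.exp_zero
  calc VCC P (z t).2.2 = Real.exp (-γ * (t - t₀)) *
        (Real.exp (γ * (t - t₀)) * VCC P (z t).2.2) := by rw [← mul_assoc, h2, one_mul]
    _ ≤ _ := by gcongr

theorem IsSolutionOn.VCC_antitone (hP : S.IsCCLyapunov P γ) {z : ℝ → State} {t₀ t₁ : ℝ}
    (hz : S.IsSolutionOn z (Icc t₀ t₁)) {t : ℝ} (ht : t ∈ Icc t₀ t₁) :
    VCC P (z t).2.2 ≤ VCC P (z t₀).2.2 := by
  refine (hz.VCC_le hP ht).trans ?_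
  have h1 : Real.exp (-γ * (t - t₀)) ≤ 1 := by
    rw [Real.exp_le_one_iff]
    have := mul_nonneg hP.2.1.le (sub_nonneg.2 ht.1)
    linarith
  nlinarith [VCC_nonneg hP.1 (z t₀).2.2]

end InverterSystem

/-! ### Positivity of the growth bound. -/

namespace InverterSystem
variable {S : InverterSystem} {P : Matrix (Fin 4) (Fin 4) ℝ}

/-- The time interval is two-sided because growth rates are tested on the past of a crossing. -/
lemma exists_local_solution {z₀ : State} (h0 : S.Nonsingular z₀.2.2) :
    ∃ z : ℝ → State, z 0 = z₀ ∧ ∃ δ > (0 : ℝ), S.IsSolutionOn z (Icc (-δ) δ) := by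
  obtain ⟨G, K, M, hG, hM, hGF⟩ := exists_lipschitz_cutoff (K := {z₀}) isOpen_nonsingular
    isCompact_singleton (singleton_subset_iff.2 h0) S.contDiffOn_field
  obtain ⟨ζ, hζ0, hζ⟩ := exists_global_integralCurve hG hM z₀
  refine ⟨ζ, hζ0, ?_⟩
  have h1 : ∀ᶠ z in 𝓝 (ζ 0), G z = S.field z ∧ S.Nonsingular z.2.2 := by
    rw [hζ0]
    exact (hGF z₀ rfl).and (isOpen_nonsingular.mem_nhds h0)
  obtain ⟨δ, hδ, h2⟩ := Metric.eventually_nhds_iff.1 ((hζ 0).continuousAt.eventually h1)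
  refine ⟨δ / 2, by positivity, fun t ht => ?_⟩
  have h3 := h2 (y := t) (by
    rw [Real.dist_eq, sub_zero]
    exact (abs_le.2 ht).trans_lt (by linarith))
  exact ⟨h3.2, h3.1 ▸ (hζ t).hasDerivWithinAt⟩

namespace CycleFamily
variable {Vbar Vmax : ℝ} {C : ℝ → Set (ℝ × ℝ)} (H : S.CycleFamily P Vbar Vmax C)
include H

/-- The distance of `C V` to `C W` is at most proportional to `W - V`. -/
lemma exists_dist_le {W : ℝ} (hW : W ∈ Ioc 0 Vbar) :
    ∃ K, 0 ≤ K ∧ ∀ V ∈ Icc (W / 2) W, ∀ p ∈ C V, ∃ q ∈ C W, dist p q ≤ K * (W - V) := by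
  obtain ⟨-, -, Γ, -, hΓ, hper, -⟩ := H.family
  have hI : ∀ V ∈ Icc (W / 2) W, V ∈ Ioc 0 Vbar := fun V hV =>
    ⟨by linarith [hW.1, hV.1], hV.2.trans hW.2⟩
  obtain ⟨K, hK⟩ := (hΓ.mono (t := Icc (W / 2) W ×ˢ Icc (0 : ℝ) 1)
    (Set.prod_mono hI (subset_univ _))).exists_lipschitzOnWith one_ne_zero
    ((convex_Icc _ _).prod (convex_Icc _ _)) (isCompact_Icc.prod isCompact_Icc)
  refine ⟨K, K.2, fun V hV p hp => ?_⟩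
  obtain ⟨σ, hσ, rfl⟩ := (mem_iff_image hper (Ioc_subset_Icc_self (hI V hV)) p).1 hp
  refine ⟨Γ (W, σ), (mem_iff_image hper (Ioc_subset_Icc_self hW) _).2 ⟨σ, hσ, rfl⟩, ?_⟩
  have hWW : W ∈ Icc (W / 2) W := ⟨by linarith [hW.1], le_rfl⟩
  have := hK.dist_le_mul (V, σ) ⟨hV, hσ⟩ (W, σ) ⟨hWW, hσ⟩
  rwa [Prod.dist_eq (x := (V, σ)), dist_self, max_eq_left dist_nonneg, dist_comm V W, Real.dist_eq,
    abs_of_nonneg (sub_nonneg.2 hV.2)] at this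

/-- A curve that crosses `C W` outwards with nonzero speed has a positive rate of `VPLL`. -/
lemma exists_rate {W : ℝ} (hW : W ∈ Ioc 0 Vbar) {y : ℝ → ℝ × ℝ} {D : ℝ × ℝ → ℝ} {d : ℝ}
    (hy : ContinuousAt y 0) (hp : y 0 ∈ C W) (hd : 0 < d) (hD : HasDerivAt (fun t => D (y t)) d 0)
    {K' : NNReal} {N : Set (ℝ × ℝ)} (hN : N ∈ 𝓝 (y 0)) (hlip : LipschitzOnWith K' D N)
    (hD0 : ∀ q ∈ C W, q ∈ N → D q = 0)
    (hin : ∀ᶠ q in 𝓝 (y 0), D q < 0 → q ∈ closedRegion (C W) \ C W) :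
    ∃ c > (0 : ℝ), ∀ᶠ t in 𝓝[<] (0 : ℝ), y t ∈ closedRegion (C Vbar) ∧
      c * -t ≤ W - VPLL Vbar C (y t) := by
  obtain ⟨K, hK, hdist⟩ := H.exists_dist_le hW
  have hsub := H.region_mono hW.1 hW.2 le_rfl
  have hpV : y 0 ∈ closedRegion (C Vbar) := hsub (Or.inl hp)
  have h0 : D (y 0) = 0 := hD0 _ hp (mem_of_mem_nhds hN)
  have hyl : Tendsto y (𝓝[<] 0) (𝓝 (y 0)) := hy.mono_left nhdsWithin_le_nhds
  have h1 : ∀ᶠ t in 𝓝[<] (0 : ℝ), D (y t) < d / 2 * t := by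
    have := hD.hasDerivWithinAt (s := Iio 0)
    rw [hasDerivWithinAt_iff_tendsto_slope' (by simp)] at this
    filter_upwards [this.eventually_const_lt (half_lt_self hd), self_mem_nhdsWithin] with t ht ht0
    rw [slope_def_field, h0, sub_zero, sub_zero, lt_div_iff_of_neg ht0] at ht
    exact ht
  have hv0 : VPLL Vbar C (y 0) = W := H.VPLL_eq (Ioc_subset_Icc_self hW) hp
  have h2 : ∀ᶠ t in 𝓝[<] (0 : ℝ), y t ∈ closedRegion (C Vbar) ∧ y t ∈ closedRegion (C W) := by
    filter_upwards [h1, hyl.eventually hin, self_mem_nhdsWithin] with t ht1 ht2 ht0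
    have := (ht2 (ht1.trans (mul_neg_of_pos_of_neg (half_pos hd) ht0))).1
    exact ⟨hsub this, this⟩
  have hv : Tendsto (fun t => VPLL Vbar C (y t)) (𝓝[<] 0) (𝓝 W) := by
    rw [← hv0]
    exact (H.continuousOn_VPLL _ hpV).tendsto.comp
      (tendsto_nhdsWithin_iff.2 ⟨hyl, h2.mono fun _ h => h.1⟩)
  obtain ⟨ε, hε, hball⟩ := Metric.mem_nhds_iff.1 hN
  have h3 : ∀ᶠ t in 𝓝[<] (0 : ℝ), K * (W - VPLL Vbar C (y t)) < ε / 2 := by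
    have : Tendsto (fun t => K * (W - VPLL Vbar C (y t))) (𝓝[<] 0) (𝓝 (K * (W - W))) :=
      (hv.const_sub W).const_mul K
    rw [sub_self, mul_zero] at this
    exact this.eventually_lt_const (half_pos hε)
  have h4 : ∀ᶠ t in 𝓝[<] (0 : ℝ), y t ∈ Metric.ball (y 0) (ε / 2) :=
    hyl.eventually (Metric.ball_mem_nhds _ (half_pos hε))
  -- From d/2·|t| ≤ |D(y t)| ≤ K'·dist(y t, C W) ≤ K'K·(W - V^PLL(y t)); the summand 1 only avoids
  -- division by zero. Differentiability of V^PLL is not needed.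
  refine ⟨d / 2 / (K' * K + 1), by positivity, ?_⟩
  filter_upwards [h1, h2, h3, h4, hv.eventually_const_lt (half_lt_self hW.1), self_mem_nhdsWithin]
    with t ht1 ht2 ht3 ht4 ht5 ht0
  refine ⟨ht2.1, ?_⟩
  have hle := (H.VPLL_le_iff hW ht2.1).2 ht2.2
  obtain ⟨q, hq, hqd⟩ := hdist _ ⟨ht5.le, hle⟩ _ (H.VPLL_spec ht2.1).2
  have hyN : y t ∈ N := hball (Metric.ball_subset_ball (by linarith) ht4)
  have hqN : q ∈ N := by
    refine hball (Metric.mem_ball.2 ?_)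
    have := dist_triangle q (y t) (y 0)
    rw [dist_comm q (y t)] at this
    have := Metric.mem_ball.1 ht4
    linarith
  have h5 := hlip.dist_le_mul _ hyN _ hqN
  rw [hD0 q hq hqN, Real.dist_eq, sub_zero] at h5
  have h6 : K' * dist (y t) q ≤ K' * (K * (W - VPLL Vbar C (y t))) := by gcongr
  have h7 := neg_abs_le (D (y t))
  rw [div_mul_eq_mul_div, div_le_iff₀ (by positivity)]
  have h8 : 0 ≤ W - VPLL Vbar C (y t) := sub_nonneg.2 hle
  linarith

omit H in
/-- Differentiability data for the defining function `ω - U(ψ)` of a graph. -/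
lemma exists_lipschitzOn_graph {κ : ℝ} {U u : ℝ → ℝ} {p : ℝ × ℝ}
    (hU : ∀ᶠ s in 𝓝 (p.1 - κ * p.2), HasDerivAt U (u s) s) (hu : ContinuousAt u (p.1 - κ * p.2)) :
    ∃ K : NNReal, ∃ N ∈ 𝓝 p, LipschitzOnWith K (fun q : ℝ × ℝ => q.2 - U (q.1 - κ * q.2)) N := by
  have h1 : HasStrictDerivAt U (u (p.1 - κ * p.2)) (p.1 - κ * p.2) :=
    hasStrictDerivAt_of_hasDerivAt_of_continuousAt hU hu
  have h2 : HasStrictFDerivAt (fun q : ℝ × ℝ => q.1 - κ * q.2)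
      (ContinuousLinearMap.fst ℝ ℝ ℝ - κ • ContinuousLinearMap.snd ℝ ℝ ℝ) p := by
    exact hasStrictFDerivAt_fst.sub (hasStrictFDerivAt_snd.const_mul κ)
  have h3 := (hasStrictFDerivAt_snd (𝕜 := ℝ) (p := p)).sub (h1.comp_hasStrictFDerivAt p h2)
  exact h3.exists_lipschitzOnWith

/-- The growth bound is positive above the diagonal. -/
theorem growth_pos {F : ℝ → ℝ → ℝ} (hF : S.IsGrowthBound P Vbar Vmax C F) {W V : ℝ}
    (hW : W ∈ Ioc 0 Vbar) (hWV : W < V) (hV : V < Vmax) : 0 < F W V := by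
  by_contra! hneg
  obtain ⟨a, b, U, L, hl, hc⟩ := H.exists_loop hW
  obtain ⟨p, hpC, hp0, hnd⟩ := H.exists_nondegenerate hW
  have hns : ∀ x, VCC P x ≤ V → S.Nonsingular x := fun x hx => H.nonsing x (hx.trans hV.le)
  set ψ₀ := p.1 - S.κ * p.2 with hψ₀
  have hpe : p = (ψ₀ + S.κ * p.2, p.2) := Prod.ext (by simp [hψ₀]) rfl
  -- The excess of an acceleration attained at level V over the extremal one of level W is the speed
  -- d with which the solution leaves Λ(W).
  have hacc := S.exists_acc_gt_and_lt (s := ψ₀) (w := p.2) H.posDef hW.1.le hWV hns (by rwa [← hpe])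
  rw [show ψ₀ + S.κ * p.2 = p.1 by simp [hψ₀]] at hacc
  have hlipHi := (S.locLip_accHi H.posDef hW.1.le (H.nonsing' hW.2)).continuous
  have hlipLo := (S.locLip_accLo H.posDef hW.1.le (H.nonsing' hW.2)).continuous
  have hon := (hc p).1 hpC
  rw [← hψ₀] at hon
  -- a state on the cycle from which the solution leaves the region with nonzero speed
  have key : ∃ x, VCC P x = V ∧ ∀ z : ℝ → State, z 0 = (p.1, p.2, x) →
      HasDerivAt (fun t => (z t).1 - S.κ * (z t).2.1) p.2 0 →
      HasDerivAt (fun t => (z t).2.1) (-S.ki * S.f p.1 p.2 x) 0 →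
      ∃ c > (0 : ℝ), ∀ᶠ t in 𝓝[<] (0 : ℝ), ((z t).1, (z t).2.1) ∈ closedRegion (C Vbar) ∧
        c * -t ≤ W - VPLL Vbar C ((z t).1, (z t).2.1) := by
    have hycont : ∀ z : ℝ → State, HasDerivAt (fun t => (z t).1 - S.κ * (z t).2.1) p.2 0 →
        ∀ α, HasDerivAt (fun t => (z t).2.1) α 0 →
        ContinuousAt (fun t => ((z t).1, (z t).2.1)) 0 := by
      intro z h1 α h2
      have := (h1.continuousAt.add (h2.continuousAt.const_mul S.κ)).prodMk h2.continuousAt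
      simpa using this
    have hψc : Continuous fun q : ℝ × ℝ => q.1 - S.κ * q.2 := by fun_prop
    rcases hon with ⟨ha, hb, hU | hL⟩
    · have hψm := hl.mem_Ioo_of_U_ne ha hb (hU ▸ hp0)
      have hUpos := hl.U_pos _ hψm
      obtain ⟨x, hx, hgt⟩ := hacc.1
      refine ⟨x, hx, fun z hz0 hψ hω => ?_⟩
      have hnh := isOpen_Ioo.mem_nhds hψm
      obtain ⟨K', N, hN, hlip⟩ := exists_lipschitzOn_graph (κ := S.κ) (p := p) (U := U)
        (Filter.mem_of_superset hnh fun s hs => hl.derivU s hs) (by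
          have hUc := (hl.derivU _ hψm).continuousAt
          exact (hlipHi.continuousAt.comp (continuousAt_id.prodMk hUc)).div hUc hUpos.ne')
      have hev : ∀ᶠ q : ℝ × ℝ in 𝓝 p, q.1 - S.κ * q.2 ∈ Ioo a b ∧ 0 < q.2 :=
        (hψc.continuousAt.eventually hnh).and
          (continuous_snd.continuousAt.eventually_const_lt (hU ▸ hUpos))
      obtain ⟨N', hN', hN''⟩ := eventually_iff_exists_mem.1 hev
      have hz0' : ((z 0).1, (z 0).2.1) = p := by rw [hz0]
      refine H.exists_rate hW (y := fun t => ((z t).1, (z t).2.1))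
        (D := fun q : ℝ × ℝ => q.2 - U (q.1 - S.κ * q.2)) (N := N ∩ N')
        (d := -S.ki * S.f p.1 p.2 x - S.accHi P W ψ₀ p.2 )
        (hycont z hψ _ hω) (by rwa [hz0']) (by linarith) ?_ (by rw [hz0']; exact inter_mem hN hN')
        (hlip.mono inter_subset_left) ?_ ?_
      · have hd := hl.derivU _ hψm
        have e : (z 0).1 - S.κ * (z 0).2.1 = ψ₀ := by rw [hz0]
        have := hω.sub (HasDerivAt.comp (0 : ℝ) (by rwa [e]) hψ)
        refine this.congr_deriv ?_
        rw [← hU, div_mul_cancel₀ _ hp0]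
      · intro q hq hqN
        obtain ⟨h1, h2⟩ := hN'' q hqN.2
        rcases (hc q).1 hq with ⟨-, -, h | h⟩
        · exact sub_eq_zero.2 h
        · have := hl.L_pos _ h1; linarith
      · rw [hz0']
        filter_upwards [hev] with q hq hD
        rw [hl.mem_inner_iff hc]
        exact ⟨hq.1.1, hq.1.2, by linarith [hl.L_pos _ hq.1, hq.2], by linarith⟩
    · have hLne : L ψ₀ ≠ 0 := by intro h; rw [h] at hL; exact hp0 (by simpa using hL)
      have hψm := hl.mem_Ioo_of_L_ne ha hb hLne
      have hLpos := hl.L_pos _ hψm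
      obtain ⟨x, hx, hgt⟩ := hacc.2
      refine ⟨x, hx, fun z hz0 hψ hω => ?_⟩
      have hnh := isOpen_Ioo.mem_nhds hψm
      obtain ⟨K', N, hN, hlip⟩ := exists_lipschitzOn_graph (κ := S.κ) (p := p) (U := fun s => -L s)
        (Filter.mem_of_superset hnh fun s hs => (hl.derivL s hs).neg) (by
          have hLc := (hl.derivL _ hψm).continuousAt
          exact ((hlipLo.continuousAt.comp (continuousAt_id.prodMk hLc.neg)).div hLc hLpos.ne').neg)
      have hev : ∀ᶠ q : ℝ × ℝ in 𝓝 p, q.1 - S.κ * q.2 ∈ Ioo a b ∧ q.2 < 0 :=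
        (hψc.continuousAt.eventually hnh).and
          (continuous_snd.continuousAt.eventually_lt_const (by rw [hL]; linarith))
      obtain ⟨N', hN', hN''⟩ := eventually_iff_exists_mem.1 hev
      have hz0' : ((z 0).1, (z 0).2.1) = p := by rw [hz0]
      refine H.exists_rate hW (y := fun t => ((z t).1, (z t).2.1))
        (D := fun q : ℝ × ℝ => -(q.2 - -L (q.1 - S.κ * q.2))) (N := N ∩ N')
        (d := S.accLo P W ψ₀ p.2 - -S.ki * S.f p.1 p.2 x)
        (hycont z hψ _ hω) (by rwa [hz0']) (by linarith) ?_ (by rw [hz0']; exact inter_mem hN hN')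
        (hlip.neg.mono inter_subset_left) ?_ ?_
      · have hd := hl.derivL _ hψm
        have e : (z 0).1 - S.κ * (z 0).2.1 = ψ₀ := by rw [hz0]
        have := (hω.sub (HasDerivAt.comp (0 : ℝ) (h₂ := fun s => -L s)
          (h := fun t => (z t).1 - S.κ * (z t).2.1) (by rw [e]; exact hd.neg) hψ)).neg
        refine this.congr_deriv ?_
        rw [← hL, neg_mul, show p.2 = -L ψ₀ from hL]
        field_simp
        ring
      · intro q hq hqN
        obtain ⟨h1, h2⟩ := hN'' q hqN.2
        rcases (hc q).1 hq with ⟨-, -, h | h⟩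
        · have := hl.U_pos _ h1; linarith
        · exact neg_eq_zero.2 (sub_eq_zero.2 h)
      · rw [hz0']
        filter_upwards [hev] with q hq hD
        rw [hl.mem_inner_iff hc]
        exact ⟨hq.1.1, hq.1.2, by linarith, by linarith [hl.U_pos _ hq.1, hq.2]⟩
  obtain ⟨x, hx, key⟩ := key
  obtain ⟨z, hz0, δ, hδ, hz⟩ := exists_local_solution (S := S) (z₀ := (p.1, p.2, x)) (hns x hx.le)
  have h0I : (0 : ℝ) ∈ Icc (-δ) δ := ⟨by linarith, hδ.le⟩
  have hnh : Icc (-δ) δ ∈ 𝓝 (0 : ℝ) := Icc_mem_nhds (by linarith) hδ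
  obtain ⟨c, hc0, hrate⟩ := key z hz0
    (by simpa [hz0] using (hz.hasDerivWithinAt_ψ h0I).hasDerivAt hnh)
    (by simpa [hz0] using (hz.hasDerivWithinAt_ω h0I).hasDerivAt hnh)
  have hVc : ∀ᶠ t in 𝓝[<] (0 : ℝ), VCC P (z t).2.2 < Vmax := by
    have := ((hz.continuousOn_VCC (P := P)).continuousAt hnh).tendsto.mono_left
      (nhdsWithin_le_nhds (s := Iio 0))
    refine this.eventually_lt_const ?_
    rw [hz0, hx]; exact hV
  obtain ⟨η, hη, hη'⟩ := (mem_nhdsLT_iff_exists_Ioo_subset.1 (hrate.and hVc))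
  have hη0 : η < 0 := hη
  -- The interval ends at the crossing time: for W = Vbar the solution is outside Λ(Vbar)
  -- afterwards. Before it V^CC may exceed V, but it is still below Vmax.
  set t₀ := max (η / 2) (-δ) with ht₀
  have ht₀0 : t₀ < 0 := max_lt (by linarith) (by linarith)
  have hsubI : Icc t₀ 0 ⊆ Icc (-δ) δ := Icc_subset_Icc (le_max_right _ _) hδ.le
  have hp0' : ((z 0).1, (z 0).2.1) = p := by rw [hz0]
  have hneg' : ∀ t ∈ Ico t₀ 0, t ∈ Ioo η 0 := fun t ht =>
    ⟨lt_of_lt_of_le (by linarith) ((le_max_left _ _).trans ht.1), ht.2⟩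
  have hgb := hF t₀ 0 z (hz.mono hsubI) (by
    intro t ht
    rcases ht.2.eq_or_lt with rfl | h
    · rw [hp0', hz0]
      exact ⟨H.region_mono hW.1 hW.2 le_rfl (Or.inl hpC), by simp [hx, hV.le]⟩
    · have := hη' (hneg' t ⟨ht.1, h⟩)
      exact ⟨this.1.1, this.2.le⟩) 0 ⟨ht₀0.le, le_rfl⟩ c (by
        rw [hp0', hz0, H.VPLL_eq (Ioc_subset_Icc_self hW) hpC, hx]; linarith)
  have hsub : 𝓝[<] (0 : ℝ) ≤ 𝓝[Icc t₀ 0 \ {0}] 0 := by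
    refine nhdsWithin_le_iff.2 ?_
    filter_upwards [Ioo_mem_nhdsLT ht₀0] with t ht
    exact ⟨⟨ht.1.le, ht.2.le⟩, ht.2.ne⟩
  obtain ⟨t, ht1, ht2, ht3⟩ := ((hgb.filter_mono hsub).and (hrate.and self_mem_nhdsWithin)).exists
  have ht3 : t < 0 := ht3
  rw [slope_def_field, sub_zero, hp0', H.VPLL_eq (Ioc_subset_Icc_self hW) hpC,
    div_lt_iff_of_neg ht3] at ht1
  linarith [ht2.2]

end CycleFamily

/-- The standing assumptions on the set that is to be shown to be an estimation. -/
structure BoundedGrowth (S : InverterSystem) (P : Matrix (Fin 4) (Fin 4) ℝ) (γ Vbar Vmax : ℝ)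
    (C : ℝ → Set (ℝ × ℝ)) (F : ℝ → ℝ → ℝ) (Φ : ℝ → ℝ) : Prop
    extends S.CycleFamily P Vbar Vmax C where
  lyap : S.IsCCLyapunov P γ
  growth : S.IsGrowthBound P Vbar Vmax C F
  const : ∀ V ∈ Icc 0 Vbar, Φ V = Vbar
  ode : ∀ V ∈ Icc Vbar Vmax, HasDerivWithinAt Φ (-F (Φ V) V / (γ * V)) (Icc Vbar Vmax) V
  pos : ∀ V ∈ Ico Vbar Vmax, 0 < Φ V ∧ Φ V ≤ Vbar
  end_zero : Φ Vmax = 0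

namespace BoundedGrowth
variable {γ Vbar Vmax : ℝ} {C : ℝ → Set (ℝ × ℝ)} {F : ℝ → ℝ → ℝ} {Φ : ℝ → ℝ}
  (B : S.BoundedGrowth P γ Vbar Vmax C F Φ)
include B

lemma F_pos {V : ℝ} (hV : V ∈ Ioo Vbar Vmax) : 0 < F (Φ V) V := by
  have h := B.pos V (Ioo_subset_Ico_self hV)
  exact B.growth_pos B.growth h (h.2.trans_lt hV.1) hV.2

/-- Since F is positive along the graph, Φ decreases strictly. Points of the improved set with V^CC
in this range thus lie strictly inside C Vbar, which leaves room to apply the growth bound. -/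
lemma Φ_lt {V : ℝ} (hV : V ∈ Ioc Vbar Vmax) : Φ V < Vbar := by
  have hanti : StrictAntiOn Φ (Icc Vbar Vmax) := by
    refine strictAntiOn_of_deriv_neg (convex_Icc _ _)
      (fun v hv => (B.ode v hv).continuousWithinAt) fun v hv => ?_
    rw [interior_Icc] at hv
    rw [((B.ode v (Ioo_subset_Icc_self hv)).hasDerivAt (Icc_mem_nhds hv.1 hv.2)).deriv]
    have h1 := B.F_pos hv
    have h2 : 0 < γ * v := mul_pos B.lyap.2.1 (B.Vbar_pos.trans hv.1)
    rw [neg_div]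
    exact neg_lt_zero.2 (div_pos h1 h2)
  have := hanti ⟨le_rfl, B.lt.le⟩ (Ioc_subset_Icc_self hV) hV.1
  rwa [B.const Vbar ⟨B.Vbar_pos.le, le_rfl⟩] at this

lemma continuousOn_Φ : ContinuousOn Φ (Icc 0 Vmax) := by
  have h1 : ContinuousOn Φ (Icc 0 Vbar) := continuousOn_const.congr B.const
  have h2 : ContinuousOn Φ (Icc Vbar Vmax) := fun v hv => (B.ode v hv).continuousWithinAt
  rw [← Icc_union_Icc_eq_Icc B.Vbar_pos.le B.lt.le]
  exact h1.union_of_isClosed h2 isClosed_Icc isClosed_Icc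

end BoundedGrowth
end InverterSystem

/-! ### Forward invariance of the improved set. -/

namespace InverterSystem
variable {S : InverterSystem} {P : Matrix (Fin 4) (Fin 4) ℝ}

namespace CycleFamily
variable {Vbar Vmax γ : ℝ} {C : ℝ → Set (ℝ × ℝ)} (H : S.CycleFamily P Vbar Vmax C)
include H

/-- `Λ(V)` is invariant as long as `V^CC ≤ V`. -/
theorem mem_region_of_mem_region (hP : S.IsCCLyapunov P γ) {V : ℝ} (hV : V ∈ Ioc 0 Vbar)
    {z : ℝ → State} {t₀ t₁ : ℝ} (hz : S.IsSolutionOn z (Icc t₀ t₁)) (hVz : VCC P (z t₀).2.2 ≤ V)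
    (h0 : ((z t₀).1, (z t₀).2.1) ∈ closedRegion (C V)) :
    ∀ t ∈ Icc t₀ t₁, ((z t).1, (z t).2.1) ∈ closedRegion (C V) := by
  obtain ⟨a, b, U, L, hl, hc⟩ := H.exists_loop hV
  have hns := H.nonsing' hV.2
  have hT := hz.traj H.posDef hV.1.le hns fun t ht => (hz.VCC_antitone hP ht).trans hVz
  simp only [hl.mem_closedRegion_iff hc] at h0 ⊢
  exact hT.inRegion_of_inRegion hl (S.locLip_accHi H.posDef hV.1.le hns)
    (S.locLip_accLo H.posDef hV.1.le hns) h0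

/-- The states at which `V^PLL` and `V^CC` are within their bounds. -/
lemma isCompact_states :
    IsCompact {z : State | (z.1, z.2.1) ∈ closedRegion (C Vbar) ∧ VCC P z.2.2 ≤ Vmax} := by
  have h := ((H.isCompact_region ⟨H.Vbar_pos, le_rfl⟩).prod (isCompact_VCC_le H.posDef Vmax)).image
    (f := fun q : (ℝ × ℝ) × (Fin 4 → ℝ) => ((q.1.1, q.1.2, q.2) : State)) (by fun_prop)
  convert h using 1
  ext ⟨θ, ω, x⟩
  constructor
  · rintro ⟨h1, h2⟩; exact ⟨((θ, ω), x), ⟨h1, h2⟩, rfl⟩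
  · rintro ⟨⟨⟨θ', ω'⟩, x'⟩, ⟨h1, h2⟩, e⟩
    obtain ⟨rfl, rfl, rfl⟩ : θ' = θ ∧ ω' = ω ∧ x' = x := by simpa using e
    exact ⟨h1, h2⟩

end CycleFamily

namespace BoundedGrowth
variable {γ Vbar Vmax : ℝ} {C : ℝ → Set (ℝ × ℝ)} {F : ℝ → ℝ → ℝ} {Φ : ℝ → ℝ}
  (B : S.BoundedGrowth P γ Vbar Vmax C F Φ)
include B

lemma isClosed_improvedSet : IsClosed (improvedSet P Vbar Vmax C Φ) := by
  set K : Set State := {z | (z.1, z.2.1) ∈ closedRegion (C Vbar) ∧ VCC P z.2.2 ≤ Vmax} with hK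
  have h1 : ContinuousOn (fun z : State => VPLL Vbar C (z.1, z.2.1)) K :=
    B.continuousOn_VPLL.comp (by fun_prop) fun z hz => hz.1
  have h2 : ContinuousOn (fun z : State => Φ (VCC P z.2.2)) K :=
    B.continuousOn_Φ.comp (continuous_VCC.comp (by fun_prop)).continuousOn
      fun z hz => ⟨VCC_nonneg B.posDef _, hz.2⟩
  have := (h1.sub h2).preimage_isClosed_of_isClosed B.isCompact_states.isClosed
    (isClosed_Iic (a := (0 : ℝ)))
  convert this using 1
  ext z
  simp only [improvedSet, Set.mem_ofPred_eq, hK, mem_inter_iff, mem_preimage, mem_Iic, sub_nonpos,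
    Pi.sub_apply, and_assoc]

/-- The improved set is invariant below the level `Vmax` of `V^CC`. -/
theorem mem_improvedSet_of_lt {z : ℝ → State} {t₀ t₁ : ℝ} (hz : S.IsSolutionOn z (Icc t₀ t₁))
    (h0 : z t₀ ∈ improvedSet P Vbar Vmax C Φ) (hlt : VCC P (z t₀).2.2 < Vmax) :
    ∀ t ∈ Icc t₀ t₁, z t ∈ improvedSet P Vbar Vmax C Φ := by
  have hcl : IsClosed ({t | z t ∈ improvedSet P Vbar Vmax C Φ} ∩ Icc t₀ t₁) := by
    rw [inter_comm]
    exact hz.continuousOn.preimage_isClosed_of_isClosed isClosed_Icc B.isClosed_improvedSet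
  refine hcl.Icc_subset_of_forall_exists_gt h0 fun t ht t' ht' => ?_
  obtain ⟨⟨hr, -, hv⟩, ht⟩ := ht
  have hzt : S.IsSolutionOn z (Icc t t₁) := hz.mono (Icc_subset_Icc_left ht.1)
  have hVt : VCC P (z t).2.2 < Vmax :=
    (hz.VCC_antitone B.lyap (Ico_subset_Icc_self ht)).trans_lt hlt
  suffices h : ∀ᶠ s in 𝓝[>] t, z s ∈ improvedSet P Vbar Vmax C Φ by
    obtain ⟨s, h1, h2⟩ := (h.and (Ioc_mem_nhdsGT ht')).exists
    exact ⟨s, h1, h2⟩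
  have hmem : ∀ᶠ s in 𝓝[>] t, s ∈ Icc t t₁ := Icc_mem_right ⟨le_rfl, ht.2⟩ self_mem_nhdsWithin
  -- Below the level Vbar, where Φ is constant, the claim is the invariance of Λ(Vbar); above it a
  -- differential comparison of V^PLL with Φ(V^CC) is used.
  rcases le_or_gt (VCC P (z t).2.2) Vbar with hc | hc
  · filter_upwards [hmem] with s hs
    have h1 := B.mem_region_of_mem_region B.lyap ⟨B.Vbar_pos, le_rfl⟩ hzt hc hr s hs
    have h2 := (hzt.VCC_antitone B.lyap hs).trans hc
    refine ⟨h1, h2.trans B.lt.le, ?_⟩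
    rw [B.const _ ⟨VCC_nonneg B.posDef _, h2⟩]
    exact (B.VPLL_spec h1).1.2
  · have hin := (B.VPLL_lt_iff ⟨B.Vbar_pos, le_rfl⟩ hr).1
      (hv.trans_lt (B.Φ_lt ⟨hc, hVt.le⟩))
    have htI : t ∈ Icc t₀ t₁ := Ico_subset_Icc_self ht
    have hev : ∀ᶠ s in 𝓝[Icc t t₁] t,
        ((z s).1, (z s).2.1) ∈ closedRegion (C Vbar) ∧ Vbar < VCC P (z s).2.2 := by
      have hI : t ∈ Icc t t₁ := ⟨le_rfl, ht.2.le⟩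
      refine Filter.Eventually.and ?_ ((hzt.continuousOn_VCC t hI).eventually_const_lt hc)
      filter_upwards [(hzt.continuousOn_plane t hI).eventually
        ((B.isOpen_inner ⟨B.Vbar_pos, le_rfl⟩).mem_nhds hin)] with s hs using hs.1
    have hev' : ∀ᶠ s in 𝓝[≥] t, s ≤ t₁ ∧ (((z s).1, (z s).2.1) ∈ closedRegion (C Vbar) ∧
        Vbar < VCC P (z s).2.2) := by
      refine Filter.Eventually.and ?_ ?_
      · filter_upwards [Icc_mem_nhdsGE ht.2] with s hs using hs.2
      · exact nhdsWithin_le_iff.2 (Icc_mem_nhdsGE ht.2) hev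
    obtain ⟨δ, hδ, hsub⟩ := (mem_nhdsGE_iff_exists_Icc_subset).1 hev'
    have hδ : t < δ := hδ
    have hδ1 : δ ≤ t₁ := (hsub ⟨hδ.le, le_rfl⟩).1
    have hzδ : S.IsSolutionOn z (Icc t δ) := hzt.mono (Icc_subset_Icc_right hδ1)
    have hV' : ∀ s ∈ Icc t δ, VCC P (z s).2.2 ∈ Ioo Vbar Vmax := fun s hs =>
      ⟨(hsub hs).2.2, (hzδ.VCC_antitone B.lyap hs).trans_lt hVt⟩
    have hder : ∀ s ∈ Icc t δ, HasDerivWithinAt (fun s => Φ (VCC P (z s).2.2))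
        (-F (Φ (VCC P (z s).2.2)) (VCC P (z s).2.2) / (γ * VCC P (z s).2.2)
          * S.VCCdot P (z s).2.2) (Icc t δ) s := fun s hs =>
      ((B.ode _ (Ioo_subset_Icc_self (hV' s hs))).hasDerivAt
        (Icc_mem_nhds (hV' s hs).1 (hV' s hs).2)).comp_hasDerivWithinAt s
        (hzδ.hasDerivWithinAt_VCC hs)
    have key := image_le_of_liminf_slope_right_lt_deriv_boundary' (a := t) (b := δ)
      (f := fun s => VPLL Vbar C ((z s).1, (z s).2.1))
      (f' := fun s => F (VPLL Vbar C ((z s).1, (z s).2.1)) (VCC P (z s).2.2))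
      (B := fun s => Φ (VCC P (z s).2.2))
      (B' := fun s => -F (Φ (VCC P (z s).2.2)) (VCC P (z s).2.2) / (γ * VCC P (z s).2.2)
          * S.VCCdot P (z s).2.2)
      (B.continuousOn_VPLL.comp hzδ.continuousOn_plane fun s hs => (hsub hs).2.1) ?_ hv
      (fun s hs => (hder s hs).continuousWithinAt) ?_ ?_
    · filter_upwards [Icc_mem_nhdsGT hδ] with s hs
      exact ⟨(hsub hs).2.1, (hV' s hs).2.le, key hs⟩
    · intro s hs r hr'
      have := B.growth t δ z hzδ (fun s hs => ⟨(hsub hs).2.1, (hV' s hs).2.le⟩) s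
        (Ico_subset_Icc_self hs) r hr'
      refine (this.filter_mono (nhdsWithin_le_iff.2 ?_)).frequently
      filter_upwards [Ioc_mem_nhdsGT hs.2] with u hu
      exact ⟨⟨hs.1.trans hu.1.le, hu.2⟩, hu.1.ne'⟩
    · intro s hs
      exact (hder s (Ico_subset_Icc_self hs)).mono_of_mem_nhdsWithin
        (Filter.mem_of_superset (Icc_mem_nhdsGE hs.2) (Icc_subset_Icc_left hs.1))
    -- At contact the derivative of Φ(V^CC) is (F/(γV))·(-dV/dt) with V = V^CC, which exceeds F
    -- because F > 0 and dV/dt < -γV.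
    · intro s hs heq
      have hsI := hV' s (Ico_subset_Icc_self hs)
      rw [heq]
      have hF := B.F_pos hsI
      have hc0 : 0 < VCC P (z s).2.2 := B.Vbar_pos.trans hsI.1
      have hx : (z s).2.2 ≠ 0 := by
        intro h; rw [h, VCC_zero] at hc0; exact lt_irrefl _ hc0
      have hd := B.lyap.VCCdot_lt hx
      have hγ : 0 < γ * VCC P (z s).2.2 := mul_pos B.lyap.2.1 hc0
      rw [div_mul_eq_mul_div, lt_div_iff₀ hγ]
      nlinarith

/-- The improved set contains the global integral curves of a modified field that start in it. -/
theorem integralCurve_mem {G : State → State} {M : NNReal} (hG : LipschitzWith M G)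
    {N : ℝ} (hN : ∀ z, ‖G z‖ ≤ N)
    (hGF : ∀ z : State, (z.1, z.2.1) ∈ closedRegion (C Vbar) → VCC P z.2.2 ≤ Vmax →
      G =ᶠ[𝓝 z] S.field) {ζ : ℝ → State} (hζ : ∀ t, HasDerivAt ζ (G (ζ t)) t)
    (h0 : ζ 0 ∈ improvedSet P Vbar Vmax C Φ) {t : ℝ} (ht : 0 ≤ t) :
    ζ t ∈ improvedSet P Vbar Vmax C Φ := by
  -- the case of an initial state below the level `Vmax`
  have key : ∀ ζ : ℝ → State, (∀ t, HasDerivAt ζ (G (ζ t)) t) →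
      ζ 0 ∈ improvedSet P Vbar Vmax C Φ → VCC P (ζ 0).2.2 < Vmax →
      ζ t ∈ improvedSet P Vbar Vmax C Φ := by
    intro ζ hζ h0 hlt
    have hcont : Continuous ζ := continuous_iff_continuousAt.2 fun t => (hζ t).continuousAt
    have hVc : Continuous fun t => VCC P (ζ t).2.2 := continuous_VCC.comp (by fun_prop)
    have hsub : Icc 0 t ⊆ {t | ζ t ∈ improvedSet P Vbar Vmax C Φ ∧
        VCC P (ζ t).2.2 ≤ VCC P (ζ 0).2.2} := by
      refine IsClosed.Icc_subset_of_forall_exists_gt ?_ ⟨h0, le_rfl⟩ fun s hs s' hs' => ?_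
      · exact ((B.isClosed_improvedSet.preimage hcont).inter
          (isClosed_le hVc continuous_const)).inter isClosed_Icc
      obtain ⟨⟨hsW, hsV⟩, -⟩ := hs
      have hev := (hcont.tendsto s).eventually ((hGF _ hsW.1 hsW.2.1).and
        (isOpen_nonsingular.mem_nhds (B.nonsing _ hsW.2.1)))
      obtain ⟨δ, hδ, hball⟩ := Metric.eventually_nhds_iff.1 hev
      have hs' : s < s' := hs'
      set u := min s' (s + δ / 2)
      have hu : s < u := lt_min hs' (by linarith)
      have hz : S.IsSolutionOn ζ (Icc s u) := by
        intro r hr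
        have hru : r ≤ s + δ / 2 := hr.2.trans (min_le_right _ _)
        have := hball (y := r) (by
          rw [Real.dist_eq, abs_of_nonneg (sub_nonneg.2 hr.1)]; linarith)
        exact ⟨this.2, this.1 ▸ (hζ r).hasDerivWithinAt⟩
      have huI : u ∈ Icc s u := ⟨hu.le, le_rfl⟩
      exact ⟨u, ⟨B.mem_improvedSet_of_lt hz hsW (hsV.trans_lt hlt) u huI,
        (hz.VCC_antitone B.lyap huI).trans hsV⟩, hu, min_le_left _ _⟩
    exact (hsub ⟨ht, le_rfl⟩).1
  rcases h0.2.1.lt_or_eq with hlt | heq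
  · exact key ζ hζ h0 hlt
  -- At the top level Φ vanishes, so the planar state is the origin. The initial state is approached
  -- by (0, 0, s x) with s < 1, which lie in the set below the level Vmax.
  have hV0 := h0.2.2
  rw [heq, B.end_zero] at hV0
  have hsp := B.VPLL_spec h0.1
  rw [le_antisymm hV0 hsp.1.1, B.zero, mem_singleton_iff] at hsp
  have hy : ζ 0 = (0, 0, (ζ 0).2.2) := by
    have h1 := congrArg Prod.fst hsp.2
    have h2 := congrArg Prod.snd hsp.2
    exact Prod.ext h1 (Prod.ext h2 rfl)
  set x := (ζ 0).2.2
  choose η hη0 hη using fun s : ℝ => exists_global_integralCurve hG hN ((0, 0, s • x) : State)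
  have h0r : (0 : ℝ × ℝ) ∈ closedRegion (C Vbar) := (B.zero_mem_inner ⟨B.Vbar_pos, le_rfl⟩).1
  have hηW : ∀ s ∈ Ioo (0 : ℝ) 1, η s t ∈ improvedSet P Vbar Vmax C Φ := by
    intro s hs
    have hVs : VCC P (η s 0).2.2 = s ^ 2 * Vmax := by rw [hη0, VCC_smul, heq]
    have hm : 0 < Vmax := B.Vbar_pos.trans B.lt
    have hlt : VCC P (η s 0).2.2 < Vmax := by
      rw [hVs]
      exact mul_lt_of_lt_one_left hm (pow_lt_one₀ hs.1.le hs.2 two_ne_zero)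
    refine key (η s) (hη s) ⟨by rw [hη0]; exact h0r, hlt.le, ?_⟩ hlt
    have hz : VPLL Vbar C ((η s 0).1, (η s 0).2.1) = 0 := by
      rw [hη0]
      exact B.VPLL_eq ⟨le_rfl, B.Vbar_pos.le⟩ (by rw [B.zero]; rfl)
    rw [hz]
    rcases lt_or_ge (VCC P (η s 0).2.2) Vbar with h | h
    · rw [B.const _ ⟨VCC_nonneg B.posDef _, h.le⟩]; exact B.Vbar_pos.le
    · exact (B.pos _ ⟨h, hlt⟩).1.le
  have hdist : ∀ s, dist (η s t) (ζ t) ≤ dist (η s 0) (ζ 0) * Real.exp (M * (t - 0)) := fun s =>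
    dist_le_of_trajectories_ODE (v := fun _ => G) (fun _ => hG)
      (fun r _ => (hη s r).continuousAt.continuousWithinAt) (fun r _ => (hη s r).hasDerivWithinAt)
      (fun r _ => (hζ r).continuousAt.continuousWithinAt) (fun r _ => (hζ r).hasDerivWithinAt)
      le_rfl t ⟨ht, le_rfl⟩
  have hlim : Tendsto (fun s => η s t) (𝓝[<] 1) (𝓝 (ζ t)) := by
    rw [tendsto_iff_dist_tendsto_zero]
    refine squeeze_zero (fun _ => dist_nonneg) hdist ?_
    simp only [hη0]
    have hc : Continuous fun s : ℝ => dist ((0, 0, s • x) : State) (ζ 0) *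
        Real.exp (M * (t - 0)) := by fun_prop
    have := (hc.tendsto 1).mono_left (nhdsWithin_le_nhds (s := Iio 1))
    rwa [one_smul, ← hy, dist_self, zero_mul] at this
  refine B.isClosed_improvedSet.mem_of_tendsto hlim ?_
  filter_upwards [Ioo_mem_nhdsLT zero_lt_one] with s hs using hηW s hs

/-- A given solution coincides with a global integral curve of the field cut off around both the
admissible states and the solution's own compact trace, so the limiting argument for integral curves
covers it. -/
theorem forwardInvariant : S.ForwardInvariant (improvedSet P Vbar Vmax C Φ) := by
  intro T z hz h0 t ht
  set K : Set State := {z | (z.1, z.2.1) ∈ closedRegion (C Vbar) ∧ VCC P z.2.2 ≤ Vmax}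
  have hK : IsCompact (K ∪ z '' Icc 0 T) :=
    B.isCompact_states.union (isCompact_Icc.image_of_continuousOn hz.continuousOn)
  obtain ⟨G, M, N, hG, hN, hGF⟩ := exists_lipschitz_cutoff isOpen_nonsingular hK
    (by
      rintro w (hw | ⟨r, hr, rfl⟩)
      · exact B.nonsing _ hw.2
      · exact (hz r hr).1) S.contDiffOn_field
  obtain ⟨ζ, hζ0, hζ⟩ := exists_global_integralCurve hG hN (z 0)
  have := B.integralCurve_mem hG hN (fun w h1 h2 => hGF w (Or.inl ⟨h1, h2⟩)) hζ (hζ0 ▸ h0) ht.1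
  have heq := ODE_solution_unique (v := fun _ => G) (fun _ => hG)
    (fun r _ => (hζ r).continuousAt.continuousWithinAt) (fun r _ => (hζ r).hasDerivWithinAt)
    hz.continuousOn (fun r hr => by
      have hr' := Ico_subset_Icc_self hr
      rw [(hGF (z r) (Or.inr ⟨r, hr', rfl⟩)).eq_of_nhds]
      exact (hz r hr').2.mono_of_mem_nhdsWithin
        (Filter.mem_of_superset (Icc_mem_nhdsGE hr.2) (Icc_subset_Icc_left hr.1))) hζ0 ht
  rwa [← heq]

end BoundedGrowth
end InverterSystem

/-! ### Solutions confined to a loop. -/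

/-- If a function and its derivative converge, then the derivative converges to zero. -/
lemma tendsto_deriv_eq_zero {f f' : ℝ → ℝ} {T ℓ m : ℝ} (hd : ∀ t > T, HasDerivAt f (f' t) t)
    (hf : Tendsto f atTop (𝓝 ℓ)) (hf' : Tendsto f' atTop (𝓝 m)) : m = 0 := by
  have hc : ∀ t : ℝ, ∃ c, t ≤ c ∧ (T < t → f' c = f (t + 1) - f t) := by
    intro t
    by_cases ht : T < t
    · obtain ⟨c, hc, h⟩ := exists_hasDerivAt_eq_slope f f' (lt_add_one t)
        (fun s hs => (hd s (ht.trans_le hs.1)).continuousAt.continuousWithinAt)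
        (fun s hs => hd s (ht.trans hs.1))
      exact ⟨c, hc.1.le, fun _ => by rw [h, add_sub_cancel_left, div_one]⟩
    · exact ⟨t, le_rfl, fun h => absurd h ht⟩
  choose c hc hc' using hc
  have h1 : Tendsto (fun t => f' (c t)) atTop (𝓝 m) := hf'.comp (tendsto_atTop_mono hc tendsto_id)
  have h2 : Tendsto (fun t => f (t + 1) - f t) atTop (𝓝 (ℓ - ℓ)) :=
    (hf.comp (tendsto_atTop_add_const_right _ _ tendsto_id)).sub hf
  rw [sub_self] at h2
  refine tendsto_nhds_unique h1 (h2.congr' ?_)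
  filter_upwards [eventually_gt_atTop T] with t ht using (hc' t ht).symm

/-- A solution of `s' = w`, `w' = φ(s, w)` that stays on a loop for positive times. -/
structure LoopOrbit (φ : ℝ → ℝ → ℝ) (a b : ℝ) (U L ψ ω : ℝ → ℝ) : Prop where
  cont : Continuous ω
  derivψ : ∀ t > 0, HasDerivAt ψ (ω t) t
  derivω : ∀ t > 0, HasDerivAt ω (φ (ψ t) (ω t)) t
  onLoop : ∀ t > 0, OnLoop a b U L (ψ t) (ω t)

namespace LoopOrbit
variable {lo hi φ : ℝ → ℝ → ℝ} {a b : ℝ} {U L ψ ω : ℝ → ℝ}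

lemma reflect (h : LoopOrbit φ a b U L ψ ω) :
    LoopOrbit (fun s w => -φ (-s) (-w)) (-b) (-a) (fun s => L (-s)) (fun s => U (-s))
      (fun t => -ψ t) (fun t => -ω t) where
  cont := h.cont.neg
  derivψ t ht := (h.derivψ t ht).neg
  derivω t ht := by
    simp only [neg_neg]
    exact (h.derivω t ht).neg
  onLoop t ht := by
    obtain ⟨h1, h2, h3⟩ := h.onLoop t ht
    refine ⟨neg_le_neg h2, neg_le_neg h1, ?_⟩
    simp only [neg_neg]
    rcases h3 with h3 | h3
    · exact Or.inr (by rw [h3])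
    · exact Or.inl (by rw [h3, neg_neg])

lemma eq_U_of_pos (hl : Loop lo hi a b U L) (h : LoopOrbit φ a b U L ψ ω) {t : ℝ} (ht : 0 < t)
    (hω : 0 < ω t) : ψ t ∈ Ioo a b ∧ ω t = U (ψ t) := by
  obtain ⟨h1, h2, h3 | h3⟩ := h.onLoop t ht
  · exact ⟨hl.mem_Ioo_of_U_ne h1 h2 (by rw [← h3]; exact hω.ne'), h3⟩
  · have := hl.L_nonneg h1 h2; linarith

/-- An orbit on the upper half of a loop reaches the right end in finite time. -/
lemma exists_right (hl : Loop lo hi a b U L) (h : LoopOrbit φ a b U L ψ ω)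
    (hφ : Continuous fun p : ℝ × ℝ => φ p.1 p.2) (hφa : 0 < φ a 0) (hφb : φ b 0 < 0) {t : ℝ}
    (ht : 0 < t) (hp : 0 < ω t ∨ (ω t = 0 ∧ ψ t = a)) :
    ∃ τ > t, ψ τ = b ∧ ω τ = 0 ∧ ∀ r ∈ Ioo t τ, 0 < ω r := by
  have hev : ∀ᶠ s in 𝓝[>] t, 0 < ω s := by
    rcases hp with hp | ⟨hp, hpa⟩
    · exact nhdsWithin_le_nhds ((h.cont.tendsto t).eventually_const_lt hp)
    · exact eventually_pos_right ((h.derivω t ht).hasDerivWithinAt (s := Icc t (t + 1)))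
        ⟨le_rfl, lt_add_one t⟩ hp (by rw [hp, hpa]; exact hφa)
  have hmono : ∀ τ, (∀ r ∈ Ioo t τ, 0 < ω r) → StrictMonoOn ψ (Icc t τ) := fun τ hτ => by
    refine strictMonoOn_of_deriv_pos (convex_Icc _ _)
      (fun r hr => (h.derivψ r (ht.trans_le hr.1)).continuousAt.continuousWithinAt) fun r hr => ?_
    rw [interior_Icc] at hr
    rw [(h.derivψ r (ht.trans hr.1)).deriv]
    exact hτ r hr
  by_cases hz : ∃ s > t, ω s = 0
  · obtain ⟨s, hs, hs0⟩ := hz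
    obtain ⟨τ, hτ, hτ0, hlt⟩ := exists_first_zero h.cont hs hs0 hev
    refine ⟨τ, hτ.1, ?_, hτ0, hlt⟩
    have h1 := hmono τ hlt ⟨le_rfl, hτ.1.le⟩ ⟨hτ.1.le, le_rfl⟩ hτ.1
    obtain ⟨h2, h3, h4⟩ := h.onLoop τ (ht.trans hτ.1)
    by_contra hne
    have hm : ψ τ ∈ Ioo a b := ⟨(h.onLoop t ht).1.trans_lt h1, lt_of_le_of_ne h3 hne⟩
    have := hl.U_pos _ hm
    have := hl.L_pos _ hm
    rcases h4 with h4 | h4 <;> linarith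
  -- If ω never vanished again, ψ would increase to a limit m with U(m) = 0, hence m = b; then ω'
  -- would tend to φ(b, 0) < 0 although ω converges.
  exfalso
  push Not at hz
  have hpos : ∀ s > t, 0 < ω s := by
    intro s hs
    by_contra! hle
    obtain ⟨r, hr, hrI⟩ := (hev.and (Ioo_mem_nhdsGT hs)).exists
    obtain ⟨u, hu, hu0⟩ := intermediate_value_Icc' hrI.2.le h.cont.continuousOn ⟨hle, hr.le⟩
    exact hz u (hrI.1.trans_le hu.1) hu0
  have hU : ∀ s > t, ψ s ∈ Ioo a b ∧ ω s = U (ψ s) := fun s hs =>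
    h.eq_U_of_pos hl (ht.trans hs) (hpos s hs)
  set g : ℝ → ℝ := fun s => ψ (max s (t + 1)) with hg
  have hgm : Monotone g := fun r s hrs => by
    have h1 : max r (t + 1) ≤ max s (t + 1) := max_le_max_right _ hrs
    have h2 : t ≤ max r (t + 1) := (by linarith : t ≤ t + 1).trans (le_max_right _ _)
    exact (hmono (max s (t + 1)) fun u hu => hpos u hu.1).monotoneOn ⟨h2, h1⟩ ⟨h2.trans h1, le_rfl⟩ h1
  have hgt : ∀ s : ℝ, t < max s (t + 1) := fun s => (lt_add_one t).trans_le (le_max_right _ _)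
  have hbdd : BddAbove (range g) := ⟨b, by rintro _ ⟨s, rfl⟩; exact (hU _ (hgt s)).1.2.le⟩
  set m := ⨆ s, g s
  have hma : a < m := (hU _ (hgt 0)).1.1.trans_le (le_ciSup hbdd 0)
  have hmb : m ≤ b := ciSup_le fun s => (hU _ (hgt s)).1.2.le
  have hψ : Tendsto ψ atTop (𝓝 m) := by
    refine (tendsto_atTop_ciSup hgm hbdd).congr' ?_
    filter_upwards [eventually_ge_atTop (t + 1)] with s hs
    simp only [hg, max_eq_left hs]
  have hω : Tendsto ω atTop (𝓝 (U m)) := by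
    have : Tendsto (fun s => U (ψ s)) atTop (𝓝 (U m)) := by
      refine (hl.contU m ⟨hma.le, hmb⟩).tendsto.comp (tendsto_nhdsWithin_iff.2 ⟨hψ, ?_⟩)
      filter_upwards [eventually_gt_atTop t] with s hs using Ioo_subset_Icc_self (hU s hs).1
    refine this.congr' ?_
    filter_upwards [eventually_gt_atTop t] with s hs using (hU s hs).2.symm
  have hUm : U m = 0 := tendsto_deriv_eq_zero h.derivψ hψ hω
  have hm : m = b := by
    by_contra hne
    exact (hl.U_pos m ⟨hma, lt_of_le_of_ne hmb hne⟩).ne' hUm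
  have hφm : φ m (U m) = 0 := tendsto_deriv_eq_zero h.derivω hω
    ((hφ.tendsto (m, U m)).comp (hψ.prodMk_nhds hω))
  rw [hUm, hm] at hφm
  exact hφb.ne hφm

lemma continuous_reflect (hφ : Continuous fun p : ℝ × ℝ => φ p.1 p.2) :
    Continuous fun p : ℝ × ℝ => -φ (-p.1) (-p.2) :=
  (hφ.comp (continuous_neg : Continuous fun p : ℝ × ℝ => -p)).neg

/-- An orbit on a loop passes through the left end. -/
lemma exists_left_end (hl : Loop lo hi a b U L) (h : LoopOrbit φ a b U L ψ ω)
    (hφ : Continuous fun p : ℝ × ℝ => φ p.1 p.2) (hφa : 0 < φ a 0) (hφb : φ b 0 < 0) :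
    ∃ τ > 0, ψ τ = a ∧ ω τ = 0 := by
  have hleft : ∀ t > 0, (ω t < 0 ∨ (ω t = 0 ∧ ψ t = b)) → ∃ τ > 0, ψ τ = a ∧ ω τ = 0 := by
    intro t ht hp
    obtain ⟨τ, h1, h2, h3, -⟩ := h.reflect.exists_right hl.reflect (continuous_reflect hφ)
      (by simpa using hφb) (by simpa using hφa) ht (by simpa using hp)
    exact ⟨τ, ht.trans h1, neg_injective h2, neg_eq_zero.1 h3⟩
  have hright : ∀ t > 0, (0 < ω t ∨ (ω t = 0 ∧ ψ t = a)) → ∃ τ > 0, ψ τ = a ∧ ω τ = 0 := by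
    intro t ht hp
    obtain ⟨τ, h1, h2, h3, -⟩ := h.exists_right hl hφ hφa hφb ht hp
    exact hleft τ (ht.trans h1) (Or.inr ⟨h3, h2⟩)
  rcases lt_trichotomy (ω 1) 0 with h0 | h0 | h0
  · exact hleft 1 one_pos (Or.inl h0)
  · obtain ⟨h1, h2, h3⟩ := h.onLoop 1 one_pos
    by_cases ha : ψ 1 = a
    · exact hright 1 one_pos (Or.inr ⟨h0, ha⟩)
    by_cases hb : ψ 1 = b
    · exact hleft 1 one_pos (Or.inr ⟨h0, hb⟩)
    have hm : ψ 1 ∈ Ioo a b := ⟨lt_of_le_of_ne h1 (Ne.symm ha), lt_of_le_of_ne h2 hb⟩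
    have := hl.U_pos _ hm
    have := hl.L_pos _ hm
    rcases h3 with h3 | h3 <;> linarith
  · exact hright 1 one_pos (Or.inl h0)

/-- An orbit on a loop runs along the whole upper half of the loop, where its acceleration is
the one that defines the loop. -/
lemma eq_hi (hl : Loop lo hi a b U L) (h : LoopOrbit φ a b U L ψ ω)
    (hφ : Continuous fun p : ℝ × ℝ => φ p.1 p.2) (hφa : 0 < φ a 0) (hφb : φ b 0 < 0)
    {s : ℝ} (hs : s ∈ Ioo a b) : φ s (U s) = hi s (U s) := by
  obtain ⟨t, ht, hta, ht0⟩ := h.exists_left_end hl hφ hφa hφb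
  obtain ⟨τ, hτ, hτb, -, hpos⟩ := h.exists_right hl hφ hφa hφb ht (Or.inr ⟨ht0, hta⟩)
  have hψc : ContinuousOn ψ (Icc t τ) := fun r hr =>
    (h.derivψ r (ht.trans_le hr.1)).continuousAt.continuousWithinAt
  obtain ⟨r, hr, rfl⟩ := intermediate_value_Ioo hτ.le hψc (by rwa [hta, hτb])
  have hr0 : 0 < r := ht.trans hr.1
  have hωr := hpos r hr
  have hU : ω =ᶠ[𝓝 r] fun u => U (ψ u) := by
    filter_upwards [Ioo_mem_nhds hr.1 hr.2] with u hu
    exact (h.eq_U_of_pos hl (ht.trans hu.1) (hpos u hu)).2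
  have h1 := ((hl.derivU _ hs).comp r (h.derivψ r hr0)).congr_of_eventuallyEq hU
  have h2 := (h.derivω r hr0).unique h1
  rwa [hU.eq_of_nhds, div_mul_cancel₀ _ (hl.U_pos _ hs).ne'] at h2

lemma eq_lo (hl : Loop lo hi a b U L) (h : LoopOrbit φ a b U L ψ ω)
    (hφ : Continuous fun p : ℝ × ℝ => φ p.1 p.2) (hφa : 0 < φ a 0) (hφb : φ b 0 < 0)
    {s : ℝ} (hs : s ∈ Ioo a b) : φ s (-L s) = lo s (-L s) := by
  have := h.reflect.eq_hi hl.reflect (continuous_reflect hφ) (by simpa using hφb)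
    (by simpa using hφa) (s := -s) ⟨neg_lt_neg hs.2, neg_lt_neg hs.1⟩
  simpa using this

end LoopOrbit

/-! ### Convergence to the origin. -/

namespace InverterSystem
variable {S : InverterSystem} {P : Matrix (Fin 4) (Fin 4) ℝ}

namespace CycleFamily
variable {Vbar Vmax : ℝ} {C : ℝ → Set (ℝ × ℝ)} (H : S.CycleFamily P Vbar Vmax C)
include H

/-- No solution with `x = 0` stays on a limit cycle of the family. -/
theorem not_solution_on_cycle {V : ℝ} (hV : V ∈ Ioc 0 Vbar) {w : ℝ → State} (hc : Continuous w)
    (hw : S.IsSolutionOn w (Ici 0)) (hx : ∀ t ≥ 0, (w t).2.2 = 0)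
    (hC : ∀ t ≥ 0, ((w t).1, (w t).2.1) ∈ C V) : False := by
  obtain ⟨a, b, U, L, hl, hCl⟩ := H.exists_loop hV
  have hns := H.nonsing' hV.2
  set φ : ℝ → ℝ → ℝ := fun s v => -S.ki * S.f (s + S.κ * v) v 0 with hφd
  have hφ : Continuous fun p : ℝ × ℝ => φ p.1 p.2 := by
    have hg : Continuous fun p : ℝ × ℝ => S.g p.1 p.2 := S.g_smooth.continuous
    have : Continuous fun p : ℝ × ℝ => S.g (p.1 + S.κ * p.2) p.2 :=
      hg.comp (by fun_prop : Continuous fun p : ℝ × ℝ => (p.1 + S.κ * p.2, p.2))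
    simp only [hφd, InverterSystem.f, dotProduct_zero, sub_zero]
    exact continuous_const.mul (this.div_const _)
  have hacc := S.acc_mem H.posDef hV.1.le hns (x := 0) (by rw [VCC_zero]; exact hV.1.le)
  have hφa : 0 < φ a 0 := hl.lo_left.trans_le (hacc a 0).1
  have hφb : φ b 0 < 0 := (hacc b 0).2.trans_lt hl.hi_right
  have hO : LoopOrbit φ a b U L (fun t => (w t).1 - S.κ * (w t).2.1) (fun t => (w t).2.1) :=
    { cont := by fun_prop
      derivψ := fun t ht => (hw.hasDerivWithinAt_ψ (le_of_lt ht)).hasDerivAt (Ici_mem_nhds ht)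
      derivω := fun t ht => by
        have := (hw.hasDerivWithinAt_ω (le_of_lt ht)).hasDerivAt (Ici_mem_nhds ht)
        rw [hx t (le_of_lt ht)] at this
        simpa only [hφd, sub_add_cancel] using this
      onLoop := fun t ht => (hCl _).1 (hC t (le_of_lt ht)) }
  obtain ⟨p, hp, hp0, hnd⟩ := H.exists_nondegenerate hV
  have hlt := S.acc_zero_lt_and_gt (s := p.1 - S.κ * p.2) (w := p.2) H.posDef hV.1 hns
    (by rwa [sub_add_cancel])
  obtain ⟨h1, h2, h3 | h3⟩ := (hCl p).1 hp
  · have hs := hl.mem_Ioo_of_U_ne h1 h2 (h3 ▸ hp0)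
    have := hO.eq_hi hl hφ hφa hφb hs
    rw [← h3] at this
    exact hlt.1.ne this
  · have hs := hl.mem_Ioo_of_L_ne h1 h2 (by intro h; rw [h] at h3; exact hp0 (by simpa using h3))
    have := hO.eq_lo hl hφ hφa hφb hs
    rw [← h3] at this
    exact hlt.2.ne' this

end CycleFamily

namespace BoundedGrowth
variable {γ Vbar Vmax : ℝ} {C : ℝ → Set (ℝ × ℝ)} {F : ℝ → ℝ → ℝ} {Φ : ℝ → ℝ}
  (B : S.BoundedGrowth P γ Vbar Vmax C F Φ)
include B

lemma tendsto_VCC {z : ℝ → State} (hz : S.IsSolutionOn z (Ici 0)) :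
    Tendsto (fun t => VCC P (z t).2.2) atTop (𝓝 0) := by
  have h1 : Tendsto (fun t : ℝ => Real.exp (-γ * (t - 0)) * VCC P (z 0).2.2) atTop
      (𝓝 (0 * VCC P (z 0).2.2)) := by
    refine Tendsto.mul_const _ (Real.tendsto_exp_atBot.comp ?_)
    simp only [sub_zero]
    exact tendsto_id.const_mul_atTop_of_neg (neg_neg_of_pos B.lyap.2.1)
  rw [zero_mul] at h1
  refine squeeze_zero' (Eventually.of_forall fun t => VCC_nonneg B.posDef _) ?_ h1
  filter_upwards [eventually_ge_atTop 0] with t ht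
  exact (hz.mono Icc_subset_Ici_self).VCC_le B.lyap ⟨ht, le_rfl⟩

lemma tendsto_x {z : ℝ → State} (hz : S.IsSolutionOn z (Ici 0)) :
    Tendsto (fun t => (z t).2.2) atTop (𝓝 0) := by
  obtain ⟨c, hc, hco⟩ := exists_coercive B.posDef
  have h1 : Tendsto (fun t => √(VCC P (z t).2.2 / c)) atTop (𝓝 0) := by
    have := ((B.tendsto_VCC hz).div_const c).sqrt
    rwa [zero_div, Real.sqrt_zero] at this
  refine squeeze_zero_norm (fun t => Real.le_sqrt_of_sq_le ?_) h1
  rw [le_div_iff₀ hc, mul_comm]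
  exact hco _

/-- `V^PLL` tends to zero along the solutions that stay in the improved set. -/
theorem tendsto_VPLL {z : ℝ → State} (hz : S.IsSolutionOn z (Ici 0))
    (hW : ∀ t ≥ 0, z t ∈ improvedSet P Vbar Vmax C Φ) :
    Tendsto (fun t => VPLL Vbar C ((z t).1, (z t).2.1)) atTop (𝓝 0) := by
  set v : ℝ → ℝ := fun t => VPLL Vbar C ((z t).1, (z t).2.1) with hv
  have hvI : ∀ t ≥ 0, v t ∈ Icc 0 Vbar := fun t ht => (B.VPLL_spec (hW t ht).1).1
  set A : Set ℝ := {V | V ∈ Ioc 0 Vbar ∧ ∃ t ≥ 0, v t ≤ V ∧ VCC P (z t).2.2 ≤ V} with hA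
  have hVcc := B.tendsto_VCC hz
  have hAV : Vbar ∈ A := by
    obtain ⟨t, h1, h2⟩ := ((hVcc.eventually_le_const B.Vbar_pos).and
      (eventually_ge_atTop 0)).exists
    exact ⟨⟨B.Vbar_pos, le_rfl⟩, t, h2, (hvI t h2).2, h1⟩
  -- Once both functions are at most V, the invariance of Λ(V) keeps V^PLL there forever.
  have hpers : ∀ V ∈ A, ∀ᶠ t in atTop, v t ≤ V := by
    rintro V ⟨hV, t, ht, h1, h2⟩
    filter_upwards [eventually_ge_atTop t] with s hs
    have hs0 : 0 ≤ s := ht.trans hs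
    refine (B.VPLL_le_iff hV (hW s hs0).1).2 ?_
    exact B.mem_region_of_mem_region B.lyap hV
      (hz.mono (Icc_subset_Ici_self.trans (Ici_subset_Ici.2 ht))) h2
      ((B.VPLL_le_iff hV (hW t ht).1).1 h1) s ⟨hs, le_rfl⟩
  have hAb : BddBelow A := ⟨0, fun V hV => hV.1.1.le⟩
  set m := sInf A with hm
  have hm0 : 0 ≤ m := le_csInf ⟨_, hAV⟩ fun V hV => hV.1.1.le
  have hmV : m ≤ Vbar := csInf_le hAb hAV
  have hup : ∀ c > m, ∀ᶠ t in atTop, v t < c := by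
    intro c hc
    obtain ⟨V, hV, hVc⟩ := exists_lt_of_csInf_lt ⟨_, hAV⟩ hc
    filter_upwards [hpers V hV] with t ht using ht.trans_lt hVc
  have hvm : Tendsto v atTop (𝓝 m) := by
    refine tendsto_order.2 ⟨fun c hc => ?_, hup⟩
    rcases hm0.eq_or_lt with h0 | h0
    · filter_upwards [eventually_ge_atTop 0] with t ht
      exact (hc.trans_eq h0.symm).trans_le (hvI t ht).1
    filter_upwards [eventually_ge_atTop 0, hVcc.eventually_lt_const h0] with t ht h1
    refine hc.trans_le (le_of_not_gt fun hlt => ?_)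
    -- If V^PLL dropped below m at a time when V^CC < m, a level between them and m would belong to
    -- A, against the choice of m.
    obtain ⟨V, hV1, hV2⟩ := exists_between (max_lt hlt h1)
    have hV0 : 0 < V := ((hvI t ht).1.trans (le_max_left _ _)).trans_lt hV1
    have : V ∈ A := ⟨⟨hV0, hV2.le.trans hmV⟩, t, ht, (le_max_left _ _).trans hV1.le,
      (le_max_right _ _).trans hV1.le⟩
    exact absurd (csInf_le hAb this) (not_le.2 hV2)
  rcases hm0.eq_or_lt with h0 | h0
  · rwa [← h0] at hvm
  exfalso
  -- a limit solution stays on the cycle of parameter `m`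
  set K : Set State := {z | (z.1, z.2.1) ∈ closedRegion (C Vbar) ∧ VCC P z.2.2 ≤ Vmax}
  have hKc : IsCompact K := B.isCompact_states
  have hzK : ∀ t ≥ 0, z t ∈ K := fun t ht => ⟨(hW t ht).1, (hW t ht).2.1⟩
  obtain ⟨z₁, -, hcl⟩ := hKc.exists_mapClusterPt (f := atTop) (u := z)
    (tendsto_principal.2 ((eventually_ge_atTop 0).mono hzK))
  obtain ⟨𝒰, h𝒰, hlim⟩ := mapClusterPt_iff_ultrafilter.1 hcl
  obtain ⟨G, M, N, hG, hN, hGF⟩ := exists_lipschitz_cutoff isOpen_nonsingular hKc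
    (fun w hw => B.nonsing _ hw.2) S.contDiffOn_field
  obtain ⟨w, hw0, hw⟩ := exists_global_integralCurve hG hN z₁
  have hge : ∀ᶠ t in (𝒰 : Filter ℝ), 0 ≤ t := h𝒰 (eventually_ge_atTop 0)
  -- Continuous dependence on initial data: time shifts of z converge, along the ultrafilter, to the
  -- integral curve through the cluster point.
  have hshift : ∀ s ≥ 0, Tendsto (fun t => z (t + s)) 𝒰 (𝓝 (w s)) := by
    intro s hs
    have h1 : Tendsto (fun t => dist (z t) z₁ * Real.exp (M * (s - 0))) 𝒰 (𝓝 0) := by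
      have := (tendsto_iff_dist_tendsto_zero.1 hlim).mul_const (Real.exp (M * (s - 0)))
      rwa [zero_mul] at this
    rw [tendsto_iff_dist_tendsto_zero]
    refine squeeze_zero' (Eventually.of_forall fun _ => dist_nonneg) ?_ h1
    filter_upwards [hge] with t ht
    have hder : ∀ r ≥ 0, HasDerivWithinAt (fun r => z (t + r)) (G (z (t + r))) (Ici r) r := by
      intro r hr
      have htr : 0 ≤ t + r := add_nonneg ht hr
      rw [(hGF _ (hzK _ htr)).eq_of_nhds]
      have h2 := (hz (t + r) htr).2.mono (Ici_subset_Ici.2 htr)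
      have h3 : HasDerivWithinAt (fun r : ℝ => t + r) 1 (Ici r) r :=
        ((hasDerivAt_id r).const_add t).hasDerivWithinAt
      have := h2.scomp r h3 (fun u hu => add_le_add_right hu t)
      rwa [one_smul] at this
    have hcz : ContinuousOn (fun r => z (t + r)) (Icc 0 s) :=
      hz.continuousOn.comp (by fun_prop) fun r hr => add_nonneg ht hr.1
    have := dist_le_of_trajectories_ODE (v := fun _ => G) (fun _ => hG) hcz
      (fun r hr => hder r hr.1) (fun r _ => (hw r).continuousAt.continuousWithinAt)
      (fun r _ => (hw r).hasDerivWithinAt) (δ := dist (z t) z₁) (by rw [hw0, add_zero]) s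
      ⟨hs, le_rfl⟩
    exact this
  have hadd : ∀ s : ℝ, Tendsto (fun t => t + s) 𝒰 atTop := fun s =>
    (tendsto_atTop_add_const_right _ s tendsto_id).mono_left h𝒰
  have hge' : ∀ s ≥ 0, ∀ᶠ t in (𝒰 : Filter ℝ), z (t + s) ∈ K := fun s hs =>
    hge.mono fun t ht => hzK _ (add_nonneg ht hs)
  have hwK : ∀ s ≥ 0, w s ∈ K := fun s hs => hKc.isClosed.mem_of_tendsto (hshift s hs) (hge' s hs)
  have hsol : S.IsSolutionOn w (Ici 0) := fun s hs =>
    ⟨B.nonsing _ (hwK s hs).2, by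
      rw [← (hGF _ (hwK s hs)).eq_of_nhds]; exact (hw s).hasDerivWithinAt⟩
  have hxw : ∀ s ≥ 0, (w s).2.2 = 0 := fun s hs =>
    tendsto_nhds_unique (((by fun_prop : Continuous fun z : State => z.2.2).tendsto _).comp
      (hshift s hs)) ((B.tendsto_x hz).comp (hadd s))
  have hCw : ∀ s ≥ 0, ((w s).1, (w s).2.1) ∈ C m := by
    intro s hs
    have h1 : Tendsto (fun t => ((z (t + s)).1, (z (t + s)).2.1)) 𝒰
        (𝓝[closedRegion (C Vbar)] ((w s).1, (w s).2.1)) :=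
      tendsto_nhdsWithin_iff.2 ⟨((by fun_prop : Continuous fun z : State => (z.1, z.2.1)).tendsto
        _).comp (hshift s hs), (hge' s hs).mono fun t ht => ht.1⟩
    have h2 := (B.continuousOn_VPLL _ (hwK s hs).1).tendsto.comp h1
    have h3 := tendsto_nhds_unique h2 (hvm.comp (hadd s))
    have := (B.VPLL_spec (hwK s hs).1).2
    rwa [h3] at this
  exact B.not_solution_on_cycle ⟨h0, hmV⟩
    (continuous_iff_continuousAt.2 fun t => (hw t).continuousAt) hsol hxw hCw

/-- V^PLL → 0 gives convergence in the plane because the curves C V shrink into every neighbourhood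
of the origin. -/
theorem tendsto_zero {z : ℝ → State} (hz : S.IsSolutionOn z (Ici 0))
    (hW : ∀ t ≥ 0, z t ∈ improvedSet P Vbar Vmax C Φ) : Tendsto z atTop (𝓝 0) := by
  have hy : Tendsto (fun t => ((z t).1, (z t).2.1)) atTop (𝓝 (0 : ℝ × ℝ)) := by
    rw [(nhds_basis_opens (0 : ℝ × ℝ)).tendsto_right_iff]
    rintro O ⟨hO0, hO⟩
    have h1 := B.eventually_not_meets hO.isClosed_compl (V₀ := 0) (by
      intro q hq
      rw [B.zero, mem_singleton_iff] at hq
      rw [hq]; exact fun h => h hO0)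
    have h2 : Tendsto (fun t => VPLL Vbar C ((z t).1, (z t).2.1)) atTop (𝓝[Icc 0 Vbar] 0) :=
      tendsto_nhdsWithin_iff.2 ⟨B.tendsto_VPLL hz hW, (eventually_ge_atTop 0).mono fun t ht =>
        (B.VPLL_spec (hW t ht).1).1⟩
    filter_upwards [h2.eventually h1, eventually_ge_atTop 0] with t ht h0
    exact not_not.1 (ht _ (B.VPLL_spec (hW t h0).1).2)
  have h1 := ((continuous_fst.tendsto _).comp hy).prodMk_nhds
    (((continuous_snd.tendsto _).comp hy).prodMk_nhds (B.tendsto_x hz))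
  exact h1

/-- The integral curve of the cut-off field is global and never leaves the improved set, where the
field is unmodified; hence it solves the original system for all t ≥ 0. -/
theorem subset_lockInDomain (hpi : ∀ p ∈ closedRegion (C Vbar), |p.1| ≤ Real.pi) :
    improvedSet P Vbar Vmax C Φ ⊆ S.lockInDomain := by
  intro z₀ h0
  obtain ⟨G, M, N, hG, hN, hGF⟩ := exists_lipschitz_cutoff isOpen_nonsingular B.isCompact_states
    (fun w hw => B.nonsing _ hw.2) S.contDiffOn_field
  obtain ⟨ζ, hζ0, hζ⟩ := exists_global_integralCurve hG hN z₀
  have hW : ∀ t ≥ 0, ζ t ∈ improvedSet P Vbar Vmax C Φ := fun t ht =>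
    B.integralCurve_mem hG hN (fun w h1 h2 => hGF w ⟨h1, h2⟩) hζ (hζ0 ▸ h0) ht
  have hsol : S.IsSolutionOn ζ (Ici 0) := fun t ht =>
    ⟨B.nonsing _ (hW t ht).2.1, by
      rw [← (hGF _ ⟨(hW t ht).1, (hW t ht).2.1⟩).eq_of_nhds]; exact (hζ t).hasDerivWithinAt⟩
  exact ⟨ζ, hsol, hζ0, B.tendsto_zero hsol hW, fun t ht => hpi _ (hW t ht).1⟩

end BoundedGrowth
end InverterSystem

end

theorem mainTheorem2 (S : InverterSystem) (hS : S.OscillatoryStable)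
    (P : Matrix (Fin 4) (Fin 4) ℝ) (γ : ℝ) (hP : S.IsCCLyapunov P γ)
    (Vbar Vmax : ℝ) (hVbar : 0 < Vbar) (hVmax : Vbar < Vmax)
    (hns : ∀ x, VCC P x ≤ Vmax → S.Nonsingular x)
    (C : ℝ → Set (ℝ × ℝ)) (hC : S.IsLimitCycleFamily P Vbar C)
    (hpi : ∀ p ∈ closedRegion (C Vbar), |p.1| ≤ Real.pi)
    (F : ℝ → ℝ → ℝ) (hF : S.IsGrowthBound P Vbar Vmax C F)
    (Φ : ℝ → ℝ) (hΦ_const : ∀ V ∈ Icc 0 Vbar, Φ V = Vbar)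
    (hΦ_ode : ∀ V ∈ Icc Vbar Vmax,
      HasDerivWithinAt Φ (-F (Φ V) V / (γ * V)) (Icc Vbar Vmax) V)
    (hΦ_range : ∀ V ∈ Ico Vbar Vmax, 0 < Φ V ∧ Φ V ≤ Vbar)
    (hΦ_end : Φ Vmax = 0) :
    S.IsLockInEstimation (improvedSet P Vbar Vmax C Φ) := by
  have B : S.BoundedGrowth P γ Vbar Vmax C F Φ :=
    { posDef := hP.1
      Vbar_pos := hVbar
      lt := hVmax
      nonsing := hns
      family := hC
      lyap := hP
      growth := hF
      const := hΦ_const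
      ode := hΦ_ode
      pos := hΦ_range
      end_zero := hΦ_end }
  exact ⟨B.forwardInvariant, B.subset_lockInDomain hpi⟩
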